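/- Let $n\ge 1$ and let $\Omega\subset\mathbb{R}^n$ be a bounded open set with $C^2$ boundary, inward unit normal $\nu$, and scalar mean curvature $\kappa$ of $\partial\Omega$ (the sum of the principal curvatures, equal to $n-1$ for the unit ball). Let $a<b$ and let $W:\mathbb{R}\to[0,\infty)$ be continuous with $W^{-1}(\{0\})=\{a,b\}$ and $W\in C^2(\mathbb{R}\setminus\{a,b\})$, and such that for some $q\in(0,1)$ the limits $\lim_{s\to a}W''(s)|s-a|^{1-q}$ and $\lim_{s\to b}W''(s)|s-b|^{1-q}$ exist in $(0,\infty)$. Put $\mathrm{d}_W(r,s)=\left|\int_r^s 2\sqrt{W(\rho)}\,d\rho\right|$ and $C_W=\mathrm{d}_W(a,b)$. For $\alpha\in[a,b]$ let $\Psi_\alpha(x)=\int_\alpha^x W(s)^{-1/2}\,ds$ for $x \in [\alpha,b]$, and let $z_\alpha:[0,\infty)\to[a,b]$ be $\Psi_\alpha^{-1}$ on $[0,\Psi_\alpha(b)]$ and $b$ on $(\Psi_\alpha(b),\infty)$ (so $z_\alpha'=\sqrt{W(z_\alpha)}$ and $z_\alpha(0)=\alpha$). Let $g\in C^2(\partial\Omega;[a,b])$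 with $\{g=a\}\subseteq\{\kappa<0\}$. For $\varepsilon>0$ let $g_\varepsilon\in H^1(\partial\Omega)$ with values in $[a,b]$ be such that there are $\alpha_-\in(a,b)$ and $\kappa_0<0$ for which, for all sufficiently small $\varepsilon>0$ and $\mathcal{H}^{n-1}$-a.e. $y\in\partial\Omega$, $g_\varepsilon(y)\in[\alpha_-,b]$ or $\kappa(y)\le\kappa_0$; and such that, as $\varepsilon\to0^+$, $g_\varepsilon\to g$ $\mathcal{H}^{n-1}$-a.e. on $\partial\Omega$, $$\int_{\partial\Omega}\frac{\mathrm{d}_W(g_\varepsilon,g)}{\varepsilon}\,d\mathcal{H}^{n-1}\to0\qquad\text{and}\qquad \varepsilon\int_{\partial\Omega}\frac{|\nabla_\tau g_\varepsilon|^2}{W(g_\varepsilon)}\,d\mathcal{H}^{n-1}\to0,$$ where $\nabla_\tau$ is the tangential gradient and the last integrand is read as $0$ where $g_\varepsilon\in\{a,b\}$. For $u\in L^1(\Omega)$ let $$\mathcal{F}^{(1)}(u)=\frac{C_W}{b-a}|Du|(\Omega)+\int_{\partial\Omega}\mathrm{d}_W(u,g)\,d\mathcal{H}^{n-1}\ \text{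 if } u\in BV(\Omega;\{a,b\}),\qquad \mathcal{F}^{(1)}(u)=\infty\ \text{ otherwise},$$ $$\mathcal{F}^{(2)}_\varepsilon(u)=\int_\Omega\Big(\frac{W(u)}{\varepsilon^2}+|\nabla u|^2\Big)dx-\frac1\varepsilon\int_{\partial\Omega}\mathrm{d}_W(b,g)\,d\mathcal{H}^{n-1}\ \text{ if } u\in H^1(\Omega)\text{ and }u=g_\varepsilon\text{ on }\partial\Omega,$$ and $\mathcal{F}^{(2)}_\varepsilon(u)=\infty$ otherwise; boundary values are meant in the sense of traces. Theorem. Assume that the constant function $b$ is the unique minimizer of $\mathcal{F}^{(1)}$ on $L^1(\Omega)$. Then there is a family $(u_\varepsilon)_{\varepsilon>0}$ in $L^1(\Omega)$ such that $u_\varepsilon\in H^1(\Omega)$ and $u_\varepsilon=g_\varepsilon$ on $\partial\Omega$ for every $\varepsilon>0$, $u_\varepsilon\to b$ in $L^1(\Omega)$ as $\varepsilon\to0^+$, and $$\limsup_{\varepsilon\to0^+}\mathcal{F}^{(2)}_\varepsilon(u_\varepsilon)\le\int_{\partial\Omega}-\kappa(y)\int_0^\infty \mathrm{d}_W\big(z_{g(y)}(s),b\big)\,ds\,d\mathcal{H}^{n-1}(y).$$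 Moreover, $(u_\varepsilon)$ can be chosen so that there are $\delta,\varepsilon_0>0$ with the following property for every $\varepsilon\in(0,\varepsilon_0)$: $u_\varepsilon(y+t\nu(y))=z_{g_\varepsilon(y)}(t/\varepsilon)$ for $\mathcal{H}^{n-1}$-a.e. $y\in\partial\Omega$ and all $t\in(0,\delta)$, and $u_\varepsilon(x)=b$ for every $x\in\Omega$ with $\mathrm{dist}(x,\partial\Omega)\ge\delta$. -/

import Mathlib

open MeasureTheory Set Filter Topology
open scoped ENNReal ContDiff

noncomputable section

namespace CahnHilliard

/-- The Euclidean space `ℝⁿ`. -/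
abbrev E (n : ℕ) : Type := EuclideanSpace ℝ (Fin n)

/-! ### The potential, the geodesic distance, the optimal profile -/

/-- A continuous double-well potential `W : ℝ → [0, ∞)` with wells `a < b`, of class `C²` off the
wells, with subquadratic growth at the wells: for some `q ∈ (0,1)` the limits of
`W''(s) |s - a|^(1-q)` as `s → a` and of `W''(s) |s - b|^(1-q)` as `s → b` exist in `(0, ∞)`. -/
structure IsSubquadraticDoubleWell (W : ℝ → ℝ) (a b : ℝ) : Prop where
  lt : a < b
  continuous : Continuous W
  nonneg : ∀ s, 0 ≤ W s
  zero_iff : ∀ s, W s = 0 ↔ s = a ∨ s = b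
  contDiffOn : ContDiffOn ℝ 2 W {a, b}ᶜ
  growth : ∃ q : ℝ, 0 < q ∧ q < 1 ∧
    (∃ L : ℝ, 0 < L ∧
      Tendsto (fun s => iteratedDeriv 2 W s * |s - a| ^ (1 - q)) (𝓝[≠] a) (𝓝 L)) ∧
    (∃ L : ℝ, 0 < L ∧
      Tendsto (fun s => iteratedDeriv 2 W s * |s - b| ^ (1 - q)) (𝓝[≠] b) (𝓝 L))

/-- The geodesic distance `d_W(r, s) = |∫_r^s 2 √W(ρ) dρ|`. -/
def geodesicDist (W : ℝ → ℝ) (r s : ℝ) : ℝ := |∫ ρ in r..s, 2 * √(W ρ)|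

/-- `Ψ_α(x) = ∫_α^x W(s)^(-1/2) ds`. -/
def travelTime (W : ℝ → ℝ) (α x : ℝ) : ℝ := ∫ s in α..x, 1 / √(W s)

/-- The optimal profile `z_α`: the inverse of `Ψ_α : [α, b] → [0, Ψ_α(b)]`, continued by `b`. It
solves `z' = √W(z)`, `z(0) = α`, and leaves the well `a` at once if `α = a`. -/
def profile (W : ℝ → ℝ) (b α t : ℝ) : ℝ :=
  if t ≤ travelTime W α b then Function.invFunOn (travelTime W α) (Icc α b) t else b

/-! ### Domains with `C²` boundary and the geometry of the boundary -/

variable {n : ℕ}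

/-- The divergence of a vector field. -/
def divergence (X : E n → E n) (x : E n) : ℝ :=
  ∑ i, fderiv ℝ X x (EuclideanSpace.single i 1) i

/-- `φ` is a local `C²` defining function of `Ω` at `y`: it is `C²` near `y`, its gradient at `y`
does not vanish, and `Ω = {φ < 0}` near `y`. -/
structure IsLocalDefiningFunction (Ω : Set (E n)) (y : E n) (φ : E n → ℝ) : Prop where
  contDiffAt : ContDiffAt ℝ 2 φ y
  gradient_ne_zero : gradient φ y ≠ 0
  mem_iff : ∀ᶠ x in 𝓝 y, x ∈ Ω ↔ φ x < 0

/-- `Ω` is a bounded open set with boundary of class `C²`. -/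
structure IsC2Domain (Ω : Set (E n)) : Prop where
  isOpen : IsOpen Ω
  isBounded : Bornology.IsBounded Ω
  boundary : ∀ y ∈ frontier Ω, ∃ φ, IsLocalDefiningFunction Ω y φ

open Classical in
/-- A local defining function of `Ω` at the boundary point `y`. The normal and the mean curvature
computed from it do not depend on the choice. -/
def definingFunction (Ω : Set (E n)) (y : E n) : E n → ℝ :=
  if h : ∃ φ, IsLocalDefiningFunction Ω y φ then h.choose else 0

/-- The normalized gradient `∇φ / |∇φ|`. -/
def unitGradient (φ : E n → ℝ) (x : E n) : E n := ‖gradient φ x‖⁻¹ • gradient φ x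

/-- The inward unit normal `ν(y)` of `∂Ω`. -/
def inwardNormal (Ω : Set (E n)) (y : E n) : E n := -unitGradient (definingFunction Ω y) y

/-- The scalar mean curvature `κ(y)` of `∂Ω` (the sum of the principal curvatures), as the
divergence of the outward unit normal field `∇φ / |∇φ|`; it is `n - 1` for the unit ball. -/
def meanCurvature (Ω : Set (E n)) (y : E n) : ℝ :=
  divergence (unitGradient (definingFunction Ω y)) y

/-- The surface measure `ℋ^{n-1}` on `∂Ω`, normalized as in the area formula. -/
def surfaceMeasure (Ω : Set (E n)) : Measure (E n) :=
  (Measure.euclideanHausdorffMeasure (n - 1)).restrict (frontier Ω)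

/-- The tangential gradient on `∂Ω` of a `C¹` function on `ℝⁿ`. -/
def tangentialGradient (Ω : Set (E n)) (φ : E n → ℝ) (y : E n) : E n :=
  gradient φ y - inner ℝ (gradient φ y) (inwardNormal Ω y) • inwardNormal Ω y

/-! ### Function spaces -/

/-- `f ∈ C²(∂Ω)`: the restriction of `f` to `∂Ω` has a `C²` extension to `ℝⁿ`. -/
def IsC2OnBoundary (Ω : Set (E n)) (f : E n → ℝ) : Prop :=
  ∃ F : E n → ℝ, ContDiff ℝ 2 F ∧ EqOn F f (frontier Ω)

/-- `f ∈ H¹(∂Ω)` with tangential gradient `G`: `f` is an `L²(∂Ω)`-limit of `C¹` functions whose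
tangential gradients converge to `G` in `L²(∂Ω)`. -/
def HasSurfaceGradient (Ω : Set (E n)) (f : E n → ℝ) (G : E n → E n) : Prop :=
  MemLp f 2 (surfaceMeasure Ω) ∧ MemLp G 2 (surfaceMeasure Ω) ∧
  ∃ φ : ℕ → E n → ℝ, (∀ k, ContDiff ℝ 1 (φ k)) ∧
    Tendsto (fun k => eLpNorm (φ k - f) 2 (surfaceMeasure Ω)) atTop (𝓝 0) ∧
    Tendsto (fun k => eLpNorm (tangentialGradient Ω (φ k) - G) 2 (surfaceMeasure Ω)) atTop (𝓝 0)

/-- `f ∈ H¹(∂Ω)`. -/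
def MemH1Boundary (Ω : Set (E n)) (f : E n → ℝ) : Prop := ∃ G, HasSurfaceGradient Ω f G

open Classical in
/-- The tangential gradient `∇_τ f` of `f ∈ H¹(∂Ω)` (unique up to `ℋ^{n-1}`-null sets). -/
def surfaceGradient (Ω : Set (E n)) (f : E n → ℝ) : E n → E n :=
  if h : MemH1Boundary Ω f then h.choose else 0

/-- `u ∈ H¹(Ω)` with weak gradient `G`. -/
def HasWeakGradient (Ω : Set (E n)) (u : E n → ℝ) (G : E n → E n) : Prop :=
  MemLp u 2 (volume.restrict Ω) ∧ MemLp G 2 (volume.restrict Ω) ∧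
  ∀ φ : E n → ℝ, ContDiff ℝ ∞ φ → HasCompactSupport φ → tsupport φ ⊆ Ω →
    ∫ x in Ω, u x • gradient φ x = -∫ x in Ω, φ x • G x

/-- `u ∈ H¹(Ω)`. -/
def MemH1 (Ω : Set (E n)) (u : E n → ℝ) : Prop := ∃ G, HasWeakGradient Ω u G

open Classical in
/-- The weak gradient `∇u` of `u ∈ H¹(Ω)` (unique up to null sets). -/
def weakGradient (Ω : Set (E n)) (u : E n → ℝ) : E n → E n :=
  if h : MemH1 Ω u then h.choose else 0

/-- The total variation `|Du|(Ω)` of `u ∈ L¹(Ω)`. -/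
def totalVariation (Ω : Set (E n)) (u : E n → ℝ) : ℝ≥0∞ :=
  ⨆ (X : E n → E n) (_ : ContDiff ℝ 1 X) (_ : HasCompactSupport X) (_ : tsupport X ⊆ Ω)
    (_ : ∀ x, ‖X x‖ ≤ 1), ENNReal.ofReal (∫ x in Ω, u x * divergence X x)

/-- `u ∈ BV(Ω; {a, b})`. -/
def MemBVPhases (Ω : Set (E n)) (a b : ℝ) (u : E n → ℝ) : Prop :=
  MemLp u 1 (volume.restrict Ω) ∧ (∀ᵐ x ∂volume.restrict Ω, u x = a ∨ u x = b) ∧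
    totalVariation Ω u ≠ ⊤

/-- `u` has the boundary value (trace) `c` at `y ∈ ∂Ω`: the mean of `|u - c|` over `Ω ∩ B_r(y)`
tends to `0` as `r → 0`. A function in `BV(Ω)`, in particular in `H¹(Ω)`, has a trace at
`ℋ^{n-1}`-almost every `y`. -/
def HasTraceAt (Ω : Set (E n)) (u : E n → ℝ) (y : E n) (c : ℝ) : Prop :=
  Tendsto (fun r : ℝ => laverage (volume.restrict (Ω ∩ Metric.ball y r)) fun x => ‖u x - c‖ₑ)
    (𝓝[>] 0) (𝓝 0)

/-- `u = f` on `∂Ω` in the sense of traces. -/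
def HasTrace (Ω : Set (E n)) (u f : E n → ℝ) : Prop :=
  ∀ᵐ y ∂surfaceMeasure Ω, HasTraceAt Ω u y (f y)

open Classical in
/-- The trace of `u` on `∂Ω`. -/
def boundaryTrace (Ω : Set (E n)) (u : E n → ℝ) (y : E n) : ℝ :=
  if h : ∃ c, HasTraceAt Ω u y c then h.choose else 0

/-! ### The functionals -/

open Classical in
/-- The first-order limit functional
`F⁽¹⁾(u) = C_W / (b - a) |Du|(Ω) + ∫_{∂Ω} d_W(u, g) dℋ^{n-1}` on `BV(Ω; {a, b})`, and `∞`
otherwise, where `C_W = d_W(a, b)`. -/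
def firstOrderLimit (Ω : Set (E n)) (W : ℝ → ℝ) (a b : ℝ) (g : E n → ℝ) (u : E n → ℝ) : ℝ≥0∞ :=
  if MemBVPhases Ω a b u then
    ENNReal.ofReal (geodesicDist W a b / (b - a)) * totalVariation Ω u +
      ∫⁻ y, ENNReal.ofReal (geodesicDist W (boundaryTrace Ω u y) (g y)) ∂surfaceMeasure Ω
  else ⊤

/-- `u₀` is the unique minimizer of `F` on `L¹(Ω)`. -/
def IsUniqueMinimizer (Ω : Set (E n)) (F : (E n → ℝ) → ℝ≥0∞) (u₀ : E n → ℝ) : Prop :=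
  MemLp u₀ 1 (volume.restrict Ω) ∧
    ∀ u, MemLp u 1 (volume.restrict Ω) → ¬ u =ᵐ[volume.restrict Ω] u₀ → F u₀ < F u

open Classical in
/-- The second-order functional
`F_ε⁽²⁾(u) = ∫_Ω W(u)/ε² + |∇u|² dx - (1/ε) ∫_{∂Ω} d_W(b, g) dℋ^{n-1}` if `u ∈ H¹(Ω)` and
`u = g_ε` on `∂Ω`, and `∞` otherwise. -/
def secondOrderFunctional (Ω : Set (E n)) (W : ℝ → ℝ) (b : ℝ) (g gε : E n → ℝ) (ε : ℝ)
    (u : E n → ℝ) : EReal :=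
  if MemH1 Ω u ∧ HasTrace Ω u gε then
    ((∫⁻ x in Ω, ENNReal.ofReal (W (u x) / ε ^ 2 + ‖weakGradient Ω u x‖ ^ 2) : ℝ≥0∞) : EReal) -
      ((1 / ε * ∫ y, geodesicDist W b (g y) ∂surfaceMeasure Ω : ℝ) : EReal)
  else ⊤

/-- The value `∫_{∂Ω} -κ(y) ∫_0^∞ d_W(z_{g(y)}(s), b) ds dℋ^{n-1}(y)`. -/
def secondOrderLimit (Ω : Set (E n)) (W : ℝ → ℝ) (b : ℝ) (g : E n → ℝ) : ℝ :=
  ∫ y, -meanCurvature Ω y * (∫ s in Ioi (0 : ℝ), geodesicDist W (profile W b (g y) s) b)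
    ∂surfaceMeasure Ω

/-! ### The boundary data -/

/-- The limit boundary datum: `g ∈ C²(∂Ω; [a, b])` with `{g = a} ⊆ {κ < 0}`. -/
structure IsLimitDatum (Ω : Set (E n)) (a b : ℝ) (g : E n → ℝ) : Prop where
  isC2 : IsC2OnBoundary Ω g
  mem_Icc : ∀ y ∈ frontier Ω, g y ∈ Icc a b
  curvature : ∀ y ∈ frontier Ω, g y = a → meanCurvature Ω y < 0

/-- The approximating boundary data `g_ε ∈ H¹(∂Ω; [a, b])`, `ε > 0`, of the limit datum `g`. -/
structure IsApproximatingData (Ω : Set (E n)) (W : ℝ → ℝ) (a b : ℝ) (g : E n → ℝ)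
    (gε : ℝ → E n → ℝ) : Prop where
  memH1 : ∀ ε, 0 < ε → MemH1Boundary Ω (gε ε)
  mem_Icc : ∀ ε, 0 < ε → ∀ᵐ y ∂surfaceMeasure Ω, gε ε y ∈ Icc a b
  curvature : ∃ α κ₀ : ℝ, a < α ∧ α < b ∧ κ₀ < 0 ∧
    ∀ᶠ ε in 𝓝[>] (0 : ℝ), ∀ᵐ y ∂surfaceMeasure Ω,
      gε ε y ∈ Icc α b ∨ meanCurvature Ω y ≤ κ₀
  tendsto_ae : ∀ᵐ y ∂surfaceMeasure Ω, Tendsto (fun ε => gε ε y) (𝓝[>] 0) (𝓝 (g y))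
  tendsto_dist : Tendsto
    (fun ε => ∫⁻ y, ENNReal.ofReal (geodesicDist W (gε ε y) (g y) / ε) ∂surfaceMeasure Ω)
    (𝓝[>] 0) (𝓝 0)
  tendsto_gradient : Tendsto
    (fun ε => ENNReal.ofReal ε *
      ∫⁻ y, ENNReal.ofReal (‖surfaceGradient Ω (gε ε) y‖ ^ 2 / W (gε ε y)) ∂surfaceMeasure Ω)
    (𝓝[>] 0) (𝓝 0)

end CahnHilliard

end

noncomputable section

namespace CahnHilliard

/-! ### The travel time and the optimal profile -/

/-! The competitor is the ansatz itself: `u_ε(y + tν(y)) = z_{g_ε(y)}(t/ε)` in a collar of the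
boundary and `u_ε = b` elsewhere. The work consists in showing that this is an `H¹` function with
trace `g_ε`, and in computing its energy to first order in the depth.

In one dimension, subquadratic growth gives `W ≥ c t^(1+q)` at distance `t` from a well. Hence
`W^(-1/2)` is integrable on `[a, b]`, and every profile reaches `b` within the finite time `T =
Ψ_a(b)`. All profiles are translates of a single `C¹` curve `ζ`, the `heteroclinic`: `z_α(t) =
ζ(Ψ_a(α) + t)`. From `ζ' = √W(ζ)` the derivative of `d_W(ζ, b)` is `-2W(ζ)`. This yields the two
identities that produce the limit: `∫ 2W(z_α) ds = d_W(α, b)` and, after an integration by parts, `∫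
2W(z_α) s ds = ∫ d_W(z_α, b) ds` (`integral_two_mul_heteroclinic`,
`integral_two_mul_heteroclinic_mul`).

In normal coordinates, Lebesgue measure is `J(y, t) dt dℋ^{n-1}(y)` with `J = det(1 + t Dν) = 1 -
κ(y)t + o(t)`, uniformly in `y` (`lintegral_inside`, `exists_jacobian_sub_le`). The gradient of the
layer splits orthogonally (`norm_layerGrad_sq_le`). The normal part contributes `W(u)/ε²`, equal to
the potential term. The tangential part is at most a constant times `|∇_τ g_ε|²/W(g_ε)` and lives in
depth less than `εT`, so that it costs `O(ε ∫ |∇_τ g_ε|²/W(g_ε))`, which tends to zero. For `η > 0`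
and `ε` small, each normal segment therefore costs at most `d_W(g_ε, b)/ε + (η - κ) ∫ d_W(z_{g_ε},
b) ds`, apart from the tangential cost. The triangle inequality replaces `g_ε` by `g` in the
singular term, up to `∫ d_W(g_ε, g)/ε → 0`. Dominated convergence treats the second term, and `η` is
arbitrary. This is `eventually_secondOrderFunctional_le`.

Two points of regularity remain. The travel time is not `C¹` at the wells and `g_ε` is merely `H¹`,
so `hasWeakGradient_layer` obtains the weak gradient by a double limit: from `C¹` data to `H¹` data
with a regularized slowness, then from the regularized to the true slowness. The second limit is
dominated because `∇_τ g_ε/√W(g_ε)` is in `L²` for small `ε`. For the trace, `u_ε` differs from `g_ε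
∘ foot` by `O(depth)`, so that Lebesgue points of `g_ε` on the boundary are trace points
(`hasTrace_of_le`). When `ε` is not small, a cutoff extension of the data suffices. -/

/-- A nonnegative function on `[0, r)` vanishing at `0` whose second derivative is at least
`c q (1 + q) t^(q - 1)` is at least `c t^(1 + q)`. -/
theorem mul_rpow_le_of_deriv2 {V V' V'' : ℝ → ℝ} {c q r : ℝ} (hq : 0 < q) (hc : 0 < c)
    (hV : ContinuousOn V (Ico 0 r)) (h0 : V 0 = 0) (hnn : ∀ t, 0 ≤ V t)
    (h1 : ∀ t ∈ Ioo 0 r, HasDerivAt V (V' t) t) (h2 : ∀ t ∈ Ioo 0 r, HasDerivAt V' (V'' t) t)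
    (h3 : ∀ t ∈ Ioo 0 r, c * ((1 + q) * q) * t ^ (q - 1) ≤ V'' t) {t : ℝ} (ht : t ∈ Ioo 0 r) :
    c * t ^ (1 + q) ≤ V t := by
  have hconv : ConvexOn ℝ (Ico 0 r) (fun t => V t - c * t ^ (1 + q)) := by
    refine convexOn_of_hasDerivWithinAt2_nonneg (convex_Ico 0 r)
      (f' := fun t => V' t - c * ((1 + q) * t ^ q))
      (f'' := fun t => V'' t - c * ((1 + q) * (q * t ^ (q - 1)))) ?_ ?_ ?_ ?_
    · refine hV.sub (continuousOn_const.mul ?_)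
      exact fun x _ => (Real.continuousAt_rpow_const _ _ (Or.inr (by linarith))).continuousWithinAt
    · intro x hx
      rw [interior_Ico] at hx
      have hp := Real.hasDerivAt_rpow_const (x := x) (p := 1 + q) (Or.inl hx.1.ne')
      rw [add_sub_cancel_left] at hp
      exact ((h1 x hx).sub (hp.const_mul c)).hasDerivWithinAt
    · intro x hx
      rw [interior_Ico] at hx
      have hp := Real.hasDerivAt_rpow_const (x := x) (p := q) (Or.inl hx.1.ne')
      exact ((h2 x hx).sub ((hp.const_mul (1 + q)).const_mul c)).hasDerivWithinAt
    · intro x hx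
      rw [interior_Ico] at hx
      have := h3 x hx
      linarith [mul_assoc c ((1 + q) * q) (x ^ (q - 1)), mul_assoc (1 + q) q (x ^ (q - 1))]
  -- Nothing is known about `V'` at `0`; nonnegativity of `V` replaces it. With `D = V - c t^(1+q)`
  -- convex and `D(0) = 0`, `-c s^(1+q) ≤ D(s) ≤ (s/t) D(t)`. Dividing by `s/t` and letting `s → 0`
  -- gives `D(t) ≥ 0`.
  have key : ∀ s ∈ Ioo 0 t, -(c * t) * s ^ q ≤ V t - c * t ^ (1 + q) := by
    intro s hs
    have hst := hconv.2 (⟨le_rfl, ht.1.trans ht.2⟩ : (0 : ℝ) ∈ Ico 0 r) ⟨ht.1.le, ht.2⟩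
      (sub_nonneg.2 ((div_le_one ht.1).2 hs.2.le)) (div_nonneg hs.1.le ht.1.le) (by ring)
    simp only [smul_eq_mul, mul_zero, zero_add, h0, Real.zero_rpow (by linarith : 1 + q ≠ 0),
      sub_zero] at hst
    rw [div_mul_cancel₀ _ ht.1.ne', Real.rpow_add hs.1, Real.rpow_one] at hst
    have hmul : -(c * (s * s ^ q)) ≤ s / t * (V t - c * t ^ (1 + q)) := by
      linarith [hnn s]
    have h4 : s / t * (-(c * t) * s ^ q) ≤ s / t * (V t - c * t ^ (1 + q)) := by
      refine le_trans (le_of_eq ?_) hmul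
      field_simp [ht.1.ne']
    exact le_of_mul_le_mul_left h4 (div_pos hs.1 ht.1)
  have hlim : Tendsto (fun s : ℝ => -(c * t) * s ^ q) (𝓝[>] 0) (𝓝 0) := by
    have := (Real.continuousAt_rpow_const 0 q (Or.inr hq.le)).tendsto
    rw [Real.zero_rpow hq.ne'] at this
    simpa using (this.mono_left nhdsWithin_le_nhds).const_mul (-(c * t))
  have := le_of_tendsto hlim (b := V t - c * t ^ (1 + q))
    (by filter_upwards [Ioo_mem_nhdsGT ht.1] with s hs using key s hs)
  linarith

/-- The singularity is at most `t^(-(1+q)/2)`, whose exponent exceeds `-1` exactly when `q < 1`. -/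
theorem intervalIntegrable_one_div_sqrt_of_le {V : ℝ → ℝ} {c q r : ℝ} (hq : q < 1) (hc : 0 < c)
    (hr : 0 < r) (hV : Measurable V) (h : ∀ t ∈ Ioo 0 r, c * t ^ (1 + q) ≤ V t) :
    IntervalIntegrable (fun t => 1 / √(V t)) volume 0 r := by
  have h1 : IntervalIntegrable (fun t : ℝ => 1 / √c * t ^ (-((1 + q) / 2))) volume 0 r :=
    (intervalIntegral.intervalIntegrable_rpow' (by linarith)).const_mul _
  refine h1.mono_fun (hV.sqrt.const_div 1).aestronglyMeasurable ?_
  rw [uIoc_of_le hr.le, ← restrict_Ioo_eq_restrict_Ioc]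
  filter_upwards [ae_restrict_mem measurableSet_Ioo] with t ht
  have hpos : 0 < √(c * t ^ (1 + q)) :=
    Real.sqrt_pos.2 (mul_pos hc (Real.rpow_pos_of_pos ht.1 _))
  have h2 := Real.sqrt_le_sqrt (h t ht)
  rw [Real.norm_of_nonneg (by positivity), Real.norm_of_nonneg
    (mul_nonneg (by positivity) (Real.rpow_nonneg ht.1.le _))]
  refine (one_div_le_one_div_of_le hpos h2).trans (le_of_eq ?_)
  rw [Real.sqrt_mul hc.le, Real.rpow_neg ht.1.le, Real.sqrt_eq_rpow (t ^ (1 + q)),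
    ← Real.rpow_mul ht.1.le, one_div, one_div, mul_inv, div_eq_mul_one_div (1 + q)]
  norm_num

section Potential

variable {W : ℝ → ℝ} {a b : ℝ}

namespace IsSubquadraticDoubleWell

theorem pos_of_mem_Ioo (hW : IsSubquadraticDoubleWell W a b) {s : ℝ} (hs : s ∈ Ioo a b) :
    0 < W s := by
  refine lt_of_le_of_ne (hW.nonneg s) fun h => ?_
  rcases (hW.zero_iff s).1 h.symm with rfl | rfl
  exacts [lt_irrefl _ hs.1, lt_irrefl _ hs.2]

theorem hasDerivAt (hW : IsSubquadraticDoubleWell W a b) {s : ℝ} (h1 : s ≠ a) (h2 : s ≠ b) :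
    HasDerivAt W (deriv W s) s ∧ HasDerivAt (deriv W) (iteratedDeriv 2 W s) s := by
  have hs : ({a, b}ᶜ : Set ℝ) ∈ 𝓝 s :=
    (Set.Finite.isClosed (by simp)).isOpen_compl.mem_nhds (by simp [h1, h2])
  have hC := (hW.contDiffOn.contDiffAt hs)
  refine ⟨(hC.differentiableAt (by norm_num)).hasDerivAt, ?_⟩
  have hd : ContDiffAt ℝ 1 (deriv W) s := hC.derivWithin (by norm_num)
  rw [iteratedDeriv_succ, iteratedDeriv_one]
  exact (hd.differentiableAt (by norm_num)).hasDerivAt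

/-- The growth condition bounds `W''` below by `(L/2) t^(q-1)` near the well, and convexity
integrates this twice. -/
theorem exists_rpow_le_left (hW : IsSubquadraticDoubleWell W a b) :
    ∃ c q r : ℝ, 0 < c ∧ q < 1 ∧ 0 < r ∧ a + r ≤ b ∧
      ∀ t ∈ Ioo 0 r, c * t ^ (1 + q) ≤ W (a + t) := by
  obtain ⟨q, hq0, hq1, ⟨L, hL, hlim⟩, -⟩ := hW.growth
  have hev : ∀ᶠ s in 𝓝[>] a, L / 2 < iteratedDeriv 2 W s * |s - a| ^ (1 - q) :=
    (hlim.mono_left (nhdsWithin_mono _ fun x hx => ne_of_gt hx)).eventually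
      (lt_mem_nhds (by linarith))
  obtain ⟨e, he, hsub⟩ := (mem_nhdsGT_iff_exists_Ioo_subset' hW.lt).1 hev
  set r := min (e - a) (b - a) with hr
  have hr0 : 0 < r := lt_min (sub_pos.2 he) (sub_pos.2 hW.lt)
  have hrb : a + r ≤ b := by linarith [min_le_right (e - a) (b - a)]
  have hre : a + r ≤ e := by linarith [min_le_left (e - a) (b - a)]
  -- The constant makes the second derivative of `c t^(1+q)` equal to `(L/2) t^(q-1)`.
  refine ⟨L / 2 / ((1 + q) * q), q, r, by positivity, hq1, hr0, hrb, fun t ht => ?_⟩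
  refine mul_rpow_le_of_deriv2 (V := fun t => W (a + t)) (V' := fun t => deriv W (a + t))
    (V'' := fun t => iteratedDeriv 2 W (a + t)) (r := r) hq0 (by positivity) ?_ ?_ ?_ ?_ ?_ ?_ ht
  · exact (hW.continuous.comp (continuous_const.add continuous_id)).continuousOn
  · simpa using (hW.zero_iff a).2 (Or.inl rfl)
  · exact fun t => hW.nonneg _
  · intro s hs
    exact (hW.hasDerivAt (by linarith [hs.1]) (by linarith [hs.2])).1.comp_const_add _ _
  · intro s hs
    exact (hW.hasDerivAt (by linarith [hs.1]) (by linarith [hs.2])).2.comp_const_add _ _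
  · intro s hs
    have := hsub (show a + s ∈ Ioo a e from ⟨by linarith [hs.1], by linarith [hs.2]⟩)
    rw [mem_ofPred_eq, add_sub_cancel_left, abs_of_pos hs.1] at this
    have hp := Real.rpow_pos_of_pos hs.1 (q - 1)
    have h1 : s ^ (1 - q) * s ^ (q - 1) = 1 := by
      rw [← Real.rpow_add hs.1]; simp
    rw [div_mul_cancel₀ _ (by positivity)]
    have h2 := mul_lt_mul_of_pos_right this hp
    rw [mul_assoc, h1, mul_one] at h2
    exact h2.le

/-- The reflection `s ↦ -s` exchanges the wells, so that the analysis at `a` also serves at `b`. -/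
theorem reflect (hW : IsSubquadraticDoubleWell W a b) :
    IsSubquadraticDoubleWell (fun s => W (-s)) (-b) (-a) := by
  have hab : -b < -a := neg_lt_neg hW.lt
  have hlim : ∀ {q L c : ℝ}, Tendsto (fun s => iteratedDeriv 2 W s * |s - c| ^ (1 - q))
      (𝓝[≠] c) (𝓝 L) → Tendsto (fun s => iteratedDeriv 2 (fun s => W (-s)) s *
        |s - -c| ^ (1 - q)) (𝓝[≠] (-c)) (𝓝 L) := by
    intro q L c h
    have hneg : Tendsto (fun s : ℝ => -s) (𝓝[≠] (-c)) (𝓝[≠] c) := by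
      refine tendsto_nhdsWithin_iff.2 ⟨?_, ?_⟩
      · simpa using (continuous_neg.tendsto (-c)).mono_left nhdsWithin_le_nhds
      · filter_upwards [self_mem_nhdsWithin] with s hs h'
        exact hs (by rw [mem_singleton_iff] at h' ⊢; linarith)
    refine (h.comp hneg).congr fun s => ?_
    rw [iteratedDeriv_comp_neg]
    simp only [Function.comp_apply, even_two, Even.neg_pow, one_pow, one_smul]
    rw [← abs_neg (s - -c)]
    congr 3
    ring
  refine ⟨hab, hW.continuous.comp continuous_neg, fun s => hW.nonneg _, fun s => ?_, ?_, ?_⟩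
  · rw [hW.zero_iff]
    constructor <;> rintro (h | h)
    · right; linarith
    · left; linarith
    · right; linarith
    · left; linarith
  · refine hW.contDiffOn.comp contDiff_neg.contDiffOn fun s hs => ?_
    simp only [mem_compl_iff, mem_insert_iff, mem_singleton_iff, not_or] at hs ⊢
    exact ⟨fun h => hs.2 (by linarith), fun h => hs.1 (by linarith)⟩
  · obtain ⟨q, hq0, hq1, ⟨L, hL, hlimL⟩, ⟨L', hL', hlimL'⟩⟩ := hW.growth
    exact ⟨q, hq0, hq1, ⟨L', hL', hlim hlimL'⟩, ⟨L, hL, hlim hlimL⟩⟩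

theorem intervalIntegrable_left (hW : IsSubquadraticDoubleWell W a b) {c : ℝ} (hc : c ∈ Ioo a b) :
    IntervalIntegrable (fun s => 1 / √(W s)) volume a c := by
  obtain ⟨k, q, r, hk, hq, hr, hrb, h⟩ := hW.exists_rpow_le_left
  have h1 := intervalIntegrable_one_div_sqrt_of_le hq hk hr
    (V := fun t => W (a + t)) (hW.continuous.measurable.comp (measurable_const_add a)) h
  have h2 : IntervalIntegrable (fun s => 1 / √(W s)) volume a (a + r) := by
    have := h1.comp_sub_right a
    simpa [add_comm] using this
  have h3 : ∀ d ∈ Ioo a b, ∀ e ∈ Ioo a b,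
      IntervalIntegrable (fun s => 1 / √(W s)) volume d e := by
    intro d hd e he
    refine ContinuousOn.intervalIntegrable (ContinuousOn.div continuousOn_const
      hW.continuous.sqrt.continuousOn fun x hx => ?_)
    exact (Real.sqrt_pos.2 (hW.pos_of_mem_Ioo (ordConnected_Ioo.uIcc_subset hd he hx))).ne'
  -- The point `a + r` may be the other well; stopping at `a + r / 2` keeps the remaining interval
  -- inside `(a, b)`.
  have h4 : IntervalIntegrable (fun s => 1 / √(W s)) volume a (a + r / 2) :=
    h2.mono_set (by
      rw [uIcc_of_le (by linarith), uIcc_of_le (by linarith)]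
      exact Icc_subset_Icc le_rfl (by linarith))
  exact h4.trans (h3 _ ⟨by linarith, by linarith⟩ _ hc)

/-- Finiteness of the total travel time `T` gives each boundary layer a width of at most `εT`. -/
theorem intervalIntegrable (hW : IsSubquadraticDoubleWell W a b) :
    IntervalIntegrable (fun s => 1 / √(W s)) volume a b := by
  have hc : (a + b) / 2 ∈ Ioo a b := ⟨by linarith [hW.lt], by linarith [hW.lt]⟩
  have h1 := hW.reflect.intervalIntegrable_left (c := -((a + b) / 2))
    ⟨by linarith [hc.2], by linarith [hc.1]⟩
  have h2 := (IntervalIntegrable.iff_comp_neg (by simp)).1 h1 |>.symm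
  simp only [neg_neg] at h2
  exact (hW.intervalIntegrable_left hc).trans h2

theorem intervalIntegrable_of_mem (hW : IsSubquadraticDoubleWell W a b) {x y : ℝ}
    (hx : x ∈ Icc a b) (hy : y ∈ Icc a b) :
    IntervalIntegrable (fun s => 1 / √(W s)) volume x y :=
  hW.intervalIntegrable.mono_set (by
    rw [uIcc_of_le hW.lt.le]; exact ordConnected_Icc.uIcc_subset hx hy)

theorem travelTime_eq_sub (hW : IsSubquadraticDoubleWell W a b) {x y : ℝ}
    (hx : x ∈ Icc a b) (hy : y ∈ Icc a b) :
    travelTime W x y = travelTime W a y - travelTime W a x := by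
  have ha : a ∈ Icc a b := ⟨le_rfl, hW.lt.le⟩
  rw [travelTime, travelTime, travelTime, intervalIntegral.integral_interval_sub_left
    (hW.intervalIntegrable_of_mem ha hy) (hW.intervalIntegrable_of_mem ha hx)]

/-- A positive bound for `√W` on `[a, b]`. -/
theorem exists_sqrt_le (hW : IsSubquadraticDoubleWell W a b) :
    ∃ M : ℝ, 0 < M ∧ ∀ s ∈ Icc a b, √(W s) ≤ M := by
  obtain ⟨M, hM⟩ := isCompact_Icc.exists_bound_of_continuousOn
    (hW.continuous.sqrt.continuousOn (s := Icc a b))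
  exact ⟨max M 1, by positivity, fun s hs =>
    ((le_abs_self _).trans (hM s hs)).trans (le_max_left _ _)⟩

/-- The speed `√W` is at most `M`. This gives strict monotonicity of the travel time and the
Lipschitz constant `M` of its inverse. -/
theorem sub_div_le_travelTime (hW : IsSubquadraticDoubleWell W a b) {M : ℝ}
    (hM : ∀ s ∈ Icc a b, √(W s) ≤ M) {x y : ℝ} (hx : a ≤ x) (hxy : x ≤ y) (hy : y ≤ b) :
    (y - x) / M ≤ travelTime W x y := by
  have : ∫ s in x..y, 1 / M ≤ travelTime W x y := by
    refine intervalIntegral.integral_mono_ae_restrict hxy intervalIntegrable_const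
      (hW.intervalIntegrable_of_mem ⟨hx, hxy.trans hy⟩ ⟨hx.trans hxy, hy⟩) ?_
    rw [EventuallyLE, ← restrict_Ioo_eq_restrict_Icc]
    filter_upwards [ae_restrict_mem measurableSet_Ioo] with s hs
    exact one_div_le_one_div_of_le (Real.sqrt_pos.2 (hW.pos_of_mem_Ioo
      ⟨hx.trans_lt hs.1, hs.2.trans_le hy⟩)) (hM s ⟨hx.trans hs.1.le, hs.2.le.trans hy⟩)
  simpa [div_eq_mul_inv] using this

theorem strictMonoOn_travelTime (hW : IsSubquadraticDoubleWell W a b) :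
    StrictMonoOn (travelTime W a) (Icc a b) := by
  intro x hx y hy hxy
  obtain ⟨M, hM0, hM⟩ := hW.exists_sqrt_le
  have h := hW.sub_div_le_travelTime hM hx.1 hxy.le hy.2
  rw [hW.travelTime_eq_sub hx hy] at h
  have : 0 < (y - x) / M := div_pos (sub_pos.2 hxy) hM0
  linarith

theorem continuousOn_travelTime (hW : IsSubquadraticDoubleWell W a b) :
    ContinuousOn (travelTime W a) (Icc a b) :=
  intervalIntegral.continuousOn_primitive_interval' (b₁ := a) (b₂ := b) hW.intervalIntegrable
    left_mem_uIcc |>.mono (by rw [uIcc_of_le hW.lt.le])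

theorem hasDerivAt_travelTime (hW : IsSubquadraticDoubleWell W a b) {x : ℝ} (hx : x ∈ Ioo a b) :
    HasDerivAt (travelTime W a) (1 / √(W x)) x := by
  refine intervalIntegral.integral_hasDerivAt_right
    (hW.intervalIntegrable_of_mem ⟨le_rfl, hW.lt.le⟩ ⟨hx.1.le, hx.2.le⟩) ?_ ?_
  · exact (hW.continuous.measurable.sqrt.const_div 1).stronglyMeasurable.stronglyMeasurableAtFilter
  · exact continuousAt_const.div hW.continuous.sqrt.continuousAt
      (Real.sqrt_pos.2 (hW.pos_of_mem_Ioo hx)).ne'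

theorem travelTime_mem_Icc (hW : IsSubquadraticDoubleWell W a b) {x : ℝ} (hx : x ∈ Icc a b) :
    travelTime W a x ∈ Icc 0 (travelTime W a b) := by
  have h0 : travelTime W a a = 0 := intervalIntegral.integral_same
  have hm := hW.strictMonoOn_travelTime.monotoneOn
  exact ⟨h0 ▸ hm ⟨le_rfl, hW.lt.le⟩ hx hx.1, hm hx ⟨hW.lt.le, le_rfl⟩ hx.2⟩

theorem travelTime_pos (hW : IsSubquadraticDoubleWell W a b) : 0 < travelTime W a b := by
  have h0 : travelTime W a a = 0 := intervalIntegral.integral_same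
  exact h0 ▸ hW.strictMonoOn_travelTime ⟨le_rfl, hW.lt.le⟩ ⟨hW.lt.le, le_rfl⟩ hW.lt

theorem surjOn_travelTime (hW : IsSubquadraticDoubleWell W a b) :
    SurjOn (travelTime W a) (Icc a b) (Icc 0 (travelTime W a b)) := by
  have := intermediate_value_Icc hW.lt.le hW.continuousOn_travelTime
  rwa [travelTime, intervalIntegral.integral_same] at this

end IsSubquadraticDoubleWell

/-! ### The heteroclinic, its differential equation and its translates -/

/-- The optimal profile issuing from the well `a` at time `0`, continued by `a` to negative
times. -/
def heteroclinic (W : ℝ → ℝ) (a b r : ℝ) : ℝ := profile W b a (max r 0)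

namespace IsSubquadraticDoubleWell

theorem heteroclinic_spec (hW : IsSubquadraticDoubleWell W a b) {r : ℝ}
    (hr : r ∈ Icc 0 (travelTime W a b)) :
    heteroclinic W a b r ∈ Icc a b ∧ travelTime W a (heteroclinic W a b r) = r := by
  have h := hW.surjOn_travelTime hr
  rw [heteroclinic, max_eq_left hr.1, profile, if_pos hr.2]
  exact ⟨Function.invFunOn_mem h, Function.invFunOn_eq h⟩

theorem heteroclinic_travelTime (hW : IsSubquadraticDoubleWell W a b) {x : ℝ}
    (hx : x ∈ Icc a b) : heteroclinic W a b (travelTime W a x) = x := by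
  have h := hW.heteroclinic_spec (hW.travelTime_mem_Icc hx)
  exact hW.strictMonoOn_travelTime.injOn h.1 hx h.2

theorem heteroclinic_of_nonpos (hW : IsSubquadraticDoubleWell W a b) {r : ℝ} (hr : r ≤ 0) :
    heteroclinic W a b r = a := by
  have h := hW.heteroclinic_travelTime (x := a) ⟨le_rfl, hW.lt.le⟩
  rw [travelTime, intervalIntegral.integral_same] at h
  rw [heteroclinic, max_eq_right hr]
  rwa [heteroclinic, max_self] at h

theorem heteroclinic_of_ge (hW : IsSubquadraticDoubleWell W a b) {r : ℝ}
    (hr : travelTime W a b ≤ r) : heteroclinic W a b r = b := by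
  have hb : b ∈ Icc a b := ⟨hW.lt.le, le_rfl⟩
  rcases hr.eq_or_lt with rfl | hr
  · exact hW.heteroclinic_travelTime hb
  · rw [heteroclinic, max_eq_left (hW.travelTime_pos.le.trans hr.le), profile, if_neg hr.not_ge]

theorem heteroclinic_projIcc (hW : IsSubquadraticDoubleWell W a b) (r : ℝ) :
    heteroclinic W a b (projIcc 0 (travelTime W a b) hW.travelTime_pos.le r) =
      heteroclinic W a b r := by
  rcases le_total r 0 with h | h
  · rw [projIcc_of_le_left _ h, hW.heteroclinic_of_nonpos h, hW.heteroclinic_of_nonpos le_rfl]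
  rcases le_total (travelTime W a b) r with h' | h'
  · rw [projIcc_of_right_le _ h', hW.heteroclinic_of_ge h', hW.heteroclinic_of_ge le_rfl]
  · rw [projIcc_of_mem _ ⟨h, h'⟩]

theorem heteroclinic_mem_Icc (hW : IsSubquadraticDoubleWell W a b) (r : ℝ) :
    heteroclinic W a b r ∈ Icc a b := by
  rw [← hW.heteroclinic_projIcc]
  exact (hW.heteroclinic_spec (projIcc 0 _ hW.travelTime_pos.le r).2).1

theorem monotone_heteroclinic (hW : IsSubquadraticDoubleWell W a b) :
    Monotone (heteroclinic W a b) := by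
  intro r s hrs
  rw [← hW.heteroclinic_projIcc r, ← hW.heteroclinic_projIcc s]
  have hr := hW.heteroclinic_spec (projIcc 0 _ hW.travelTime_pos.le r).2
  have hs := hW.heteroclinic_spec (projIcc 0 _ hW.travelTime_pos.le s).2
  rw [← hW.strictMonoOn_travelTime.le_iff_le hr.1 hs.1, hr.2, hs.2]
  exact monotone_projIcc hW.travelTime_pos.le hrs

theorem heteroclinic_sub_le (hW : IsSubquadraticDoubleWell W a b) {M : ℝ} (hM0 : 0 < M)
    (hM : ∀ s ∈ Icc a b, √(W s) ≤ M) {r s : ℝ} (hrs : r ≤ s) :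
    heteroclinic W a b s - heteroclinic W a b r ≤ M * (s - r) := by
  have hmono := hW.monotone_heteroclinic hrs
  rw [← hW.heteroclinic_projIcc r, ← hW.heteroclinic_projIcc s] at hmono ⊢
  set r' := projIcc 0 _ hW.travelTime_pos.le r
  set s' := projIcc 0 _ hW.travelTime_pos.le s
  have hr := hW.heteroclinic_spec r'.2
  have hs := hW.heteroclinic_spec s'.2
  have h := hW.sub_div_le_travelTime hM hr.1.1 hmono hs.1.2
  rw [hW.travelTime_eq_sub hr.1 hs.1, hr.2, hs.2, div_le_iff₀ hM0] at h
  have h2 : (s' : ℝ) - r' ≤ s - r := by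
    have := abs_projIcc_sub_projIcc (c := s) (d := r) hW.travelTime_pos.le
    rw [abs_of_nonneg (sub_nonneg.2 hrs)] at this
    exact (le_abs_self _).trans this
  nlinarith

theorem lipschitz_heteroclinic (hW : IsSubquadraticDoubleWell W a b) {M : ℝ} (hM0 : 0 < M)
    (hM : ∀ s ∈ Icc a b, √(W s) ≤ M) (r s : ℝ) :
    |heteroclinic W a b r - heteroclinic W a b s| ≤ M * |r - s| := by
  wlog h : s ≤ r generalizing r s
  · rw [abs_sub_comm, abs_sub_comm r]; exact this s r (le_of_not_ge h)
  rw [abs_of_nonneg (sub_nonneg.2 (hW.monotone_heteroclinic h)), abs_of_nonneg (sub_nonneg.2 h)]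
  exact hW.heteroclinic_sub_le hM0 hM h

theorem continuous_heteroclinic (hW : IsSubquadraticDoubleWell W a b) :
    Continuous (heteroclinic W a b) := by
  obtain ⟨M, hM0, hM⟩ := hW.exists_sqrt_le
  exact (LipschitzWith.of_dist_le_mul (K := ⟨M, hM0.le⟩) fun r s => by
    rw [Real.dist_eq, Real.dist_eq]; exact hW.lipschitz_heteroclinic hM0 hM r s).continuous

theorem apply_left (hW : IsSubquadraticDoubleWell W a b) : W a = 0 := (hW.zero_iff a).2 (.inl rfl)
theorem apply_right (hW : IsSubquadraticDoubleWell W a b) : W b = 0 := (hW.zero_iff b).2 (.inr rfl)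

/-- The inverse function theorem gives the equation except at the times `0` and `T`, where the
travel time has infinite slope. Since `√W(ζ)` is continuous and two points do not matter to the
fundamental theorem of calculus, `ζ` is a primitive of `√W(ζ)`, and the equation holds at every
time. -/
theorem hasDerivAt_heteroclinic (hW : IsSubquadraticDoubleWell W a b) (r : ℝ) :
    HasDerivAt (heteroclinic W a b) (√(W (heteroclinic W a b r))) r := by
  have hc : Continuous fun r => √(W (heteroclinic W a b r)) :=
    (hW.continuous.comp hW.continuous_heteroclinic).sqrt
  have h1 : ∀ r, r ≠ 0 → r ≠ travelTime W a b →
      HasDerivAt (heteroclinic W a b) (√(W (heteroclinic W a b r))) r := by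
    intro r h0 hT
    rcases lt_or_gt_of_ne h0 with h0 | h0
    · rw [hW.heteroclinic_of_nonpos h0.le, hW.apply_left, Real.sqrt_zero]
      refine (hasDerivAt_const r a).congr_of_eventuallyEq ?_
      filter_upwards [Iio_mem_nhds h0] with s hs using hW.heteroclinic_of_nonpos (le_of_lt hs)
    rcases lt_or_gt_of_ne hT with hT | hT
    · have hs := hW.heteroclinic_spec ⟨h0.le, hT.le⟩
      have hIoo : heteroclinic W a b r ∈ Ioo a b := by
        refine ⟨lt_of_le_of_ne hs.1.1 fun h => ?_, lt_of_le_of_ne hs.1.2 fun h => ?_⟩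
        · rw [← h, travelTime, intervalIntegral.integral_same] at hs
          exact h0.ne hs.2
        · rw [h] at hs; exact hT.ne' hs.2
      have hpos := Real.sqrt_pos.2 (hW.pos_of_mem_Ioo hIoo)
      have := HasDerivAt.of_local_left_inverse hW.continuous_heteroclinic.continuousAt
        (hW.hasDerivAt_travelTime hIoo) (one_div_pos.2 hpos).ne'
        (by filter_upwards [Ioo_mem_nhds h0 hT] with s hs
            exact (hW.heteroclinic_spec ⟨hs.1.le, hs.2.le⟩).2)
      simpa using this
    · rw [hW.heteroclinic_of_ge hT.le, hW.apply_right, Real.sqrt_zero]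
      refine (hasDerivAt_const r b).congr_of_eventuallyEq ?_
      filter_upwards [Ioi_mem_nhds hT] with s hs using hW.heteroclinic_of_ge (le_of_lt hs)
  have h2 : ∀ s, heteroclinic W a b s - heteroclinic W a b 0 =
      ∫ r in (0 : ℝ)..s, √(W (heteroclinic W a b r)) := fun s =>
    (MeasureTheory.integral_eq_of_hasDerivAt_off_countable _ _
      (s := {0, travelTime W a b}) (by simp) hW.continuous_heteroclinic.continuousOn
      (fun x hx => by
        simp only [Set.mem_sdiff, mem_insert_iff, mem_singleton_iff, not_or] at hx
        exact h1 x hx.2.1 hx.2.2) (hc.intervalIntegrable 0 s)).symm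
  have h3 : heteroclinic W a b = fun s => (∫ r in (0 : ℝ)..s, √(W (heteroclinic W a b r))) +
      heteroclinic W a b 0 := by
    ext s; rw [← h2]; ring
  have h4 := (intervalIntegral.integral_hasDerivAt_right (hc.intervalIntegrable 0 r)
    hc.stronglyMeasurable.stronglyMeasurableAtFilter hc.continuousAt).add_const
      (heteroclinic W a b 0)
  rwa [← h3] at h4

theorem contDiff_heteroclinic (hW : IsSubquadraticDoubleWell W a b) :
    ContDiff ℝ 1 (heteroclinic W a b) := by
  rw [contDiff_one_iff_deriv]
  have h : deriv (heteroclinic W a b) = fun r => √(W (heteroclinic W a b r)) :=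
    funext fun r => (hW.hasDerivAt_heteroclinic r).deriv
  rw [h]
  exact ⟨fun r => (hW.hasDerivAt_heteroclinic r).differentiableAt,
    (hW.continuous.comp hW.continuous_heteroclinic).sqrt⟩

/-- All profiles are translates of the heteroclinic. -/
theorem profile_eq (hW : IsSubquadraticDoubleWell W a b) {α t : ℝ} (hα : α ∈ Icc a b)
    (ht : 0 ≤ t) : profile W b α t = heteroclinic W a b (travelTime W a α + t) := by
  have hb : b ∈ Icc a b := ⟨hW.lt.le, le_rfl⟩
  have hsum := hW.travelTime_eq_sub hα hb
  have hΨ := hW.travelTime_mem_Icc hα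
  by_cases h : t ≤ travelTime W α b
  · have hs := hW.heteroclinic_spec (r := travelTime W a α + t)
      ⟨add_nonneg hΨ.1 ht, by linarith⟩
    set x := heteroclinic W a b (travelTime W a α + t)
    have hαx : α ≤ x := by
      rw [← hW.strictMonoOn_travelTime.le_iff_le hα hs.1, hs.2]; linarith
    have hmem : ∃ y ∈ Icc α b, travelTime W α y = t :=
      ⟨x, ⟨hαx, hs.1.2⟩, by rw [hW.travelTime_eq_sub hα hs.1, hs.2]; ring⟩
    rw [profile, if_pos h]
    have h1 := Function.invFunOn_mem hmem
    have h2 := Function.invFunOn_eq hmem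
    set y := Function.invFunOn (travelTime W α) (Icc α b) t
    have hy : y ∈ Icc a b := ⟨hα.1.trans h1.1, h1.2⟩
    rw [hW.travelTime_eq_sub hα hy] at h2
    refine hW.strictMonoOn_travelTime.injOn hy hs.1 ?_
    rw [hs.2]; linarith
  · rw [profile, if_neg h, hW.heteroclinic_of_ge (by linarith)]

/-! ### Geodesic distance and equipartition of energy -/

theorem geodesicDist_eq (W : ℝ → ℝ) {x y : ℝ} (h : x ≤ y) :
    geodesicDist W x y = ∫ ρ in x..y, 2 * √(W ρ) :=
  abs_of_nonneg (intervalIntegral.integral_nonneg h fun _ _ => by positivity)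

theorem geodesicDist_triangle (hW : IsSubquadraticDoubleWell W a b) (x y z : ℝ) :
    geodesicDist W x z ≤ geodesicDist W x y + geodesicDist W y z := by
  have hi : ∀ x y, IntervalIntegrable (fun ρ => 2 * √(W ρ)) volume x y := fun x y =>
    (hW.continuous.sqrt.const_mul 2).intervalIntegrable x y
  rw [geodesicDist, ← intervalIntegral.integral_add_adjacent_intervals (hi x y) (hi y z)]
  exact abs_add_le _ _

theorem geodesicDist_comm (W : ℝ → ℝ) (x y : ℝ) : geodesicDist W x y = geodesicDist W y x := by
  rw [geodesicDist, geodesicDist, intervalIntegral.integral_symm, abs_neg]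

theorem continuous_geodesicDist (hW : IsSubquadraticDoubleWell W a b) :
    Continuous fun p : ℝ × ℝ => geodesicDist W p.1 p.2 := by
  have hi : ∀ x y, IntervalIntegrable (fun ρ => 2 * √(W ρ)) volume x y := fun x y =>
    (hW.continuous.sqrt.const_mul 2).intervalIntegrable x y
  have hc := intervalIntegral.continuous_primitive hi 0
  have : (fun p : ℝ × ℝ => geodesicDist W p.1 p.2) = fun p =>
      |(∫ ρ in (0 : ℝ)..p.2, 2 * √(W ρ)) - ∫ ρ in (0 : ℝ)..p.1, 2 * √(W ρ)| := by
    ext p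
    rw [geodesicDist, intervalIntegral.integral_interval_sub_left (hi _ _) (hi _ _)]
  rw [this]
  exact ((hc.comp continuous_snd).sub (hc.comp continuous_fst)).abs

/-- The chain rule gives `-2√W(ζ) ζ'`, and `ζ' = √W(ζ)`: the energy density of the profile is an
exact derivative. -/
theorem hasDerivAt_geodesicDist_heteroclinic (hW : IsSubquadraticDoubleWell W a b) (r : ℝ) :
    HasDerivAt (fun r => geodesicDist W (heteroclinic W a b r) b)
      (-(2 * W (heteroclinic W a b r))) r := by
  have hc : Continuous fun ρ => 2 * √(W ρ) := hW.continuous.sqrt.const_mul 2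
  have h1 : (fun r => geodesicDist W (heteroclinic W a b r) b) =
      fun r => ∫ ρ in heteroclinic W a b r..b, 2 * √(W ρ) :=
    funext fun r => geodesicDist_eq W (hW.heteroclinic_mem_Icc r).2
  have h2 := intervalIntegral.integral_hasDerivAt_left (hc.intervalIntegrable
    (heteroclinic W a b r) b) hc.stronglyMeasurable.stronglyMeasurableAtFilter hc.continuousAt
  rw [h1]
  refine (h2.comp r (hW.hasDerivAt_heteroclinic r)).congr_deriv ?_
  rw [neg_mul, mul_assoc, Real.mul_self_sqrt (hW.nonneg _)]

theorem geodesicDist_heteroclinic_of_ge (hW : IsSubquadraticDoubleWell W a b) {r : ℝ}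
    (hr : travelTime W a b ≤ r) : geodesicDist W (heteroclinic W a b r) b = 0 := by
  rw [hW.heteroclinic_of_ge hr, geodesicDist, intervalIntegral.integral_same, abs_zero]

theorem continuous_geodesicDist_heteroclinic (hW : IsSubquadraticDoubleWell W a b) :
    Continuous (fun r => geodesicDist W (heteroclinic W a b r) b) :=
  hW.continuous_geodesicDist.comp (hW.continuous_heteroclinic.prodMk continuous_const)

/-- Equipartition of energy along the profile. -/
theorem integral_two_mul_heteroclinic (hW : IsSubquadraticDoubleWell W a b) {r S : ℝ}
    (h : travelTime W a b ≤ r + S) :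
    ∫ s in (0 : ℝ)..S, 2 * W (heteroclinic W a b (r + s)) =
      geodesicDist W (heteroclinic W a b r) b := by
  have hc : Continuous fun s => 2 * W (heteroclinic W a b (r + s)) :=
    (hW.continuous.comp (hW.continuous_heteroclinic.comp (continuous_const_add r))).const_mul 2
  rw [intervalIntegral.integral_eq_sub_of_hasDerivAt
    (f := fun s => -geodesicDist W (heteroclinic W a b (r + s)) b) (fun s _ => ?_)
    (hc.intervalIntegrable 0 S)]
  · simp [hW.geodesicDist_heteroclinic_of_ge h]
  · have := ((hW.hasDerivAt_geodesicDist_heteroclinic (r + s)).comp_const_add r s).neg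
    rwa [neg_neg] at this

/-- The first moment of the energy along the profile. -/
theorem integral_two_mul_heteroclinic_mul (hW : IsSubquadraticDoubleWell W a b) {r S : ℝ}
    (h : travelTime W a b ≤ r + S) :
    ∫ s in (0 : ℝ)..S, 2 * W (heteroclinic W a b (r + s)) * s =
      ∫ s in (0 : ℝ)..S, geodesicDist W (heteroclinic W a b (r + s)) b := by
  have hc : Continuous fun s => 2 * W (heteroclinic W a b (r + s)) * s :=
    ((hW.continuous.comp (hW.continuous_heteroclinic.comp
      (continuous_const_add r))).const_mul 2).mul continuous_id
  have hd : Continuous fun s => geodesicDist W (heteroclinic W a b (r + s)) b :=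
    hW.continuous_geodesicDist_heteroclinic.comp (continuous_const_add r)
  rw [← sub_eq_zero, ← intervalIntegral.integral_sub (hc.intervalIntegrable _ _)
    (hd.intervalIntegrable _ _)]
  -- Integration by parts, written as an antiderivative of the difference of the integrands. The
  -- boundary term vanishes at `0` because of the factor `s` and at `S` because the profile has
  -- reached `b`.
  rw [intervalIntegral.integral_eq_sub_of_hasDerivAt (f := fun s => -(s * geodesicDist W (heteroclinic W a b (r + s)) b))
    (f' := fun s => 2 * W (heteroclinic W a b (r + s)) * s -
      geodesicDist W (heteroclinic W a b (r + s)) b) (fun s _ => ?_)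
    ((hc.sub hd).intervalIntegrable 0 S)]
  · simp [hW.geodesicDist_heteroclinic_of_ge h]
  · have := ((hasDerivAt_id s).mul
      ((hW.hasDerivAt_geodesicDist_heteroclinic (r + s)).comp_const_add r s)).neg
    refine this.congr_deriv ?_
    simp only [id]
    ring

end IsSubquadraticDoubleWell

/-- The energy excess `∫_0^∞ d_W(z_α(s), b) ds` of the profile issuing from `α`. -/
def profileMoment (W : ℝ → ℝ) (b α : ℝ) : ℝ :=
  ∫ s in Ioi (0 : ℝ), geodesicDist W (profile W b α s) b

theorem profileMoment_nonneg (W : ℝ → ℝ) (b α : ℝ) : 0 ≤ profileMoment W b α :=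
  integral_nonneg fun _ => abs_nonneg _

namespace IsSubquadraticDoubleWell

/-- After time `T` the profile rests at `b`, so that one window `[0, S]` serves all starting values
and improper integrals disappear. -/
theorem profileMoment_eq (hW : IsSubquadraticDoubleWell W a b) {α S : ℝ} (hα : α ∈ Icc a b)
    (hS : travelTime W a b ≤ S) : profileMoment W b α =
      ∫ s in (0 : ℝ)..S, geodesicDist W (heteroclinic W a b (travelTime W a α + s)) b := by
  have hΨ := (hW.travelTime_mem_Icc hα).1
  have hS0 : 0 ≤ S := hW.travelTime_pos.le.trans hS
  have h1 : profileMoment W b α =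
      ∫ s in Ioi (0 : ℝ), geodesicDist W (heteroclinic W a b (travelTime W a α + s)) b :=
    setIntegral_congr_fun measurableSet_Ioi fun s hs => by
      simp only [hW.profile_eq hα (le_of_lt hs)]
  rw [h1, intervalIntegral.integral_of_le hS0]
  refine setIntegral_eq_of_subset_of_forall_sdiff_eq_zero measurableSet_Ioi Ioc_subset_Ioi_self
    fun s hs => hW.geodesicDist_heteroclinic_of_ge ?_
  have : S < s := by
    by_contra! h
    exact hs.2 ⟨hs.1, h⟩
  linarith

theorem continuousOn_profileMoment (hW : IsSubquadraticDoubleWell W a b) :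
    ContinuousOn (profileMoment W b) (Icc a b) := by
  have h : Continuous fun r => ∫ s in (0 : ℝ)..travelTime W a b,
      geodesicDist W (heteroclinic W a b (r + s)) b :=
    intervalIntegral.continuous_parametric_intervalIntegral_of_continuous'
      (f := fun r s => geodesicDist W (heteroclinic W a b (r + s)) b)
      (hW.continuous_geodesicDist_heteroclinic.comp (continuous_fst.add continuous_snd)) _ _
  exact (h.comp_continuousOn hW.continuousOn_travelTime).congr fun α hα =>
    hW.profileMoment_eq hα le_rfl

end IsSubquadraticDoubleWell
end Potential

/-! ### Defining functions, the normal and the mean curvature -/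

variable {n : ℕ} {Ω : Set (E n)} {y : E n} {φ ψ : E n → ℝ}

theorem norm_unitGradient (h : gradient φ y ≠ 0) : ‖unitGradient φ y‖ = 1 := by
  rw [unitGradient, norm_smul, norm_inv, norm_norm, inv_mul_cancel₀ (norm_ne_zero_iff.2 h)]

theorem contDiffAt_gradient {m : ℕ} (h : ContDiffAt ℝ (m + 1) φ y) :
    ContDiffAt ℝ m (gradient φ) y :=
  (InnerProductSpace.toDual ℝ (E n)).symm.contDiff.contDiffAt.comp y
    (h.fderiv_right (m := m) le_rfl)

namespace IsLocalDefiningFunction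

theorem contDiffAt_unitGradient (h : IsLocalDefiningFunction Ω y φ) :
    ContDiffAt ℝ 1 (unitGradient φ) y := by
  have hg : ContDiffAt ℝ 1 (gradient φ) y :=
    contDiffAt_gradient (m := 1) (h.contDiffAt.of_le (by norm_num))
  exact ((hg.norm ℝ h.gradient_ne_zero).inv (norm_ne_zero_iff.2 h.gradient_ne_zero)).smul hg

/-- Each condition is open, so that one defining function serves all boundary points near `y`. -/
theorem eventually (h : IsLocalDefiningFunction Ω y φ) :
    ∀ᶠ z in 𝓝 y, IsLocalDefiningFunction Ω z φ := by
  have hg : ContinuousAt (gradient φ) y :=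
    (contDiffAt_gradient (m := 1) (h.contDiffAt.of_le (by norm_num))).continuousAt
  filter_upwards [h.contDiffAt.eventually (by simp), hg.eventually_ne h.gradient_ne_zero,
    h.mem_iff.eventually_nhds] with z h1 h2 h3 using ⟨h1, h2, h3⟩

theorem inner_gradient (φ : E n → ℝ) (y v : E n) :
    inner ℝ (gradient φ y) v = fderiv ℝ φ y v := by
  rw [gradient, InnerProductSpace.toDual_symm_apply]

theorem hasDerivAt_line (h : DifferentiableAt ℝ φ y) (v : E n) :
    HasDerivAt (fun t : ℝ => φ (y + t • v)) (inner ℝ (gradient φ y) v) 0 := by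
  have := h.hasFDerivAt.hasLineDerivAt v
  rwa [← inner_gradient] at this

theorem eventually_line (y v : E n) {p : E n → Prop} (h : ∀ᶠ x in 𝓝 y, p x) :
    ∀ᶠ t in 𝓝[>] (0 : ℝ), p (y + t • v) := by
  have hc : Tendsto (fun t : ℝ => y + t • v) (𝓝[>] 0) (𝓝 y) := by
    have : Continuous fun t : ℝ => y + t • v := by fun_prop
    simpa using (this.tendsto 0).mono_left nhdsWithin_le_nhds
  exact hc.eventually h

theorem differentiableAt (h : IsLocalDefiningFunction Ω y φ) : DifferentiableAt ℝ φ y :=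
  h.contDiffAt.differentiableAt (by norm_num)

theorem eventually_line_mem (h : IsLocalDefiningFunction Ω y φ) (hy : φ y = 0) {v : E n}
    (hv : inner ℝ (gradient φ y) v < 0) : ∀ᶠ t in 𝓝[>] (0 : ℝ), y + t • v ∈ Ω := by
  have h1 : ∀ᶠ t in 𝓝[>] (0 : ℝ), φ (y + t • v) < 0 := by
    have hd := (hasDerivAt_line h.differentiableAt v).tendsto_slope.mono_left
      (nhdsWithin_mono _ fun x (hx : x ∈ Ioi (0 : ℝ)) => ne_of_gt hx)
    filter_upwards [hd.eventually (gt_mem_nhds hv), self_mem_nhdsWithin] with t ht ht0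
    rw [slope_def_field, zero_smul, add_zero, hy, sub_zero, sub_zero, div_lt_iff₀ ht0,
      zero_mul] at ht
    exact ht
  filter_upwards [h1, eventually_line y v h.mem_iff] with t ht1 ht2 using ht2.2 ht1

theorem inner_nonpos (h : IsLocalDefiningFunction Ω y φ) (hy : φ y = 0) {v : E n}
    (hv : ∀ᶠ t in 𝓝[>] (0 : ℝ), y + t • v ∈ Ω) : inner ℝ (gradient φ y) v ≤ 0 := by
  by_contra! hpos
  have hd := (hasDerivAt_line h.differentiableAt v).tendsto_slope.mono_left
    (nhdsWithin_mono _ fun x (hx : x ∈ Ioi (0 : ℝ)) => ne_of_gt hx)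
  obtain ⟨t, ht1, ht2, ht3, ht4⟩ := (hv.and ((eventually_line y v h.mem_iff).and
    ((hd.eventually (lt_mem_nhds hpos)).and self_mem_nhdsWithin))).exists
  rw [slope_def_field, zero_smul, add_zero, hy, sub_zero, sub_zero] at ht3
  exact absurd (ht2.1 ht1) (not_lt.2 (by
    by_contra! h; exact absurd (div_neg_of_neg_of_pos h ht4) (not_lt.2 ht3.le)))

theorem apply_eq_zero (h : IsLocalDefiningFunction Ω y φ) (hΩ : IsOpen Ω)
    (hy : y ∈ frontier Ω) : φ y = 0 := by
  have h1 : ¬ φ y < 0 := fun hlt => by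
    have := h.mem_iff.self_of_nhds.2 hlt
    exact hy.2 (hΩ.interior_eq.symm ▸ this)
  refine le_antisymm (not_lt.1 fun hpos => ?_) (not_lt.1 h1)
  have h2 : ∀ᶠ x in 𝓝 y, x ∉ Ω := by
    filter_upwards [h.mem_iff, h.contDiffAt.continuousAt.eventually (lt_mem_nhds hpos)]
      with x hx1 hx2 hx3
    exact absurd (hx1.1 hx3) hx2.not_gt
  obtain ⟨x, hx1, hx2⟩ := mem_closure_iff_nhds.1 hy.1 _ h2
  exact hx1 hx2

theorem mem_frontier (h : IsLocalDefiningFunction Ω y φ) (hΩ : IsOpen Ω) (hy : φ y = 0) :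
    y ∈ frontier Ω := by
  refine ⟨?_, ?_⟩
  · have := h.eventually_line_mem hy (v := -gradient φ y) (by
      rw [inner_neg_right, neg_lt_zero]
      exact real_inner_self_pos.2 h.gradient_ne_zero)
    rw [mem_closure_iff_frequently]
    have hc : Tendsto (fun t : ℝ => y + t • -gradient φ y) (𝓝[>] 0) (𝓝 y) := by
      have : Continuous fun t : ℝ => y + t • -gradient φ y := by fun_prop
      simpa using (this.tendsto 0).mono_left nhdsWithin_le_nhds
    exact hc.frequently this.frequently
  · rw [hΩ.interior_eq]
    exact fun hmem => absurd (h.mem_iff.self_of_nhds.1 hmem) (by rw [hy]; exact lt_irrefl _)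

/-- Suppose that the unit gradients `e` of `φ` and `e'` of `ψ` differ. The direction `e' - e`
decreases `φ` to first order, hence enters `Ω`; but it increases `ψ`, because `⟨e', e' - e⟩ = 1 -
⟨e, e'⟩ > 0`. -/
theorem unitGradient_eq (h : IsLocalDefiningFunction Ω y φ) (h' : IsLocalDefiningFunction Ω y ψ)
    (hΩ : IsOpen Ω) (hy : y ∈ frontier Ω) : unitGradient φ y = unitGradient ψ y := by
  by_contra hne
  have e1 := norm_unitGradient h.gradient_ne_zero
  have e2 := norm_unitGradient h'.gradient_ne_zero
  have hlt : inner ℝ (unitGradient φ y) (unitGradient ψ y) < 1 := 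
    (inner_lt_one_iff_real_of_norm_eq_one e1 e2).2 hne
  have hgr : ∀ {φ : E n → ℝ}, gradient φ y ≠ 0 → gradient φ y = ‖gradient φ y‖ • unitGradient φ y :=
    fun {φ} h => by rw [unitGradient, smul_inv_smul₀ (norm_ne_zero_iff.2 h)]
  have hv : inner ℝ (gradient φ y) (unitGradient ψ y - unitGradient φ y) < 0 := by
    rw [hgr h.gradient_ne_zero, inner_smul_left, inner_sub_right, real_inner_self_eq_norm_sq, e1]
    exact mul_neg_of_pos_of_neg (norm_pos_iff.2 h.gradient_ne_zero) (by linarith)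
  have h2 := h'.inner_nonpos (h'.apply_eq_zero hΩ hy)
    (h.eventually_line_mem (h.apply_eq_zero hΩ hy) hv)
  rw [hgr h'.gradient_ne_zero, inner_smul_left, inner_sub_right, real_inner_self_eq_norm_sq, e2,
    real_inner_comm] at h2
  have : 0 < ‖gradient ψ y‖ * (1 ^ 2 - inner ℝ (unitGradient φ y) (unitGradient ψ y)) :=
    mul_pos (norm_pos_iff.2 h'.gradient_ne_zero) (by linarith)
  exact absurd h2 (not_le.2 this)

end IsLocalDefiningFunction

namespace IsC2Domain

theorem definingFunction_spec (hΩ : IsC2Domain Ω) (hy : y ∈ frontier Ω) :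
    IsLocalDefiningFunction Ω y (definingFunction Ω y) := by
  have h := hΩ.boundary y hy
  rw [definingFunction, dif_pos h]
  exact h.choose_spec

theorem inwardNormal_eq (hΩ : IsC2Domain Ω) (hy : y ∈ frontier Ω)
    (h : IsLocalDefiningFunction Ω y φ) : inwardNormal Ω y = -unitGradient φ y := by
  rw [inwardNormal, (hΩ.definingFunction_spec hy).unitGradient_eq h hΩ.isOpen hy]

theorem norm_inwardNormal (hΩ : IsC2Domain Ω) (hy : y ∈ frontier Ω) : ‖inwardNormal Ω y‖ = 1 := by
  rw [inwardNormal, norm_neg, norm_unitGradient (hΩ.definingFunction_spec hy).gradient_ne_zero]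

end IsC2Domain

/-- Near a boundary point, `f` is the nearest boundary point and `s` the signed distance to the
boundary, positive inside. -/
structure IsFootpoint (Ω : Set (E n)) (f : E n → E n) (s : E n → ℝ) (x : E n) : Prop where
  mem : f x ∈ frontier Ω
  add_eq : f x + s x • inwardNormal Ω (f x) = x
  contDiffAt_foot : ContDiffAt ℝ 1 f x
  contDiffAt_depth : ContDiffAt ℝ 1 s x
  contDiffAt_normal : ContDiffAt ℝ 1 (fun x => inwardNormal Ω (f x)) x
  mem_iff : x ∈ Ω ↔ 0 < s x
  inner_eq_zero : ∀ v, inner ℝ (inwardNormal Ω (f x)) (fderiv ℝ f x v) = 0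

/-- The derivative at `t = 0` of `(y, t) ↦ (y + t ν(y), φ(y))`. -/
def footpointEquiv (ν : E n) (ℓ : E n →L[ℝ] ℝ) (h : ℓ ν ≠ 0) : (E n × ℝ) ≃L[ℝ] (E n × ℝ) :=
  ContinuousLinearEquiv.equivOfInverse
    (((ContinuousLinearMap.fst ℝ (E n) ℝ) + (ContinuousLinearMap.snd ℝ (E n) ℝ).smulRight ν).prod
      (ℓ.comp (ContinuousLinearMap.fst ℝ (E n) ℝ)))
    (((ContinuousLinearMap.fst ℝ (E n) ℝ) - ((ℓ ν)⁻¹ •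
      (ℓ.comp (ContinuousLinearMap.fst ℝ (E n) ℝ) - ContinuousLinearMap.snd ℝ (E n) ℝ)).smulRight
        ν).prod ((ℓ ν)⁻¹ •
      (ℓ.comp (ContinuousLinearMap.fst ℝ (E n) ℝ) - ContinuousLinearMap.snd ℝ (E n) ℝ)))
    (by
      rintro ⟨v, t⟩
      simp [h, mul_comm])
    (by
      rintro ⟨v, t⟩
      simp
      field_simp
      ring)

/-- No chart of the boundary is needed: the inverse function theorem is applied in `E n × ℝ` to `(y,
t) ↦ (y + tN(y), φ(y))`, where `N = -∇φ/|∇φ|` is a `C¹` field off the boundary as well. The preimage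
of `(x, 0)` is a zero of `φ`, which is the foot of `x`, together with its signed depth. -/
theorem IsC2Domain.exists_isFootpoint (hΩ : IsC2Domain Ω) (hy : y ∈ frontier Ω) :
    ∃ (f : E n → E n) (s : E n → ℝ), ∀ᶠ p in 𝓝 (y, (0 : ℝ)), p.1 ∈ frontier Ω →
      (∀ᶠ x in 𝓝 (p.1 + p.2 • inwardNormal Ω p.1), IsFootpoint Ω f s x) ∧
      f (p.1 + p.2 • inwardNormal Ω p.1) = p.1 ∧ s (p.1 + p.2 • inwardNormal Ω p.1) = p.2 := by
  obtain ⟨φ, hφ⟩ := hΩ.boundary y hy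
  have hφ0 := hφ.apply_eq_zero hΩ.isOpen hy
  set N : E n → E n := fun z => -unitGradient φ z with hN
  have hNy : ContDiffAt ℝ 1 N y := hφ.contDiffAt_unitGradient.neg
  have hG : 0 < ‖gradient φ y‖ := norm_pos_iff.2 hφ.gradient_ne_zero
  have hℓ : fderiv ℝ φ y (N y) = -‖gradient φ y‖ := by
    rw [← IsLocalDefiningFunction.inner_gradient, hN, inner_neg_right, unitGradient,
      inner_smul_right, real_inner_self_eq_norm_sq]
    field_simp
  have hℓ0 : fderiv ℝ φ y (N y) ≠ 0 := by rw [hℓ]; linarith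
  set S : E n × ℝ → E n × ℝ := fun p => (p.1 + p.2 • N p.1, φ p.1) with hS
  have hSC : ContDiffAt ℝ 1 S (y, 0) := by
    have h1 : ContDiffAt ℝ 1 (fun p : E n × ℝ => N p.1) (y, 0) :=
      ContDiffAt.comp (g := N) (y, (0 : ℝ)) hNy contDiffAt_fst
    have h2 : ContDiffAt ℝ 1 (fun p : E n × ℝ => φ p.1) (y, 0) :=
      ContDiffAt.comp (y, (0 : ℝ)) (hφ.contDiffAt.of_le (by norm_num)) contDiffAt_fst
    exact (contDiffAt_fst.add (contDiffAt_snd.smul h1)).prodMk h2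
  have hSD : HasFDerivAt S (footpointEquiv (N y) (fderiv ℝ φ y) hℓ0 : E n × ℝ →L[ℝ] E n × ℝ)
      (y, 0) := by
    have h1 : HasFDerivAt (fun p : E n × ℝ => N p.1)
        ((fderiv ℝ N y).comp (ContinuousLinearMap.fst ℝ (E n) ℝ)) (y, (0 : ℝ)) :=
      HasFDerivAt.comp (g := N) (y, (0 : ℝ)) (hNy.differentiableAt (by norm_num)).hasFDerivAt hasFDerivAt_fst
    have h2 : HasFDerivAt (fun p : E n × ℝ => φ p.1)
        ((fderiv ℝ φ y).comp (ContinuousLinearMap.fst ℝ (E n) ℝ)) (y, (0 : ℝ)) :=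
      HasFDerivAt.comp (y, (0 : ℝ)) hφ.differentiableAt.hasFDerivAt hasFDerivAt_fst
    refine ((hasFDerivAt_fst.add (hasFDerivAt_snd.smul h1)).prodMk h2).congr_fderiv ?_
    ext <;> simp [footpointEquiv]
  have hS0 : S (y, 0) = (y, 0) := by simp [hS, hφ0]
  set R := hSC.localInverse hSD one_ne_zero with hR
  have hRy : R (y, 0) = (y, 0) := by
    have := hSC.localInverse_apply_image hSD one_ne_zero
    rwa [hS0] at this
  have hRC : ContDiffAt ℝ 1 R (y, 0) := by
    have := hSC.to_localInverse hSD one_ne_zero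
    rwa [hS0] at this
  have hstrict := hSC.hasStrictFDerivAt' hSD one_ne_zero
  have hleft : ∀ᶠ p in 𝓝 (y, (0 : ℝ)), R (S p) = p := hstrict.eventually_left_inverse
  have hright : ∀ᶠ q in 𝓝 (y, (0 : ℝ)), S (R q) = q := by
    have := hstrict.eventually_right_inverse
    rwa [hS0] at this
  set g : E n → E n × ℝ := fun x => R (x, 0) with hg
  have hgy : g y = (y, 0) := hRy
  have hgC : ContDiffAt ℝ 1 g y :=
    ContDiffAt.comp y hRC (contDiffAt_id.prodMk contDiffAt_const)
  have hgc : Tendsto g (𝓝 y) (𝓝 (y, 0)) := hgy ▸ hgC.continuousAt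
  have hfc : Tendsto (fun x => (g x).1) (𝓝 y) (𝓝 y) := (continuous_fst.tendsto _).comp hgc
  have hSg : ∀ᶠ x in 𝓝 y, S (g x) = (x, 0) := by
    have : Tendsto (fun x : E n => (x, (0 : ℝ))) (𝓝 y) (𝓝 (y, 0)) := by
      exact (continuous_id.prodMk continuous_const).tendsto y
    exact this.eventually hright
  have hbd : ∀ᶠ x in 𝓝 y, (g x).1 ∈ frontier Ω := by
    filter_upwards [hSg, hfc.eventually hφ.eventually] with x h1 h2
    exact h2.mem_frontier hΩ.isOpen (congrArg Prod.snd h1)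
  have hnorm : ∀ᶠ x in 𝓝 y, inwardNormal Ω (g x).1 = N (g x).1 := by
    filter_upwards [hbd, hfc.eventually hφ.eventually] with x h1 h2
    exact hΩ.inwardNormal_eq h1 h2
  -- As `φ` vanishes at the foot, strict differentiability gives `φ(x) = t Dφ(y)N(foot)` up to
  -- `|t||∇φ(y)|/4`, while `Dφ(y)N < -|∇φ(y)|/2`. So `φ(x)` and the depth `t` have opposite signs.
  have hsign : ∀ᶠ x in 𝓝 y, x ∈ Ω ↔ 0 < (g x).2 := by
    have hs := (hφ.contDiffAt.hasStrictFDerivAt (by norm_num)).isLittleO.def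
      (c := ‖gradient φ y‖ / 4) (by positivity)
    have hpair : Tendsto (fun x => (x, (g x).1)) (𝓝 y) (𝓝 (y, y)) :=
      tendsto_id.prodMk_nhds hfc
    have hNlim : Tendsto (fun x => fderiv ℝ φ y (N (g x).1)) (𝓝 y)
        (𝓝 (fderiv ℝ φ y (N y))) :=
      ((fderiv ℝ φ y).continuous.tendsto _).comp (hNy.continuousAt.tendsto.comp hfc)
    rw [hℓ] at hNlim
    filter_upwards [hpair.eventually hs, hSg, hfc.eventually hφ.eventually, hφ.mem_iff,
      hNlim.eventually (gt_mem_nhds (show -‖gradient φ y‖ < -‖gradient φ y‖ / 2 by linarith))]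
      with x h1 h2 h3 h4 h5
    have e1 : (g x).1 + (g x).2 • N (g x).1 = x := congrArg Prod.fst h2
    have e2 : φ (g x).1 = 0 := congrArg Prod.snd h2
    have e3 : x - (g x).1 = (g x).2 • N (g x).1 := by rw [sub_eq_iff_eq_add', e1]
    simp only [e2, sub_zero, e3, map_smul, smul_eq_mul, norm_smul, hN, norm_neg,
      norm_unitGradient h3.gradient_ne_zero, mul_one, Real.norm_eq_abs] at h1 h5
    rw [h4]
    have h6 := abs_le.1 h1
    constructor
    · intro h
      by_contra! hle
      rw [abs_of_nonpos hle] at h6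
      nlinarith [h6.1]
    · intro h
      rw [abs_of_pos h] at h6
      nlinarith [h6.2]
  have hgood : ∀ᶠ x in 𝓝 y, IsFootpoint Ω (fun x => (g x).1) (fun x => (g x).2) x := by
    filter_upwards [hSg.eventually_nhds, hbd, hnorm.eventually_nhds, hsign,
      hgC.eventually (by simp), hfc.eventually hφ.eventually] with x h1 h2 h3 h4 h5 h6
    have h7 : ContDiffAt ℝ 1 (fun x => (g x).1) x := contDiffAt_fst.comp x h5
    refine ⟨h2, ?_, h7, contDiffAt_snd.comp x h5, ?_, h4, fun v => ?_⟩
    · rw [h3.self_of_nhds]; exact congrArg Prod.fst h1.self_of_nhds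
    · have : ContDiffAt ℝ 1 (fun x => N (g x).1) x :=
        ContDiffAt.comp (g := N) x h6.contDiffAt_unitGradient.neg h7
      exact this.congr_of_eventuallyEq h3
    -- Differentiating `φ ∘ foot = 0` shows that the derivative of the foot has tangential range.
    · have e1 : (fun x => φ (g x).1) =ᶠ[𝓝 x] fun _ => 0 := by
        filter_upwards [h1] with z hz using congrArg Prod.snd hz
      have e2 := (h6.differentiableAt.hasFDerivAt.comp x
        (h7.differentiableAt (by norm_num)).hasFDerivAt)
      have e3 := (e2.congr_of_eventuallyEq e1.symm).unique (hasFDerivAt_const (0 : ℝ) x)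
      have e4 : fderiv ℝ φ (g x).1 (fderiv ℝ (fun x => (g x).1) x v) = 0 := by
        have := congrArg (fun L => L v) e3
        simpa using this
      rw [h3.self_of_nhds, hN, inner_neg_left, unitGradient, inner_smul_left,
        IsLocalDefiningFunction.inner_gradient, e4]
      simp
  refine ⟨fun x => (g x).1, fun x => (g x).2, ?_⟩
  have hpc : Tendsto (fun p : E n × ℝ => p.1 + p.2 • N p.1) (𝓝 (y, 0)) (𝓝 y) := by
    have h1 : ContinuousAt (fun p : E n × ℝ => p.1 + p.2 • N p.1) (y, 0) :=
      (contDiffAt_fst.comp _ hSC).continuousAt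
    simpa [ContinuousAt] using h1
  have hp1 : Tendsto (fun p : E n × ℝ => p.1) (𝓝 (y, 0)) (𝓝 y) := continuous_fst.tendsto _
  filter_upwards [hleft, hpc.eventually hgood.eventually_nhds, hp1.eventually hφ.eventually]
    with p h1 h2 h3 hp
  have hNp : inwardNormal Ω p.1 = N p.1 := hΩ.inwardNormal_eq hp h3
  rw [hNp]
  have h4 : S p = (p.1 + p.2 • N p.1, 0) := by
    rw [hS]; simp only [h3.apply_eq_zero hΩ.isOpen hp]
  rw [h4] at h1
  exact ⟨h2, congrArg Prod.fst h1, congrArg Prod.snd h1⟩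

variable {n : ℕ} {Ω : Set (E n)} {δ : ℝ}

/-! ### Tubular neighbourhoods of the boundary -/

/-- A two-sided tubular neighbourhood of width `δ` of `∂Ω`, with the projection `foot` to `∂Ω` and
the signed distance `depth`. -/
structure Collar (Ω : Set (E n)) (δ : ℝ) where
  carrier : Set (E n)
  foot : E n → E n
  depth : E n → ℝ
  pos : 0 < δ
  isOpen : IsOpen carrier
  isFootpoint : ∀ x ∈ carrier, IsFootpoint Ω foot depth x
  abs_depth_lt : ∀ x ∈ carrier, |depth x| < δ
  add_mem : ∀ y ∈ frontier Ω, ∀ t, |t| < δ → y + t • inwardNormal Ω y ∈ carrier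
  foot_add : ∀ y ∈ frontier Ω, ∀ t, |t| < δ → foot (y + t • inwardNormal Ω y) = y
  depth_add : ∀ y ∈ frontier Ω, ∀ t, |t| < δ → depth (y + t • inwardNormal Ω y) = t
  measurable_foot : Measurable foot
  measurable_depth : Measurable depth

theorem IsFootpoint.congr {f g : E n → E n} {s t : E n → ℝ} {x : E n} (h : IsFootpoint Ω f s x)
    (hf : g =ᶠ[𝓝 x] f) (hs : t =ᶠ[𝓝 x] s) : IsFootpoint Ω g t x where
  mem := hf.self_of_nhds ▸ h.mem
  add_eq := by rw [hf.self_of_nhds, hs.self_of_nhds, h.add_eq]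
  contDiffAt_foot := h.contDiffAt_foot.congr_of_eventuallyEq hf
  contDiffAt_depth := h.contDiffAt_depth.congr_of_eventuallyEq hs
  contDiffAt_normal := h.contDiffAt_normal.congr_of_eventuallyEq (hf.fun_comp (inwardNormal Ω))
  mem_iff := by rw [hs.self_of_nhds, h.mem_iff]
  inner_eq_zero v := by rw [hf.fderiv_eq, hf.self_of_nhds, h.inner_eq_zero]

theorem IsC2Domain.isCompact_frontier (hΩ : IsC2Domain Ω) : IsCompact (frontier Ω) :=
  Metric.isCompact_of_isClosed_isBounded isClosed_frontier
    (hΩ.isBounded.closure.subset frontier_subset_closure)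

-- The local inverses are glued by uniqueness. If a point has two representations of depth below `δ
-- ≤ Δ/2`, with `Δ` a Lebesgue number of the cover, their feet are less than `Δ` apart, so that one
-- local inverse sees both. Foot and depth can then be chosen pointwise and still agree locally with
-- `C¹` maps.
open Classical in
theorem IsC2Domain.exists_collar (hΩ : IsC2Domain Ω) :
    ∃ δ₀ > 0, ∀ δ, 0 < δ → δ ≤ δ₀ → Nonempty (Collar Ω δ) := by
  choose! F S hFS using fun y (hy : y ∈ frontier Ω) => hΩ.exists_isFootpoint hy
  obtain ⟨Δ, hΔ, hball⟩ := lebesgue_number_lemma_of_metric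
    (hΩ.isCompact_frontier.prod (isCompact_singleton (x := (0 : ℝ))))
    (c := fun y : frontier Ω => interior {p : E n × ℝ | p.1 ∈ frontier Ω →
      (∀ᶠ x in 𝓝 (p.1 + p.2 • inwardNormal Ω p.1), IsFootpoint Ω (F y) (S y) x) ∧
      F y (p.1 + p.2 • inwardNormal Ω p.1) = p.1 ∧ S y (p.1 + p.2 • inwardNormal Ω p.1) = p.2})
    (fun _ => isOpen_interior) (by
      rintro ⟨y, t⟩ ⟨hy, ht⟩
      obtain rfl : t = 0 := ht
      exact mem_iUnion.2 ⟨⟨y, hy⟩, mem_interior_iff_mem_nhds.2 (hFS y hy)⟩)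
  have hloc : ∀ y ∈ frontier Ω, ∃ (f : E n → E n) (s : E n → ℝ), ∀ y' ∈ frontier Ω, ∀ t : ℝ,
      dist y' y < Δ → |t| < Δ →
      (∀ᶠ x in 𝓝 (y' + t • inwardNormal Ω y'), IsFootpoint Ω f s x) ∧
      f (y' + t • inwardNormal Ω y') = y' ∧ s (y' + t • inwardNormal Ω y') = t := by
    intro y hy
    obtain ⟨i, hi⟩ := hball (y, 0) ⟨hy, rfl⟩
    refine ⟨F i, S i, fun y' hy' t h1 h2 => ?_⟩
    have hmem : (y', t) ∈ Metric.ball (y, (0 : ℝ)) Δ := by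
      rw [Metric.mem_ball, Prod.dist_eq, max_lt_iff]
      exact ⟨h1, by simpa [Real.dist_eq] using h2⟩
    exact interior_subset (hi hmem) hy'
  refine ⟨Δ / 2, half_pos hΔ, fun δ hδ hδΔ => ?_⟩
  have huniq : ∀ y ∈ frontier Ω, ∀ t : ℝ, |t| < δ → ∀ y' ∈ frontier Ω, ∀ t' : ℝ, |t'| < δ →
      y + t • inwardNormal Ω y = y' + t' • inwardNormal Ω y' → y = y' ∧ t = t' := by
    intro y hy t ht y' hy' t' ht' h
    obtain ⟨f, s, hfs⟩ := hloc y hy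
    have hd : dist y' y < Δ := by
      have : y' - y = t • inwardNormal Ω y - t' • inwardNormal Ω y' := by
        rw [sub_eq_sub_iff_add_eq_add, add_comm (t • _), h, add_comm]
      rw [dist_eq_norm, this]
      refine (norm_sub_le _ _).trans_lt ?_
      rw [norm_smul, norm_smul, hΩ.norm_inwardNormal hy, hΩ.norm_inwardNormal hy']
      simp only [Real.norm_eq_abs, mul_one]
      linarith
    have h1 := hfs y hy t (by simpa using hΔ) (by linarith)
    have h2 := hfs y' hy' t' hd (by linarith)
    rw [← h] at h2
    exact ⟨h1.2.1.symm.trans h2.2.1, h1.2.2.symm.trans h2.2.2⟩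
  let P : E n → E n × ℝ → Prop := fun x p =>
    p.1 ∈ frontier Ω ∧ |p.2| < δ ∧ p.1 + p.2 • inwardNormal Ω p.1 = x
  let T : Set (E n) := {x | ∃ p, P x p}
  let foot : E n → E n := fun x => if h : ∃ p, P x p then h.choose.1 else 0
  let depth : E n → ℝ := fun x => if h : ∃ p, P x p then h.choose.2 else 0
  have hfd : ∀ x p, P x p → foot x = p.1 ∧ depth x = p.2 := by
    intro x p hp
    have hx : ∃ p, P x p := ⟨p, hp⟩
    have hc := hx.choose_spec
    have := huniq _ hc.1 _ hc.2.1 _ hp.1 _ hp.2.1 (hc.2.2.trans hp.2.2.symm)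
    simp only [foot, depth, dif_pos hx]
    exact this
  have hev : ∀ x ∈ T, ∃ (f : E n → E n) (s : E n → ℝ), IsFootpoint Ω f s x ∧
      ∀ᶠ x' in 𝓝 x, P x' (f x', s x') := by
    rintro x ⟨⟨y, t⟩, hy, ht, rfl⟩
    obtain ⟨f, s, hfs⟩ := hloc y hy
    obtain ⟨h1, h2, h3⟩ := hfs y hy t (by simpa using hΔ) (by simp only at ht; linarith)
    refine ⟨f, s, h1.self_of_nhds, ?_⟩
    have hcont := h1.self_of_nhds.contDiffAt_depth.continuousAt.abs
    have hlt : |s (y + t • inwardNormal Ω y)| < δ := by rw [h3]; exact ht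
    filter_upwards [h1, hcont.eventually (gt_mem_nhds hlt)] with x' h4 h5
    exact ⟨h4.mem, h5, h4.add_eq⟩
  have hopen : IsOpen T := by
    rw [isOpen_iff_mem_nhds]
    intro x hx
    obtain ⟨f, s, -, h⟩ := hev x hx
    filter_upwards [h] with x' hx' using ⟨_, hx'⟩
  have hfoot : ∀ x ∈ T, IsFootpoint Ω foot depth x := by
    intro x hx
    obtain ⟨f, s, h1, h2⟩ := hev x hx
    exact h1.congr (by filter_upwards [h2] with x' hx' using (hfd _ _ hx').1)
      (by filter_upwards [h2] with x' hx' using (hfd _ _ hx').2)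
  have hoff : ∀ x ∉ T, foot x = 0 ∧ depth x = 0 := fun x hx => by
    have hx' : ¬ ∃ p, P x p := hx
    simp only [foot, depth, dif_neg hx']
    exact ⟨trivial, trivial⟩
  have hm1 : Measurable foot := by
    rw [← Set.piecewise_same T foot]
    refine ContinuousOn.measurable_piecewise (fun x hx =>
      (hfoot x hx).contDiffAt_foot.continuousAt.continuousWithinAt) ?_ hopen.measurableSet
    exact (continuousOn_const (c := (0 : E n))).congr fun x hx => (hoff x hx).1
  have hm2 : Measurable depth := by
    rw [← Set.piecewise_same T depth]
    refine ContinuousOn.measurable_piecewise (fun x hx =>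
      (hfoot x hx).contDiffAt_depth.continuousAt.continuousWithinAt) ?_ hopen.measurableSet
    exact (continuousOn_const (c := (0 : ℝ))).congr fun x hx => (hoff x hx).2
  refine ⟨⟨T, foot, depth, hδ, hopen, hfoot, ?_, ?_, ?_, ?_, hm1, hm2⟩⟩
  · rintro x ⟨p, hp⟩
    rw [(hfd x p hp).2]; exact hp.2.1
  · exact fun y hy t ht => ⟨(y, t), hy, ht, rfl⟩
  · exact fun y hy t ht => (hfd _ (y, t) ⟨hy, ht, rfl⟩).1
  · exact fun y hy t ht => (hfd _ (y, t) ⟨hy, ht, rfl⟩).2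

/-! ### Derivatives of the foot, the depth and the normal field -/

namespace Collar

variable (C : Collar Ω δ)

/-- The derivative of the normal field of the collar; at boundary points, minus the shape
operator of `∂Ω`. -/
def normalDeriv (y : E n) : E n →L[ℝ] E n := fderiv ℝ (fun x => inwardNormal Ω (C.foot x)) y

theorem frontier_subset : frontier Ω ⊆ C.carrier := fun y hy => by
  simpa using C.add_mem y hy 0 (by simpa using C.pos)

theorem foot_of_mem {y : E n} (hy : y ∈ frontier Ω) : C.foot y = y := by
  simpa using C.foot_add y hy 0 (by simpa using C.pos)

theorem depth_of_mem {y : E n} (hy : y ∈ frontier Ω) : C.depth y = 0 := by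
  simpa using C.depth_add y hy 0 (by simpa using C.pos)

variable {C} {x y : E n}

theorem hasFDerivAt_foot (hx : x ∈ C.carrier) : HasFDerivAt C.foot (fderiv ℝ C.foot x) x :=
  ((C.isFootpoint x hx).contDiffAt_foot.differentiableAt (by norm_num)).hasFDerivAt

theorem hasFDerivAt_depth (hx : x ∈ C.carrier) : HasFDerivAt C.depth (fderiv ℝ C.depth x) x :=
  ((C.isFootpoint x hx).contDiffAt_depth.differentiableAt (by norm_num)).hasFDerivAt

theorem hasFDerivAt_normal (hx : x ∈ C.carrier) :
    HasFDerivAt (fun x => inwardNormal Ω (C.foot x)) (C.normalDeriv x) x :=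
  ((C.isFootpoint x hx).contDiffAt_normal.differentiableAt (by norm_num)).hasFDerivAt

theorem inner_normalDeriv (hΩ : IsC2Domain Ω) (hx : x ∈ C.carrier) (v : E n) :
    inner ℝ (inwardNormal Ω (C.foot x)) (C.normalDeriv x v) = 0 := by
  have h1 : (fun x => ‖inwardNormal Ω (C.foot x)‖ ^ 2) =ᶠ[𝓝 x] fun _ => 1 := by
    filter_upwards [C.isOpen.mem_nhds hx] with z hz
    rw [hΩ.norm_inwardNormal (C.isFootpoint z hz).mem, one_pow]
  have h2 := ((C.hasFDerivAt_normal hx).norm_sq.congr_of_eventuallyEq h1.symm).unique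
    (hasFDerivAt_const (1 : ℝ) x)
  have h3 := congrArg (fun L => L v) h2
  simpa using h3

theorem fderiv_sum (hx : x ∈ C.carrier) (v : E n) :
    fderiv ℝ C.foot x v + (C.depth x • C.normalDeriv x v +
      fderiv ℝ C.depth x v • inwardNormal Ω (C.foot x)) = v := by
  have h1 : (fun x => C.foot x + C.depth x • inwardNormal Ω (C.foot x)) =ᶠ[𝓝 x] fun x => x := by
    filter_upwards [C.isOpen.mem_nhds hx] with z hz using (C.isFootpoint z hz).add_eq
  have h2 := (((C.hasFDerivAt_foot hx).add ((C.hasFDerivAt_depth hx).smul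
    (C.hasFDerivAt_normal hx))).congr_of_eventuallyEq h1.symm).unique (hasFDerivAt_id x)
  have h3 := congrArg (fun L => L v) h2
  simpa using h3

/-- The gradient of the distance function is the normal field. -/
theorem fderiv_depth (hΩ : IsC2Domain Ω) (hx : x ∈ C.carrier) (v : E n) :
    fderiv ℝ C.depth x v = inner ℝ (inwardNormal Ω (C.foot x)) v := by
  conv_rhs => rw [← fderiv_sum hx v]
  rw [inner_add_right, inner_add_right, inner_smul_right, inner_smul_right,
    C.inner_normalDeriv hΩ hx, (C.isFootpoint x hx).inner_eq_zero, real_inner_self_eq_norm_sq,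
    hΩ.norm_inwardNormal (C.isFootpoint x hx).mem]
  simp

/-- The normal field depends on the foot alone, so that `ν ∘ foot ∘ foot = ν ∘ foot`; the chain rule
moves the derivative to the boundary. -/
theorem normalDeriv_eq_comp (hx : x ∈ C.carrier) (v : E n) :
    C.normalDeriv x v = C.normalDeriv (C.foot x) (fderiv ℝ C.foot x v) := by
  have h1 : (fun x => inwardNormal Ω (C.foot (C.foot x))) =ᶠ[𝓝 x]
      fun x => inwardNormal Ω (C.foot x) := by
    filter_upwards [C.isOpen.mem_nhds hx] with z hz
    rw [C.foot_of_mem (C.isFootpoint z hz).mem]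
  have hmem := C.frontier_subset (C.isFootpoint x hx).mem
  have h2 := HasFDerivAt.comp (g := fun x => inwardNormal Ω (C.foot x)) x
    (C.hasFDerivAt_normal hmem) (C.hasFDerivAt_foot hx)
  have h3 := (h2.congr_of_eventuallyEq h1.symm).unique (C.hasFDerivAt_normal hx)
  exact (congrArg (fun L => L v) h3).symm

/-- This is the derivative of `foot + depth • ν(foot) = id` with its normal part moved to the right:
`1 + tDν` composed with the derivative of the foot is the tangential projection. -/
theorem fderiv_foot_add (hΩ : IsC2Domain Ω) (hx : x ∈ C.carrier) (v : E n) :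
    fderiv ℝ C.foot x v + C.depth x • C.normalDeriv (C.foot x) (fderiv ℝ C.foot x v) =
      v - inner ℝ (inwardNormal Ω (C.foot x)) v • inwardNormal Ω (C.foot x) := by
  rw [← normalDeriv_eq_comp hx, eq_sub_iff_add_eq, ← fderiv_depth hΩ hx, add_assoc, fderiv_sum hx]

theorem fderiv_foot_of_mem (hΩ : IsC2Domain Ω) (hy : y ∈ frontier Ω) (v : E n) :
    fderiv ℝ C.foot y v = v - inner ℝ (inwardNormal Ω y) v • inwardNormal Ω y := by
  have := fderiv_foot_add hΩ (C.frontier_subset hy) v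
  rwa [C.depth_of_mem hy, zero_smul, add_zero, C.foot_of_mem hy] at this

theorem normalDeriv_normal (hΩ : IsC2Domain Ω) (hy : y ∈ frontier Ω) :
    C.normalDeriv y (inwardNormal Ω y) = 0 := by
  have := normalDeriv_eq_comp (C.frontier_subset hy) (inwardNormal Ω y)
  rw [C.foot_of_mem hy, fderiv_foot_of_mem hΩ hy, real_inner_self_eq_norm_sq,
    hΩ.norm_inwardNormal hy] at this
  simpa using this

/-- `1 + t M` inverts the derivative of the projection completed by the normal. -/
theorem one_add_smul_comp (hΩ : IsC2Domain Ω) (hx : x ∈ C.carrier) :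
    (1 + C.depth x • C.normalDeriv (C.foot x)) * (fderiv ℝ C.foot x +
      (innerSL ℝ (inwardNormal Ω (C.foot x))).smulRight (inwardNormal Ω (C.foot x))) = 1 := by
  ext1 v
  have h := fderiv_foot_add hΩ hx v
  have h2 := normalDeriv_normal (C := C) hΩ (C.isFootpoint x hx).mem
  simp only [mul_apply_eq_comp, add_apply,
    one_apply_eq_self, smul_apply,
    ContinuousLinearMap.smulRight_apply, innerSL_apply_apply, map_add, map_smul, h2, smul_zero,
    add_zero]
  rw [h, sub_add_cancel]

/-- The field `ν ∘ foot` is `-∇φ/|∇φ|` made constant along normals. The traces of their derivatives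
differ by the normal-normal entry, which is zero because `∇φ/|∇φ|` has constant length. -/
theorem sum_normalDeriv (hΩ : IsC2Domain Ω) (hy : y ∈ frontier Ω) :
    ∑ i, C.normalDeriv y (EuclideanSpace.single i 1) i = -meanCurvature Ω y := by
  set φ := definingFunction Ω y
  have hφ : IsLocalDefiningFunction Ω y φ := hΩ.definingFunction_spec hy
  have hyC := C.frontier_subset hy
  have hfy := C.foot_of_mem hy
  have hc : Tendsto C.foot (𝓝 y) (𝓝 y) := by
    have := (C.hasFDerivAt_foot hyC).continuousAt.tendsto
    rwa [hfy] at this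
  have h1 : (fun x => inwardNormal Ω (C.foot x)) =ᶠ[𝓝 y] fun x => -unitGradient φ (C.foot x) := by
    filter_upwards [C.isOpen.mem_nhds hyC, hc.eventually hφ.eventually] with z hz hz'
    exact hΩ.inwardNormal_eq (C.isFootpoint z hz).mem hz'
  set N' := fderiv ℝ (unitGradient φ) y
  have hN' : HasFDerivAt (unitGradient φ) N' (C.foot y) := by
    rw [hfy]; exact (hφ.contDiffAt_unitGradient.differentiableAt (by norm_num)).hasFDerivAt
  have h2 := (((hN'.comp y (C.hasFDerivAt_foot hyC)).neg).congr_of_eventuallyEq h1).unique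
    (C.hasFDerivAt_normal hyC)
  have h3 : ∀ v, C.normalDeriv y v =
      -(N' v - inner ℝ (inwardNormal Ω y) v • N' (inwardNormal Ω y)) := by
    intro v
    rw [← h2]
    simp [fderiv_foot_of_mem hΩ hy]
  have h4 : inner ℝ (inwardNormal Ω y) (N' (inwardNormal Ω y)) = 0 := by
    have hsq : (fun x => ‖unitGradient φ x‖ ^ 2) =ᶠ[𝓝 y] fun _ => 1 := by
      filter_upwards [hφ.eventually] with z hz
      rw [norm_unitGradient hz.gradient_ne_zero, one_pow]
    rw [hfy] at hN'
    have h5 := (hN'.norm_sq.congr_of_eventuallyEq hsq.symm).unique (hasFDerivAt_const (1 : ℝ) y)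
    have h6 := congrArg (fun L => L (inwardNormal Ω y)) h5
    have h7 : inwardNormal Ω y = -unitGradient φ y := rfl
    simp at h6
    rw [h7, inner_neg_left, ← h7, h6, neg_zero]
  have h5 : ∑ i, inner ℝ (inwardNormal Ω y) (EuclideanSpace.single i 1) *
      N' (inwardNormal Ω y) i = 0 := by
    rw [← h4, PiLp.inner_apply]
    simp [EuclideanSpace.inner_single_right, mul_comm]
  simp only [h3]
  simp only [PiLp.neg_apply, PiLp.sub_apply, PiLp.smul_apply, smul_eq_mul, Finset.sum_neg_distrib,
    Finset.sum_sub_distrib, h5, sub_zero]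
  rfl

end Collar

variable {n : ℕ} {Ω : Set (E n)} {δ : ℝ}

/-! ### The Jacobian of normal coordinates -/

theorem det_eq_matrix_det (A : E n →L[ℝ] E n) :
    A.det = (Matrix.of fun i j => A (EuclideanSpace.single j 1) i).det := by
  rw [ContinuousLinearMap.det, ← LinearMap.det_toMatrix (EuclideanSpace.basisFun (Fin n) ℝ).toBasis]
  congr 1

/-- The determinant is a polynomial, hence differentiable. Its derivative at the identity is read
off along lines, from the linear coefficient `tr B` of `det(1 + tB)`. -/
theorem hasFDerivAt_det_one : ∃ L : (E n →L[ℝ] E n) →L[ℝ] ℝ,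
    (∀ A, L A = ∑ i, A (EuclideanSpace.single i 1) i) ∧
    HasFDerivAt (fun A : E n →L[ℝ] E n => A.det) L 1 := by
  have hdiff : Differentiable ℝ (fun A : E n →L[ℝ] E n => A.det) := by
    have : (fun A : E n →L[ℝ] E n => A.det) = fun A => ∑ σ : Equiv.Perm (Fin n),
        ((Equiv.Perm.sign σ : ℤ) : ℝ) * ∏ i, A (EuclideanSpace.single i 1) (σ i) := by
      ext A
      rw [det_eq_matrix_det, Matrix.det_apply']
      simp
    rw [this]
    fun_prop
  refine ⟨_, fun A => ?_, (hdiff 1).hasFDerivAt⟩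
  have h1 := ((hdiff 1).hasFDerivAt.hasLineDerivAt A)
  have h2 : HasDerivAt (fun t : ℝ => ContinuousLinearMap.det (1 + t • A))
      (∑ i, A (EuclideanSpace.single i 1) i) 0 := by
    set B : Matrix (Fin n) (Fin n) ℝ := Matrix.of fun i j => A (EuclideanSpace.single j 1) i
    have e : (fun t : ℝ => ContinuousLinearMap.det (1 + t • A)) = fun t =>
        1 + B.trace * t + (1 + (Polynomial.X : Polynomial ℝ) •
          B.map Polynomial.C).det.divX.divX.eval t * t ^ 2 := by
      ext t
      rw [← Matrix.det_one_add_smul, det_eq_matrix_det]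
      congr 1
      ext i j
      simp [B, Matrix.one_apply]
    rw [e]
    have h3 := (((hasDerivAt_id (0 : ℝ)).const_mul B.trace).const_add 1).add
      (((1 + (Polynomial.X : Polynomial ℝ) • B.map Polynomial.C).det.divX.divX.hasDerivAt
        (0 : ℝ)).mul ((hasDerivAt_id (0 : ℝ)).pow 2))
    refine h3.congr_deriv ?_
    simp [B, Matrix.trace]
  exact h1.unique h2

theorem exists_det_one_add_sub_le {η : ℝ} (hη : 0 < η) : ∃ r > 0, ∀ A : E n →L[ℝ] E n, ‖A‖ < r →
    |(1 + A).det - 1 - ∑ i, A (EuclideanSpace.single i 1) i| ≤ η * ‖A‖ := by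
  obtain ⟨L, hL, hd⟩ := hasFDerivAt_det_one (n := n)
  have h := (hasFDerivAt_iff_isLittleO_nhds_zero.1 hd).def hη
  obtain ⟨r, hr, hb⟩ := Metric.eventually_nhds_iff.1 h
  refine ⟨r, hr, fun A hA => ?_⟩
  have := hb (y := A) (by simpa using hA)
  rw [hL, Real.norm_eq_abs] at this
  convert this using 4
  simp [ContinuousLinearMap.det]

namespace Collar

variable (C : Collar Ω δ)

/-- The Jacobian of `(y, t) ↦ y + t ν(y)`. -/
def jacobian (p : E n × ℝ) : ℝ := (1 + p.2 • C.normalDeriv p.1).det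

theorem measurable_jacobian : Measurable C.jacobian := by
  have h : Measurable C.normalDeriv := measurable_fderiv ℝ _
  have h2 : Measurable fun p : E n × ℝ => (1 : E n →L[ℝ] E n) + p.2 • C.normalDeriv p.1 :=
    (measurable_snd.smul (h.comp measurable_fst)).const_add 1
  exact ContinuousLinearMap.continuous_det.measurable.comp h2

/-- The collar of width `δ' ≤ δ`. -/
def restrict {δ' : ℝ} (h0 : 0 < δ') (h : δ' ≤ δ) : Collar Ω δ' where
  carrier := C.carrier ∩ {x | |C.depth x| < δ'}
  foot := C.foot
  depth := C.depth
  pos := h0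
  isOpen := by
    rw [isOpen_iff_mem_nhds]
    rintro x ⟨hx, hd⟩
    have hc := (C.isFootpoint x hx).contDiffAt_depth.continuousAt.abs
    filter_upwards [C.isOpen.mem_nhds hx, hc.eventually (gt_mem_nhds hd)] with z h1 h2
      using ⟨h1, h2⟩
  isFootpoint x hx := C.isFootpoint x hx.1
  abs_depth_lt x hx := hx.2
  add_mem y hy t ht := ⟨C.add_mem y hy t (ht.trans_le h), by
    rw [mem_ofPred_eq, C.depth_add y hy t (ht.trans_le h)]; exact ht⟩
  foot_add y hy t ht := C.foot_add y hy t (ht.trans_le h)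
  depth_add y hy t ht := C.depth_add y hy t (ht.trans_le h)
  measurable_foot := C.measurable_foot
  measurable_depth := C.measurable_depth

theorem continuousAt_normalDeriv {x : E n} (hx : x ∈ C.carrier) :
    ContinuousAt C.normalDeriv x :=
  (C.isFootpoint x hx).contDiffAt_normal.continuousAt_fderiv one_ne_zero

theorem exists_norm_normalDeriv_le (hΩ : IsC2Domain Ω) :
    ∃ K > 0, ∀ y ∈ frontier Ω, ‖C.normalDeriv y‖ ≤ K := by
  obtain ⟨K, hK⟩ := hΩ.isCompact_frontier.exists_bound_of_continuousOn (f := C.normalDeriv)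
    fun y hy => (C.continuousAt_normalDeriv (C.frontier_subset hy)).continuousWithinAt
  exact ⟨max K 1, by positivity, fun y hy => (hK y hy).trans (le_max_left _ _)⟩

/-- First-order expansion of the Jacobian; the mean curvature appears. -/
theorem exists_jacobian_sub_le (hΩ : IsC2Domain Ω) {η : ℝ} (hη : 0 < η) :
    ∃ τ > 0, ∀ y ∈ frontier Ω, ∀ t, |t| < τ →
      |C.jacobian (y, t) - 1 + meanCurvature Ω y * t| ≤ η * |t| := by
  obtain ⟨K, hK0, hK⟩ := C.exists_norm_normalDeriv_le hΩ
  -- The tolerance `η / K` compensates for `‖t Dν‖ ≤ K|t|`.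
  obtain ⟨r, hr, h⟩ := exists_det_one_add_sub_le (n := n) (div_pos hη hK0)
  refine ⟨r / K, div_pos hr hK0, fun y hy t ht => ?_⟩
  have hn : ‖t • C.normalDeriv y‖ ≤ |t| * K := by
    rw [norm_smul, Real.norm_eq_abs]
    exact mul_le_mul_of_nonneg_left (hK y hy) (abs_nonneg t)
  have := h (t • C.normalDeriv y) (hn.trans_lt ((lt_div_iff₀ hK0).1 ht))
  have e : ∑ i, (t • C.normalDeriv y) (EuclideanSpace.single i 1) i = -(meanCurvature Ω y * t) := by
    simp only [smul_apply, PiLp.smul_apply, smul_eq_mul, ← Finset.mul_sum, sum_normalDeriv hΩ hy]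
    ring
  rw [e, sub_neg_eq_add] at this
  refine this.trans ((mul_le_mul_of_nonneg_left hn (by positivity)).trans (le_of_eq ?_))
  field_simp

/-- A collar so thin that normal coordinates are close to an isometry. -/
structure IsThin : Prop where
  mul_norm_le : ∀ y ∈ frontier Ω, δ * ‖C.normalDeriv y‖ ≤ 1 / 2
  abs_jacobian_sub_one_le : ∀ y ∈ frontier Ω, ∀ t, |t| < δ → |C.jacobian (y, t) - 1| ≤ 1 / 2

end Collar

theorem IsC2Domain.exists_isThin (hΩ : IsC2Domain Ω) :
    ∃ (δ : ℝ) (C : Collar Ω δ), C.IsThin := by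
  obtain ⟨δ₀, hδ₀, h⟩ := hΩ.exists_collar
  obtain ⟨C⟩ := h δ₀ hδ₀ le_rfl
  obtain ⟨K, hK0, hK⟩ := C.exists_norm_normalDeriv_le hΩ
  obtain ⟨K', hK0', hK'⟩ : ∃ K' > 0, ∀ y ∈ frontier Ω, |meanCurvature Ω y| ≤ K' := by
    refine ⟨n * K + 1, by positivity, fun y hy => ?_⟩
    rw [← abs_neg, ← Collar.sum_normalDeriv (C := C) hΩ hy]
    refine (Finset.abs_sum_le_sum_abs _ _).trans ?_
    have : ∀ i ∈ Finset.univ, |C.normalDeriv y (EuclideanSpace.single i 1) i| ≤ K := by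
      intro i _
      refine ((PiLp.norm_apply_le (C.normalDeriv y (EuclideanSpace.single i 1)) i)).trans ?_
      refine ((C.normalDeriv y).le_opNorm _).trans ?_
      simpa using hK y hy
    refine (Finset.sum_le_sum this).trans ?_
    simp
  obtain ⟨τ, hτ, hJ⟩ := C.exists_jacobian_sub_le hΩ one_pos
  -- The four bounds provide a collar, the Jacobian expansion, `δ‖Dν‖ ≤ 1/2`, and `|J - 1| ≤ (1 +
  -- K')|t| ≤ 1/2`.
  have hδ' : 0 < min (min δ₀ τ) (min (1 / 2 / K) (1 / 2 / (1 + K'))) := by positivity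
  refine ⟨_, C.restrict hδ' ((min_le_left _ _).trans (min_le_left _ _)), ⟨fun y hy => ?_,
    fun y hy t ht => ?_⟩⟩
  · have h1 : min (min δ₀ τ) (min (1 / 2 / K) (1 / 2 / (1 + K'))) ≤ 1 / 2 / K :=
      (min_le_right _ _).trans (min_le_left _ _)
    calc _ ≤ 1 / 2 / K * K := mul_le_mul h1 (hK y hy) (norm_nonneg _) (by positivity)
      _ = 1 / 2 := by field_simp
  · have h1 : |t| < τ := ht.trans_le ((min_le_left _ _).trans (min_le_right _ _))
    have h2 : |t| ≤ 1 / 2 / (1 + K') := ht.le.trans ((min_le_right _ _).trans (min_le_right _ _))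
    have h3 := hJ y hy t h1
    have h4 : |meanCurvature Ω y * t| ≤ K' * |t| := by
      rw [abs_mul]; exact mul_le_mul_of_nonneg_right (hK' y hy) (abs_nonneg t)
    have h5 : |C.jacobian (y, t) - 1| ≤ (1 + K') * |t| := by
      have := abs_sub_abs_le_abs_sub (C.jacobian (y, t) - 1) (-(meanCurvature Ω y * t))
      rw [sub_neg_eq_add, abs_neg] at this
      linarith
    have h6 : (1 + K') * |t| ≤ 1 / 2 := by
      rw [mul_comm]; exact (le_div_iff₀ (by positivity)).1 h2
    exact h5.trans h6

namespace Collar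

variable {C : Collar Ω δ}

theorem IsThin.jacobian_mem (hC : C.IsThin) {y : E n} (hy : y ∈ frontier Ω) {t : ℝ}
    (ht : |t| < δ) : C.jacobian (y, t) ∈ Icc (1 / 2) (3 / 2) := by
  have := abs_le.1 (hC.abs_jacobian_sub_one_le y hy t ht)
  constructor <;> linarith [this.1, this.2]

/-- From `fderiv_foot_add`, `‖Df v‖ ≤ 2‖v‖ + ‖Df v‖/2`, and the last term is absorbed. -/
theorem IsThin.norm_fderiv_foot_le (hΩ : IsC2Domain Ω) (hC : C.IsThin) {x : E n}
    (hx : x ∈ C.carrier) : ‖fderiv ℝ C.foot x‖ ≤ 4 := by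
  refine ContinuousLinearMap.opNorm_le_bound _ (by norm_num) fun v => ?_
  have hmem := (C.isFootpoint x hx).mem
  have h1 : fderiv ℝ C.foot x v =
      v - inner ℝ (inwardNormal Ω (C.foot x)) v • inwardNormal Ω (C.foot x) -
        C.depth x • C.normalDeriv (C.foot x) (fderiv ℝ C.foot x v) :=
    eq_sub_of_add_eq (fderiv_foot_add hΩ hx v)
  have h2 : ‖C.depth x • C.normalDeriv (C.foot x) (fderiv ℝ C.foot x v)‖ ≤
      1 / 2 * ‖fderiv ℝ C.foot x v‖ := by
    rw [norm_smul, Real.norm_eq_abs]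
    calc _ ≤ δ * (‖C.normalDeriv (C.foot x)‖ * ‖fderiv ℝ C.foot x v‖) :=
          mul_le_mul (C.abs_depth_lt x hx).le (ContinuousLinearMap.le_opNorm _ _)
            (norm_nonneg _) C.pos.le
      _ = δ * ‖C.normalDeriv (C.foot x)‖ * ‖fderiv ℝ C.foot x v‖ := by ring
      _ ≤ _ := mul_le_mul_of_nonneg_right (hC.mul_norm_le _ hmem) (norm_nonneg _)
  have h3 : ‖inner ℝ (inwardNormal Ω (C.foot x)) v • inwardNormal Ω (C.foot x)‖ ≤ ‖v‖ := by
    rw [norm_smul, hΩ.norm_inwardNormal hmem, mul_one]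
    simpa [hΩ.norm_inwardNormal hmem] using norm_inner_le_norm (𝕜 := ℝ) (inwardNormal Ω (C.foot x)) v
  have h4 := norm_sub_le (v - inner ℝ (inwardNormal Ω (C.foot x)) v • inwardNormal Ω (C.foot x))
    (C.depth x • C.normalDeriv (C.foot x) (fderiv ℝ C.foot x v))
  rw [← h1] at h4
  have h5 := norm_sub_le v (inner ℝ (inwardNormal Ω (C.foot x)) v • inwardNormal Ω (C.foot x))
  linarith

end Collar

variable {n : ℕ} {Ω : Set (E n)} {δ : ℝ}

/-! ### Integration in normal coordinates -/

theorem euclideanHausdorffMeasure_image_le {X Y : Type*} [MetricSpace X] [MetricSpace Y]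
    [MeasurableSpace X] [BorelSpace X] [MeasurableSpace Y] [BorelSpace Y] {K : NNReal} {f : X → Y}
    {s : Set X} (h : LipschitzOnWith K f s) (d : ℕ) :
    Measure.euclideanHausdorffMeasure d (f '' s) ≤
      (K : ℝ≥0∞) ^ d * Measure.euclideanHausdorffMeasure d s := by
  rw [Measure.euclideanHausdorffMeasure_def, Measure.euclideanHausdorffMeasure_def,
    Measure.smul_apply, Measure.smul_apply, ENNReal.smul_def, ENNReal.smul_def, smul_eq_mul,
    smul_eq_mul, mul_left_comm]
  gcongr
  simpa using h.hausdorffMeasure_image_le (d := d) (by positivity)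

theorem le_euclideanHausdorffMeasure_image {X Y : Type*} [MetricSpace X] [MetricSpace Y]
    [MeasurableSpace X] [BorelSpace X] [MeasurableSpace Y] [BorelSpace Y] [Nonempty X] {K : NNReal}
    {f : X → Y} {s : Set X} (h : ∀ x ∈ s, ∀ y ∈ s, dist x y ≤ K * dist (f x) (f y)) (d : ℕ) :
    Measure.euclideanHausdorffMeasure d s ≤
      (K : ℝ≥0∞) ^ d * Measure.euclideanHausdorffMeasure d (f '' s) := by
  have hinj : InjOn f s := fun x hx y hy hxy => by
    have := h x hx y hy
    rw [hxy, dist_self, mul_zero] at this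
    exact dist_le_zero.1 this
  have hl := hinj.leftInvOn_invFunOn
  have hL : LipschitzOnWith K (Function.invFunOn f s) (f '' s) := by
    refine LipschitzOnWith.of_dist_le_mul ?_
    rintro _ ⟨x, hx, rfl⟩ _ ⟨y, hy, rfl⟩
    rw [hl hx, hl hy]
    exact h x hx y hy
  have := euclideanHausdorffMeasure_image_le hL d
  rwa [hl.image_image] at this

/-- Near a boundary point the boundary is almost isometric to its tangent space. -/
theorem IsC2Domain.exists_inner_sub_le (hΩ : IsC2Domain Ω) {y : E n} (hy : y ∈ frontier Ω)
    {η : ℝ} (hη : 0 < η) : ∃ r > 0, ∀ z ∈ frontier Ω ∩ Metric.ball y r,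
      ∀ z' ∈ frontier Ω ∩ Metric.ball y r,
        |inner ℝ (inwardNormal Ω y) (z - z')| ≤ η * ‖z - z'‖ := by
  obtain ⟨φ, hφ⟩ := hΩ.boundary y hy
  have hG : 0 < ‖gradient φ y‖ := norm_pos_iff.2 hφ.gradient_ne_zero
  have hs := (hφ.contDiffAt.hasStrictFDerivAt (by norm_num)).isLittleO.def
    (c := η * ‖gradient φ y‖) (by positivity)
  have h0 : ∀ᶠ p in 𝓝 (y, y), (IsLocalDefiningFunction Ω p.1 φ) ∧
      IsLocalDefiningFunction Ω p.2 φ := by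
    rw [nhds_prod_eq]
    exact hφ.eventually.prod_mk hφ.eventually
  obtain ⟨r, hr, hball⟩ := Metric.eventually_nhds_iff.1 (hs.and h0)
  refine ⟨r, hr, fun z hz z' hz' => ?_⟩
  obtain ⟨h1, h2, h3⟩ := hball (y := (z, z')) (by
    rw [Prod.dist_eq]; exact max_lt hz.2 hz'.2)
  rw [h2.apply_eq_zero hΩ.isOpen hz.1, h3.apply_eq_zero hΩ.isOpen hz'.1, sub_zero, zero_sub,
    norm_neg, Real.norm_eq_abs, ← IsLocalDefiningFunction.inner_gradient] at h1
  rw [hΩ.inwardNormal_eq hy hφ, inner_neg_left, abs_neg, unitGradient, real_inner_smul_left,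
    abs_mul, abs_of_pos (inv_pos.2 hG), inv_mul_le_iff₀ hG]
  linarith

/-- The volume of a cylinder over a set of tangent directions. -/
theorem volume_cylinder {ν : E n} (hν : ‖ν‖ = 1) (hn : 1 ≤ n) (A : Set (ℝ ∙ ν)ᗮ) (B : Set ℝ) :
    volume {w : E n | (ℝ ∙ ν)ᗮ.orthogonalProjectionOnto w ∈ A ∧ inner ℝ ν w ∈ B} =
      Measure.euclideanHausdorffMeasure (n - 1) A * volume B := by
  have hν0 : ν ≠ 0 := by rintro rfl; simp at hν
  have hmp := (ℝ ∙ ν).measurePreserving_measurableEquivProd (0 : E n)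
  have hfin : Module.finrank ℝ (E n) = n := by simp
  have h1 : Module.finrank ℝ (ℝ ∙ ν) = 1 := finrank_span_singleton hν0
  have h2 : Module.finrank ℝ (ℝ ∙ ν)ᗮ = n - 1 := by
    have := (ℝ ∙ ν).finrank_add_finrank_orthogonal
    omega
  rw [InnerProductSpace.euclideanHausdorffMeasure_eq_volume] at hmp
  let ι : ℝ → (ℝ ∙ ν) := fun t => ⟨t • ν, Submodule.smul_mem _ _ (Submodule.mem_span_singleton_self ν)⟩
  have hι : Isometry ι := Isometry.of_dist_eq fun s t => by
    rw [Subtype.dist_eq, dist_eq_norm, ← sub_smul, norm_smul, hν, mul_one, Real.dist_eq,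
      Real.norm_eq_abs]
  have hset : {w : E n | (ℝ ∙ ν)ᗮ.orthogonalProjectionOnto w ∈ A ∧ inner ℝ ν w ∈ B} =
      (ℝ ∙ ν).measurableEquivProd (0 : E n) ⁻¹' ((ι '' B) ×ˢ A) := by
    ext w
    have hp : (ℝ ∙ ν).orthogonalProjectionOnto w = ι (inner ℝ ν w) := by
      ext1
      exact Submodule.starProjection_unit_singleton ℝ hν w
    have hinj : ι (inner ℝ ν w) ∈ ι '' B ↔ inner ℝ ν w ∈ B := hι.injective.mem_set_image
    simp only [mem_ofPred_eq, mem_preimage, Submodule.measurableEquivProd_apply, vsub_eq_sub,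
      sub_zero, mem_prod, hp, hinj]
    exact and_comm
  rw [hset, hmp.measure_preimage_equiv, Measure.volume_eq_prod, Measure.prod_prod, mul_comm]
  congr 1
  · rw [← InnerProductSpace.euclideanHausdorffMeasure_eq_volume, h2]
  · rw [← InnerProductSpace.euclideanHausdorffMeasure_eq_volume, h1,
      hι.euclideanHausdorffMeasure_image, ← InnerProductSpace.euclideanHausdorffMeasure_eq_volume]
    simp

theorem det_mul (A B : E n →L[ℝ] E n) : (A * B).det = A.det * B.det :=
  map_mul LinearMap.det (A : E n →ₗ[ℝ] E n) (B : E n →ₗ[ℝ] E n)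

theorem coe_orthogonalProjectionOnto {ν : E n} (hν : ‖ν‖ = 1) (w : E n) :
    ((ℝ ∙ ν)ᗮ.orthogonalProjectionOnto w : E n) = w - inner ℝ ν w • ν := by
  have h1 := Submodule.starProjection_unit_singleton ℝ hν w
  have h2 := (ℝ ∙ ν).starProjection_add_starProjection_orthogonal w
  rw [h1] at h2
  exact eq_sub_of_add_eq' h2

/-! ### Comparison of the collar with straight cylinders -/

namespace Collar

variable (C : Collar Ω δ)

/-- The inner half of the collar. -/
def inside : Set (E n) := {x ∈ C.carrier | 0 < C.depth x}

/-- Lebesgue measure on the inner half of the collar, divided by the Jacobian. -/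
def flatMeasure : Measure (E n) :=
  (volume.restrict C.inside).withDensity
    fun x => ENNReal.ofReal |C.jacobian (C.foot x, C.depth x)|⁻¹

theorem measurableSet_inside : MeasurableSet C.inside :=
  C.isOpen.measurableSet.inter (C.measurable_depth measurableSet_Ioi)

variable {C}

theorem jacobian_mul_det (hΩ : IsC2Domain Ω) {x : E n} (hx : x ∈ C.carrier) :
    C.jacobian (C.foot x, C.depth x) * (fderiv ℝ C.foot x +
      (innerSL ℝ (inwardNormal Ω (C.foot x))).smulRight (inwardNormal Ω (C.foot x))).det = 1 := by
  rw [jacobian, ← det_mul, one_add_smul_comp hΩ hx]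
  exact map_one LinearMap.det

/-- The Jacobian of the projection of a hypersurface with normal `μ` to the hyperplane with normal
`ν`. -/
def tiltDet (ν μ : E n) : ℝ :=
  ((1 - (innerSL ℝ ν).smulRight ν) * (1 - (innerSL ℝ μ).smulRight μ) +
    (innerSL ℝ μ).smulRight ν).det

theorem tiltDet_self {ν : E n} (hν : ‖ν‖ = 1) : tiltDet ν ν = 1 := by
  have : ((1 - (innerSL ℝ ν).smulRight ν) * (1 - (innerSL ℝ ν).smulRight ν) +
    (innerSL ℝ ν).smulRight ν : E n →L[ℝ] E n) = 1 := by
    ext1 v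
    simp [inner_sub_right, inner_smul_right, hν]
  rw [tiltDet, this]
  exact map_one LinearMap.det

theorem continuous_tiltDet (ν : E n) : Continuous (tiltDet ν) := by
  refine ContinuousLinearMap.continuous_det.comp ?_
  have h1 : Continuous fun μ : E n => (innerSL ℝ μ : E n →L[ℝ] ℝ) := (innerSL ℝ).continuous
  have h2 : Continuous fun μ : E n => (innerSL ℝ μ).smulRight μ :=
    ((ContinuousLinearMap.smulRightL ℝ (E n) (E n)).continuous.comp h1).clm_apply continuous_id
  have h3 : Continuous fun μ : E n => (innerSL ℝ μ).smulRight ν :=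
    ((ContinuousLinearMap.smulRightL ℝ (E n) (E n)).continuous.comp h1).clm_apply continuous_const
  exact (continuous_const.mul (continuous_const.sub h2)).add h3

/-- Projection of the collar along a fixed direction `ν`: the Jacobian. -/
theorem hasFDerivAt_flatten (hΩ : IsC2Domain Ω) (ν : E n) {x : E n} (hx : x ∈ C.carrier) :
    ∃ D : E n →L[ℝ] E n,
      HasFDerivAt (fun x => C.foot x - inner ℝ ν (C.foot x) • ν + C.depth x • ν) D x ∧
      D.det = tiltDet ν (inwardNormal Ω (C.foot x)) *
        (C.jacobian (C.foot x, C.depth x))⁻¹ := by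
  set P : E n →L[ℝ] E n := 1 - (innerSL ℝ ν).smulRight ν with hP
  have h1 : HasFDerivAt (fun x => P (C.foot x) + C.depth x • ν)
      (P.comp (fderiv ℝ C.foot x) + (fderiv ℝ C.depth x).smulRight ν) x :=
    (P.hasFDerivAt.comp x (C.hasFDerivAt_foot hx)).add
      ((C.hasFDerivAt_depth hx).smul_const ν)
  refine ⟨_, h1, ?_⟩
  set μ := inwardNormal Ω (C.foot x)
  have hμ : ‖μ‖ = 1 := hΩ.norm_inwardNormal (C.isFootpoint x hx).mem
  -- The factorization holds because the derivative of the foot is orthogonal to `μ`. The first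
  -- factor carries the tilt between the hyperplanes, and the second has determinant `1/J`.
  have hcomp : P.comp (fderiv ℝ C.foot x) + (fderiv ℝ C.depth x).smulRight ν =
      (P * (1 - (innerSL ℝ μ).smulRight μ) + (innerSL ℝ μ).smulRight ν) *
        (fderiv ℝ C.foot x + (innerSL ℝ μ).smulRight μ) := by
    ext1 v
    have := (C.isFootpoint x hx).inner_eq_zero v
    have h2 : fderiv ℝ C.depth x v = inner ℝ μ v := fderiv_depth hΩ hx v
    simp only [add_apply, ContinuousLinearMap.comp_apply, ContinuousLinearMap.smulRight_apply,
      mul_apply_eq_comp, h2, innerSL_apply_apply, sub_apply, one_apply_eq_self, inner_add_right,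
      inner_smul_right, real_inner_self_eq_norm_sq, hμ]
    have h3 : inner ℝ μ (fderiv ℝ C.foot x v) = 0 := this
    rw [h3]
    simp
  rw [hcomp, det_mul, eq_inv_of_mul_eq_one_right (jacobian_mul_det hΩ hx)]
  rfl

/-- The map `foot + depth ↦ Pr(foot) + depth • ν` carries the curved cylinder over `A` bijectively
onto a straight one over the projection of `A`. This is the change of variables formula for it.
Apart from the tilt, the weight is the density of `flatMeasure`. -/
theorem measure_flatten (hΩ : IsC2Domain Ω) (hn : 1 ≤ n) {ν : E n} (hν : ‖ν‖ = 1) {A : Set (E n)}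
    (hA : A ⊆ frontier Ω) (hAm : MeasurableSet A) {B : Set ℝ} (hB : B ⊆ Ioo 0 δ)
    (hBm : MeasurableSet B) (hinj : InjOn (ℝ ∙ ν)ᗮ.orthogonalProjectionOnto A) :
    ∫⁻ x in C.inside ∩ (C.foot ⁻¹' A ∩ C.depth ⁻¹' B),
      ENNReal.ofReal |tiltDet ν (inwardNormal Ω (C.foot x)) *
        (C.jacobian (C.foot x, C.depth x))⁻¹| =
      Measure.euclideanHausdorffMeasure (n - 1) ((ℝ ∙ ν)ᗮ.orthogonalProjectionOnto '' A) *
        volume B := by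
  set X := C.inside ∩ (C.foot ⁻¹' A ∩ C.depth ⁻¹' B)
  set K : E n → E n := fun x => C.foot x - inner ℝ ν (C.foot x) • ν + C.depth x • ν with hK
  have hXm : MeasurableSet X := C.measurableSet_inside.inter
    ((C.measurable_foot hAm).inter (C.measurable_depth hBm))
  have hpK : ∀ x, (ℝ ∙ ν)ᗮ.orthogonalProjectionOnto (K x) =
      (ℝ ∙ ν)ᗮ.orthogonalProjectionOnto (C.foot x) := by
    intro x
    ext1
    rw [coe_orthogonalProjectionOnto hν, coe_orthogonalProjectionOnto hν]
    simp [hK, inner_sub_right, inner_add_right, inner_smul_right, hν]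
  have hiK : ∀ x, inner ℝ ν (K x) = C.depth x := by
    intro x
    simp [hK, inner_sub_right, inner_add_right, inner_smul_right, hν]
  choose! D hD hdet using fun x (hx : x ∈ C.carrier) => hasFDerivAt_flatten hΩ ν hx
  have hKinj : InjOn K X := by
    intro x hx x' hx' h
    have h1 : C.depth x = C.depth x' := by rw [← hiK, h, hiK]
    have h2 : C.foot x = C.foot x' := hinj hx.2.1 hx'.2.1 (by rw [← hpK, h, hpK])
    rw [← (C.isFootpoint x hx.1.1).add_eq, ← (C.isFootpoint x' hx'.1.1).add_eq, h1, h2]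
  have himg : K '' X = {w : E n | (ℝ ∙ ν)ᗮ.orthogonalProjectionOnto w ∈
      (ℝ ∙ ν)ᗮ.orthogonalProjectionOnto '' A ∧ inner ℝ ν w ∈ B} := by
    ext w
    constructor
    · rintro ⟨x, hx, rfl⟩
      refine ⟨?_, ?_⟩
      · rw [hpK]; exact mem_image_of_mem _ hx.2.1
      · rw [hiK]; exact hx.2.2
    · rintro ⟨⟨z, hz, hzw⟩, hw⟩
      have ht : |inner ℝ ν w| < δ := by rw [abs_of_pos (hB hw).1]; exact (hB hw).2
      have h1 := C.add_mem z (hA hz) _ ht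
      have h2 := C.foot_add z (hA hz) _ ht
      have h3 := C.depth_add z (hA hz) _ ht
      refine ⟨z + inner ℝ ν w • inwardNormal Ω z, ⟨⟨h1, by rw [h3]; exact (hB hw).1⟩,
        by rw [mem_preimage, h2]; exact hz, by rw [mem_preimage, h3]; exact hw⟩, ?_⟩
      have h4 := congrArg (Subtype.val) hzw
      rw [coe_orthogonalProjectionOnto hν, coe_orthogonalProjectionOnto hν] at h4
      simp only [hK, h2, h3, h4, sub_add_cancel]
  rw [← volume_cylinder hν hn, ← himg, ← lintegral_abs_det_fderiv_eq_addHaar_image volume hXm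
    (fun x hx => (hD x hx.1.1).hasFDerivWithinAt) hKinj]
  exact setLIntegral_congr_fun hXm fun x hx => by simp only [hdet x hx.1.1]

theorem flatMeasure_apply {S : Set (E n)} (hS : MeasurableSet S) :
    C.flatMeasure S = ∫⁻ x in C.inside ∩ S,
      ENNReal.ofReal |C.jacobian (C.foot x, C.depth x)|⁻¹ := by
  rw [flatMeasure, withDensity_apply _ hS, Measure.restrict_restrict hS, inter_comm]

/-- Near `y` the tilt lies in `(1/k, k)` and the projection to the tangent space shortens distances
by at most the factor `k`. The Hausdorff measure contributes `k^(n-1)` and the tilt `k`, hence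
`k^n`. -/
theorem exists_local_comparison (hΩ : IsC2Domain Ω) (hn : 1 ≤ n) {y : E n} (hy : y ∈ frontier Ω)
    {k : NNReal} (hk : 1 < k) : ∃ U : Set (E n), IsOpen U ∧ y ∈ U ∧ ∀ A ⊆ frontier Ω ∩ U,
      MeasurableSet A → ∀ B ⊆ Ioo 0 δ, MeasurableSet B →
        C.flatMeasure (C.foot ⁻¹' A ∩ C.depth ⁻¹' B) ≤
          k ^ n * (Measure.euclideanHausdorffMeasure (n - 1) A * volume B) ∧
        Measure.euclideanHausdorffMeasure (n - 1) A * volume B ≤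
          k ^ n * C.flatMeasure (C.foot ⁻¹' A ∩ C.depth ⁻¹' B) := by
  have hk0 : (0 : ℝ) < k := by positivity
  have hk1 : (1 : ℝ) < k := by exact_mod_cast hk
  set ν := inwardNormal Ω y
  have hν : ‖ν‖ = 1 := hΩ.norm_inwardNormal hy
  -- With `η = 1 - 1/k`, removing the normal component leaves at least `‖z - z'‖/k`.
  obtain ⟨r, hr, hflat⟩ := hΩ.exists_inner_sub_le hy (η := 1 - (k : ℝ)⁻¹)
    (sub_pos.2 (inv_lt_one_of_one_lt₀ hk1))
  have hyC := C.frontier_subset hy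
  have hcont : ContinuousAt (fun z => |tiltDet ν (inwardNormal Ω (C.foot z))|) y :=
    ((continuous_tiltDet ν).continuousAt.comp
      (C.hasFDerivAt_normal hyC).continuousAt).abs
  have hval : |tiltDet ν (inwardNormal Ω (C.foot y))| = 1 := by
    rw [C.foot_of_mem hy, tiltDet_self hν, abs_one]
  have hnear : ∀ᶠ z in 𝓝 y, |tiltDet ν (inwardNormal Ω (C.foot z))| ∈ Ioo (k : ℝ)⁻¹ k := by
    refine hcont.eventually (Ioo_mem_nhds ?_ ?_) <;> simp only [hval]
    exacts [inv_lt_one_of_one_lt₀ hk1, hk1]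
  obtain ⟨U, hUsub, hUo, hyU⟩ := eventually_nhds_iff.1 (hnear.and (Metric.ball_mem_nhds y hr))
  refine ⟨U, hUo, hyU, fun A hA hAm B hB hBm => ?_⟩
  have hAf : A ⊆ frontier Ω := fun z hz => (hA hz).1
  set pr := (ℝ ∙ ν)ᗮ.orthogonalProjectionOnto
  have hanti : ∀ z ∈ A, ∀ z' ∈ A, dist z z' ≤ k * dist (pr z) (pr z') := by
    intro z hz z' hz'
    have h1 := hflat z ⟨(hA hz).1, (hUsub _ (hA hz).2).2⟩ z' ⟨(hA hz').1, (hUsub _ (hA hz').2).2⟩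
    have h2 : dist (pr z) (pr z') = ‖(z - z') - inner ℝ ν (z - z') • ν‖ := by
      rw [dist_eq_norm, ← map_sub, ← coe_orthogonalProjectionOnto hν]
      rfl
    have h3 := norm_sub_norm_le (z - z') (inner ℝ ν (z - z') • ν)
    rw [norm_smul, hν, mul_one, Real.norm_eq_abs] at h3
    rw [h2, dist_eq_norm, ← div_le_iff₀' hk0, div_eq_inv_mul]
    linarith
  have hinj : InjOn pr A := fun z hz z' hz' h => by
    have := hanti z hz z' hz'
    rw [h, dist_self, mul_zero] at this
    exact dist_le_zero.1 this
  have hle1 : Measure.euclideanHausdorffMeasure (n - 1) (pr '' A) ≤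
      Measure.euclideanHausdorffMeasure (n - 1) A := by
    have := euclideanHausdorffMeasure_image_le
      ((ℝ ∙ ν)ᗮ.lipschitzWith_orthogonalProjectionOnto.lipschitzOnWith (s := A)) (n - 1)
    simpa using this
  have hle2 := le_euclideanHausdorffMeasure_image (f := pr) hanti (n - 1)
  have hm := measure_flatten (C := C) hΩ hn hν hAf hAm hB hBm hinj
  set X := C.inside ∩ (C.foot ⁻¹' A ∩ C.depth ⁻¹' B)
  have hXm : MeasurableSet X := C.measurableSet_inside.inter
    ((C.measurable_foot hAm).inter (C.measurable_depth hBm))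
  have hfl := flatMeasure_apply (C := C) ((C.measurable_foot hAm).inter (C.measurable_depth hBm))
  have htilt : ∀ x ∈ X, |tiltDet ν (inwardNormal Ω (C.foot x))| ∈ Ioo (k : ℝ)⁻¹ k := by
    intro x hx
    have := (hUsub _ (hA hx.2.1).2).1
    rwa [C.foot_of_mem (hAf hx.2.1)] at this
  have hb1 : C.flatMeasure (C.foot ⁻¹' A ∩ C.depth ⁻¹' B) ≤
      k * (Measure.euclideanHausdorffMeasure (n - 1) (pr '' A) * volume B) := by
    rw [hfl, ← hm, ← lintegral_const_mul' _ _ ENNReal.coe_ne_top]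
    refine setLIntegral_mono' hXm fun x hx => ?_
    rw [← ENNReal.ofReal_coe_nnreal, ← ENNReal.ofReal_mul hk0.le]
    refine ENNReal.ofReal_le_ofReal ?_
    rw [abs_mul, abs_inv, ← mul_assoc]
    refine le_mul_of_one_le_left (inv_nonneg.2 (abs_nonneg _)) ?_
    have := (htilt x hx).1.le
    rwa [inv_le_iff_one_le_mul₀' hk0] at this
  have hb2 : Measure.euclideanHausdorffMeasure (n - 1) (pr '' A) * volume B ≤
      k * C.flatMeasure (C.foot ⁻¹' A ∩ C.depth ⁻¹' B) := by
    rw [hfl, ← hm, ← lintegral_const_mul' _ _ ENNReal.coe_ne_top]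
    refine setLIntegral_mono' hXm fun x hx => ?_
    rw [← ENNReal.ofReal_coe_nnreal, ← ENNReal.ofReal_mul hk0.le]
    refine ENNReal.ofReal_le_ofReal ?_
    rw [abs_mul, abs_inv]
    exact mul_le_mul_of_nonneg_right (htilt x hx).2.le (inv_nonneg.2 (abs_nonneg _))
  have hkE : (1 : ℝ≥0∞) ≤ k := by exact_mod_cast hk.le
  have hpow : (k : ℝ≥0∞) ^ (n - 1) * k = k ^ n := by
    rw [← pow_succ, Nat.sub_add_cancel hn]
  constructor
  · refine hb1.trans ?_
    have : (k : ℝ≥0∞) ≤ k ^ n := by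
      rw [← hpow]; exact le_mul_of_one_le_left' (one_le_pow₀ hkE)
    gcongr
  · calc _ ≤ (k : ℝ≥0∞) ^ (n - 1) * Measure.euclideanHausdorffMeasure (n - 1) (pr '' A) *
          volume B := by gcongr
      _ ≤ (k : ℝ≥0∞) ^ (n - 1) * (k * C.flatMeasure (C.foot ⁻¹' A ∩ C.depth ⁻¹' B)) := by
          rw [mul_assoc]; gcongr
      _ = _ := by rw [← mul_assoc, hpow]

end Collar

variable {n : ℕ} {Ω : Set (E n)} {δ : ℝ}

theorem le_of_forall_one_lt_pow_mul {a b : ℝ≥0∞} (m : ℕ)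
    (h : ∀ k : NNReal, 1 < k → a ≤ k ^ m * b) : a ≤ b := by
  have h1 : Tendsto (fun k : NNReal => ((k ^ m : NNReal) : ℝ≥0∞)) (𝓝[>] 1) (𝓝 ((1 : NNReal) ^ m : NNReal)) :=
    ENNReal.tendsto_coe.2 (((continuous_pow m).tendsto _).mono_left nhdsWithin_le_nhds)
  have h2 := ENNReal.Tendsto.mul_const h1 (b := b) (Or.inl (by simp))
  have hne : (𝓝[>] (1 : NNReal)).NeBot := nhdsGT_neBot_of_exists_gt ⟨2, by norm_num⟩
  have h3 := ge_of_tendsto h2 (b := a) (by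
    filter_upwards [self_mem_nhdsWithin] with k hk
    simpa using h k hk)
  simpa using h3

/-- Two measures comparable near each point of a compact set are comparable on the set. -/
theorem measure_le_of_locally {X : Type*} [TopologicalSpace X] [MeasurableSpace X] [BorelSpace X]
    {μ₁ μ₂ : Measure X} {K : Set X} (hK : IsCompact K) {c : ℝ≥0∞}
    (h : ∀ y ∈ K, ∃ U, IsOpen U ∧ y ∈ U ∧ ∀ A ⊆ K ∩ U, MeasurableSet A → μ₁ A ≤ c * μ₂ A)
    {A : Set X} (hA : A ⊆ K) (hAm : MeasurableSet A) : μ₁ A ≤ c * μ₂ A := by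
  have key : ∃ U, MeasurableSet U ∧ K ⊆ U ∧
      ∀ A ⊆ K ∩ U, MeasurableSet A → μ₁ A ≤ c * μ₂ A := by
    refine hK.induction_on (p := fun s => ∃ U, MeasurableSet U ∧ s ⊆ U ∧
      ∀ A ⊆ K ∩ U, MeasurableSet A → μ₁ A ≤ c * μ₂ A) ?_ ?_ ?_ ?_
    · refine ⟨∅, MeasurableSet.empty, Subset.rfl, fun A hA _ => ?_⟩
      rw [inter_empty, subset_empty_iff] at hA
      simp [hA]
    · rintro s t hst ⟨U, hU, htU, h⟩
      exact ⟨U, hU, hst.trans htU, h⟩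
    · rintro s t ⟨U, hU, hsU, h⟩ ⟨V, hV, htV, h'⟩
      refine ⟨U ∪ V, hU.union hV, union_subset_union hsU htV, fun A hA hAm => ?_⟩
      rw [← measure_inter_add_sdiff A hU, ← measure_inter_add_sdiff (μ := μ₂) A hU, mul_add]
      refine add_le_add (h _ (fun z hz => ⟨(hA hz.1).1, hz.2⟩) (hAm.inter hU))
        (h' _ (fun z hz => ⟨(hA hz.1).1, ?_⟩) (hAm.diff hU))
      exact (hA hz.1).2.resolve_left hz.2
    · intro y hy
      obtain ⟨U, hU, hyU, h⟩ := h y hy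
      exact ⟨U, mem_nhdsWithin_of_mem_nhds (hU.mem_nhds hyU), U, hU.measurableSet, Subset.rfl, h⟩
  obtain ⟨U, -, hKU, h⟩ := key
  exact h A (fun z hz => ⟨hA hz, hKU (hA hz)⟩) hAm

namespace Collar

variable {C : Collar Ω δ}

/-- Both sides are measures in `A`. The local comparisons patch over disjoint pieces without loss in
the factor `k^n`, so that letting `k → 1` gives equality. -/
theorem flatMeasure_rectangle_frontier (hΩ : IsC2Domain Ω) (hn : 1 ≤ n) {A : Set (E n)}
    (hA : A ⊆ frontier Ω) (hAm : MeasurableSet A) {B : Set ℝ} (hB : B ⊆ Ioo 0 δ)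
    (hBm : MeasurableSet B) : C.flatMeasure (C.foot ⁻¹' A ∩ C.depth ⁻¹' B) =
      Measure.euclideanHausdorffMeasure (n - 1) A * volume B := by
  set μ₁ : Measure (E n) := (C.flatMeasure.restrict (C.depth ⁻¹' B)).map C.foot
  set μ₂ : Measure (E n) := volume B • Measure.euclideanHausdorffMeasure (n - 1)
  have hBB := C.measurable_depth hBm
  have e1 : ∀ A, MeasurableSet A → μ₁ A = C.flatMeasure (C.foot ⁻¹' A ∩ C.depth ⁻¹' B) := by
    intro A hA
    rw [Measure.map_apply C.measurable_foot hA, Measure.restrict_apply (C.measurable_foot hA)]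
  have e2 : ∀ A, μ₂ A = Measure.euclideanHausdorffMeasure (n - 1) A * volume B := by
    intro A
    rw [Measure.smul_apply, smul_eq_mul, mul_comm]
  have h : ∀ k : NNReal, 1 < k → ∀ y ∈ frontier Ω, ∃ U, IsOpen U ∧ y ∈ U ∧ ∀ A ⊆ frontier Ω ∩ U,
      MeasurableSet A → μ₁ A ≤ k ^ n * μ₂ A ∧ μ₂ A ≤ k ^ n * μ₁ A := by
    intro k hk y hy
    obtain ⟨U, hU, hyU, h⟩ := exists_local_comparison (C := C) hΩ hn hy hk
    refine ⟨U, hU, hyU, fun A hA hAm => ?_⟩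
    rw [e1 A hAm, e2]
    exact h A hA hAm B hB hBm
  rw [← e1 A hAm, ← e2]
  refine le_antisymm (le_of_forall_one_lt_pow_mul n fun k hk => ?_)
    (le_of_forall_one_lt_pow_mul n fun k hk => ?_)
  · exact measure_le_of_locally hΩ.isCompact_frontier (fun y hy =>
      let ⟨U, h1, h2, h3⟩ := h k hk y hy
      ⟨U, h1, h2, fun A hA hAm => (h3 A hA hAm).1⟩) hA hAm
  · exact measure_le_of_locally hΩ.isCompact_frontier (fun y hy =>
      let ⟨U, h1, h2, h3⟩ := h k hk y hy
      ⟨U, h1, h2, fun A hA hAm => (h3 A hA hAm).2⟩) hA hAm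

theorem flatMeasure_rectangle (hΩ : IsC2Domain Ω) (hn : 1 ≤ n) {A : Set (E n)}
    (hAm : MeasurableSet A) {B : Set ℝ} (hBm : MeasurableSet B) :
    C.flatMeasure (C.foot ⁻¹' A ∩ C.depth ⁻¹' B) =
      surfaceMeasure Ω A * volume.restrict (Ioo 0 δ) B := by
  have hfm : MeasurableSet (frontier Ω) := isClosed_frontier.measurableSet
  rw [surfaceMeasure, Measure.restrict_apply hAm, Measure.restrict_apply hBm,
    ← flatMeasure_rectangle_frontier (C := C) hΩ hn inter_subset_right (hAm.inter hfm)
      inter_subset_right (hBm.inter measurableSet_Ioo),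
    flatMeasure_apply ((C.measurable_foot hAm).inter (C.measurable_depth hBm)),
    flatMeasure_apply ((C.measurable_foot (hAm.inter hfm)).inter
      (C.measurable_depth (hBm.inter measurableSet_Ioo)))]
  congr 2
  ext x
  refine and_congr_right fun hx => ?_
  have h1 := (C.isFootpoint x hx.1).mem
  have h2 := C.abs_depth_lt x hx.1
  rw [abs_of_pos hx.2] at h2
  simp [h1, h2, hx.2]

theorem IsThin.jacobian_pos (hC : C.IsThin) {x : E n} (hx : x ∈ C.carrier) :
    C.jacobian (C.foot x, C.depth x) ∈ Icc (1 / 2) (3 / 2) :=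
  hC.jacobian_mem (C.isFootpoint x hx).mem (C.abs_depth_lt x hx)

theorem inside_subset : C.inside ⊆ Ω := fun x hx => (C.isFootpoint x hx.1).mem_iff.2 hx.2

theorem inside_eq : C.inside = C.carrier ∩ Ω := by
  ext x
  exact and_congr_right fun hx => (C.isFootpoint x hx).mem_iff.symm

theorem isOpen_inside (hΩ : IsC2Domain Ω) : IsOpen C.inside :=
  C.inside_eq ▸ C.isOpen.inter hΩ.isOpen

end Collar

theorem IsC2Domain.volume_lt_top (hΩ : IsC2Domain Ω) : volume Ω < ⊤ := hΩ.isBounded.measure_lt_top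

namespace Collar
variable {C : Collar Ω δ}

/-- The area is controlled by the volume: `δ ℋ^{n-1}(∂Ω)` is the flat measure of the inner collar,
at most `2|Ω|` since `J ≥ 1/2`. -/
theorem IsThin.isFiniteMeasure (hΩ : IsC2Domain Ω) (hn : 1 ≤ n) (hC : C.IsThin) :
    IsFiniteMeasure (surfaceMeasure Ω) := by
  have h1 := flatMeasure_rectangle (C := C) hΩ hn MeasurableSet.univ MeasurableSet.univ
  have h2 : C.flatMeasure (C.foot ⁻¹' univ ∩ C.depth ⁻¹' univ) < ⊤ := by
    rw [flatMeasure_apply (by simp)]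
    calc _ ≤ ∫⁻ x in C.inside ∩ (C.foot ⁻¹' univ ∩ C.depth ⁻¹' univ), ENNReal.ofReal 2 := by
          refine setLIntegral_mono' (C.measurableSet_inside.inter (by simp)) fun x hx => ?_
          refine ENNReal.ofReal_le_ofReal ?_
          have h3 := (hC.jacobian_pos hx.1.1).1
          rw [abs_of_pos (by linarith)]
          exact inv_le_of_inv_le₀ (by norm_num) (by linarith)
      _ < ⊤ := by
          rw [lintegral_const]
          refine ENNReal.mul_lt_top ENNReal.ofReal_lt_top ?_
          rw [Measure.restrict_apply_univ]
          exact (measure_mono (inter_subset_left.trans C.inside_subset)).trans_lt hΩ.volume_lt_top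
  rw [h1, Measure.restrict_apply_univ, Real.volume_Ioo, sub_zero] at h2
  exact ⟨(ENNReal.mul_lt_top_iff.1 h2).elim (fun h => h.1) (fun h => h.elim (fun h => by simp [h])
    (fun h => absurd h (ENNReal.ofReal_pos.2 C.pos).ne'))⟩

theorem map_flatMeasure (hΩ : IsC2Domain Ω) (hn : 1 ≤ n) (hC : C.IsThin) :
    C.flatMeasure.map (fun x => (C.foot x, C.depth x)) =
      (surfaceMeasure Ω).prod (volume.restrict (Ioo 0 δ)) := by
  have := hC.isFiniteMeasure hΩ hn
  refine (Measure.prod_eq fun A B hA hB => ?_).symm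
  rw [Measure.map_apply (C.measurable_foot.prodMk C.measurable_depth) (hA.prod hB),
    ← flatMeasure_rectangle hΩ hn hA hB]
  rfl

theorem lintegral_inside_of_measurable (hΩ : IsC2Domain Ω) (hn : 1 ≤ n) (hC : C.IsThin)
    {h : E n × ℝ → ℝ≥0∞} (hm : Measurable h) :
    ∫⁻ x in C.inside, h (C.foot x, C.depth x) =
      ∫⁻ p, h p * ENNReal.ofReal (C.jacobian p)
        ∂(surfaceMeasure Ω).prod (volume.restrict (Ioo 0 δ)) := by
  have hΛ : Measurable fun x => (C.foot x, C.depth x) :=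
    C.measurable_foot.prodMk C.measurable_depth
  have hJ := C.measurable_jacobian
  have hhJ : Measurable fun p => h p * ENNReal.ofReal (C.jacobian p) := hm.mul hJ.ennreal_ofReal
  have hJm : Measurable fun x => ENNReal.ofReal |C.jacobian (C.foot x, C.depth x)|⁻¹ :=
    (continuous_abs.measurable.comp (hJ.comp hΛ)).inv.ennreal_ofReal
  have hcm : Measurable fun x => h (C.foot x, C.depth x) *
      ENNReal.ofReal (C.jacobian (C.foot x, C.depth x)) := hhJ.comp hΛ
  rw [← map_flatMeasure hΩ hn hC, lintegral_map hhJ hΛ, flatMeasure,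
    lintegral_withDensity_eq_lintegral_mul _ hJm hcm]
  refine setLIntegral_congr_fun C.measurableSet_inside fun x hx => ?_
  have hpos : 0 < C.jacobian (C.foot x, C.depth x) := by
    linarith [(hC.jacobian_pos hx.1).1]
  simp only [Pi.mul_apply]
  rw [mul_left_comm, abs_of_pos hpos, ← ENNReal.ofReal_mul (inv_nonneg.2 hpos.le),
    inv_mul_cancel₀ hpos.ne', ENNReal.ofReal_one, mul_one]

/-- Functions on the boundary are given only up to null sets; this makes their composition with the
foot meaningful almost everywhere. -/
theorem quasiMeasurePreserving (hΩ : IsC2Domain Ω) (hn : 1 ≤ n) (hC : C.IsThin) :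
    Measure.QuasiMeasurePreserving (fun x => (C.foot x, C.depth x)) (volume.restrict C.inside)
      ((surfaceMeasure Ω).prod (volume.restrict (Ioo 0 δ))) := by
  refine ⟨C.measurable_foot.prodMk C.measurable_depth, Measure.AbsolutelyContinuous.mk
    fun s hs h0 => ?_⟩
  rw [← lintegral_indicator_one hs, lintegral_map (measurable_one.indicator hs)
    (C.measurable_foot.prodMk C.measurable_depth), lintegral_inside_of_measurable hΩ hn hC
    (measurable_one.indicator hs)]
  refine (lintegral_congr_ae ?_).trans lintegral_zero
  filter_upwards [measure_eq_zero_iff_ae_notMem.1 h0] with p hp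
  simp [hp]

theorem quasiMeasurePreserving_foot (hΩ : IsC2Domain Ω) (hn : 1 ≤ n) (hC : C.IsThin) :
    Measure.QuasiMeasurePreserving C.foot (volume.restrict C.inside) (surfaceMeasure Ω) :=
  have := hC.isFiniteMeasure hΩ hn
  Measure.quasiMeasurePreserving_fst.comp (quasiMeasurePreserving hΩ hn hC)

/-- Integration in normal coordinates. -/
theorem lintegral_inside (hΩ : IsC2Domain Ω) (hn : 1 ≤ n) (hC : C.IsThin) {h : E n × ℝ → ℝ≥0∞}
    (hm : AEMeasurable h ((surfaceMeasure Ω).prod (volume.restrict (Ioo 0 δ)))) :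
    ∫⁻ x in C.inside, h (C.foot x, C.depth x) =
      ∫⁻ y, (∫⁻ t in Ioo 0 δ, h (y, t) * ENNReal.ofReal (C.jacobian (y, t))) ∂surfaceMeasure Ω := by
  have := hC.isFiniteMeasure hΩ hn
  have h1 : (fun x => h (C.foot x, C.depth x)) =ᵐ[volume.restrict C.inside]
      fun x => hm.mk h (C.foot x, C.depth x) :=
    (quasiMeasurePreserving hΩ hn hC).ae_eq_comp hm.ae_eq_mk
  have hJ := C.measurable_jacobian
  rw [lintegral_congr_ae h1, lintegral_inside_of_measurable hΩ hn hC hm.measurable_mk,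
    ← lintegral_prod (fun p => h p * ENNReal.ofReal (C.jacobian p))
      (hm.mul hJ.ennreal_ofReal.aemeasurable)]
  refine lintegral_congr_ae ?_
  filter_upwards [hm.ae_eq_mk] with p hp
  rw [hp]

/-- For functions of the foot alone the Jacobian is bounded by `2`. With `B` the layer of width
`εT`, the volume factor supplies the `ε` in front of the tangential energy. -/
theorem lintegral_inside_le (hΩ : IsC2Domain Ω) (hn : 1 ≤ n) (hC : C.IsThin) {h : E n → ℝ≥0∞}
    (hm : AEMeasurable h (surfaceMeasure Ω)) {B : Set ℝ} (hB : MeasurableSet B) :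
    ∫⁻ x in C.inside ∩ C.depth ⁻¹' B, h (C.foot x) ≤
      2 * volume (B ∩ Ioo 0 δ) * ∫⁻ y, h y ∂surfaceMeasure Ω := by
  have := hC.isFiniteMeasure hΩ hn
  have hfst : AEMeasurable (fun p : E n × ℝ => h p.1)
      ((surfaceMeasure Ω).prod (volume.restrict (Ioo 0 δ))) :=
    hm.comp_quasiMeasurePreserving Measure.quasiMeasurePreserving_fst
  have hind : AEMeasurable (fun p : E n × ℝ => h p.1 * B.indicator 1 p.2)
      ((surfaceMeasure Ω).prod (volume.restrict (Ioo 0 δ))) :=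
    hfst.mul ((measurable_one.indicator hB).comp measurable_snd).aemeasurable
  have h1 : ∫⁻ x in C.inside ∩ C.depth ⁻¹' B, h (C.foot x) =
      ∫⁻ x in C.inside, h (C.foot x) * B.indicator 1 (C.depth x) := by
    rw [inter_comm, ← Measure.restrict_restrict (C.measurable_depth hB),
      ← lintegral_indicator (C.measurable_depth hB)]
    refine lintegral_congr fun x => ?_
    by_cases hx : C.depth x ∈ B <;> simp [hx]
  rw [h1, lintegral_inside hΩ hn hC hind, ← lintegral_const_mul'' _ hm]
  have hsupp : ∀ᵐ y ∂surfaceMeasure Ω, y ∈ frontier Ω :=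
    ae_restrict_mem isClosed_frontier.measurableSet
  refine lintegral_mono_ae ?_
  filter_upwards [hsupp] with y hy
  calc _ ≤ ∫⁻ t in Ioo 0 δ, 2 * h y * B.indicator 1 t := by
        refine setLIntegral_mono' measurableSet_Ioo fun t ht => ?_
        have h2 : ENNReal.ofReal (C.jacobian (y, t)) ≤ 2 := by
          rw [← ENNReal.ofReal_ofNat]
          refine ENNReal.ofReal_le_ofReal ?_
          linarith [(hC.jacobian_mem hy (t := t) (by rw [abs_of_pos ht.1]; exact ht.2)).2]
        calc _ ≤ h y * B.indicator 1 t * 2 := by gcongr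
          _ = _ := by ring
    _ = 2 * h y * ∫⁻ t in Ioo 0 δ, B.indicator 1 t :=
        lintegral_const_mul _ (measurable_one.indicator hB)
    _ = _ := by
        rw [lintegral_indicator_one hB, Measure.restrict_apply hB]
        ring

end Collar

variable {n : ℕ} {Ω : Set (E n)} {δ : ℝ}

/-! ### Weak gradients -/

/-- The integration by parts identity that defines the weak gradient. -/
def IsWeakGradient (Ω : Set (E n)) (u : E n → ℝ) (G : E n → E n) : Prop :=
  ∀ φ : E n → ℝ, ContDiff ℝ ∞ φ → HasCompactSupport φ → tsupport φ ⊆ Ω →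
    ∫ x in Ω, u x • gradient φ x = -∫ x in Ω, φ x • G x

theorem continuous_gradient {φ : E n → ℝ} (hφ : ContDiff ℝ 1 φ) : Continuous (gradient φ) :=
  (InnerProductSpace.toDual ℝ (E n)).symm.continuous.comp (hφ.continuous_fderiv one_ne_zero)

theorem gradient_eq_zero_of_notMem_tsupport {φ : E n → ℝ} {x : E n} (hx : x ∉ tsupport φ) :
    ∀ᶠ z in 𝓝 x, φ z = 0 ∧ gradient φ z = 0 := by
  have h := (notMem_tsupport_iff_eventuallyEq.1 hx)
  filter_upwards [h.eventually_nhds] with z hz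
  refine ⟨hz.self_of_nhds, ?_⟩
  have hz' : φ =ᶠ[𝓝 z] fun _ => (0 : ℝ) := hz
  rw [gradient, hz'.fderiv_eq]
  simp

theorem exists_norm_le_of_hasCompactSupport {φ : E n → ℝ} (hφ : ContDiff ℝ 1 φ)
    (hc : HasCompactSupport φ) : ∃ K : ℝ, 0 ≤ K ∧ ∀ x, |φ x| ≤ K ∧ ‖gradient φ x‖ ≤ K := by
  obtain ⟨K₁, h1⟩ := hφ.continuous.bounded_above_of_compact_support hc
  have hs : HasCompactSupport (gradient φ) := hc.mono' fun x hx => by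
    by_contra h
    exact hx (gradient_eq_zero_of_notMem_tsupport h).self_of_nhds.2
  obtain ⟨K₂, h2⟩ := (continuous_gradient hφ).bounded_above_of_compact_support hs
  exact ⟨max (max K₁ K₂) 0, le_max_right _ _, fun x =>
    ⟨((h1 x).trans (le_max_left _ _)).trans (le_max_left _ _),
      ((h2 x).trans (le_max_right _ _)).trans (le_max_left _ _)⟩⟩

/-- A function that is `C¹` in `Ω` has its gradient as weak gradient. -/
theorem isWeakGradient_gradient {u : E n → ℝ} (hu : ∀ x ∈ Ω, ContDiffAt ℝ 1 u x) :
    IsWeakGradient Ω u (gradient u) := by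
  intro φ hφ hc hsub
  have hφ1 : ContDiff ℝ 1 φ := hφ.of_le (by exact_mod_cast le_top)
  -- The product with the test function is `C¹` on the whole space although `u` is `C¹` in `Ω` only.
  -- Integration by parts is then the vanishing of the integral of `∇F`.
  set F : E n → ℝ := fun x => φ x * u x with hF
  have hFd : ContDiff ℝ 1 F := contDiff_iff_contDiffAt.2 fun x => by
    by_cases hx : x ∈ tsupport φ
    · exact hφ1.contDiffAt.mul (hu x (hsub hx))
    · refine (contDiffAt_const (c := (0 : ℝ))).congr_of_eventuallyEq ?_
      filter_upwards [gradient_eq_zero_of_notMem_tsupport hx] with z hz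
      simp [hF, hz.1]
  have hFc : HasCompactSupport F := hc.mul_right
  have hgradF : ∀ x, gradient F x = φ x • gradient u x + u x • gradient φ x := by
    intro x
    by_cases hx : x ∈ tsupport φ
    · have h1 := (hφ1.differentiable one_ne_zero x).hasFDerivAt.mul
        ((hu x (hsub hx)).differentiableAt one_ne_zero).hasFDerivAt
      have h2 : fderiv ℝ F x = φ x • fderiv ℝ u x + u x • fderiv ℝ φ x := h1.fderiv
      simp only [gradient, h2, map_add, map_smul]
    · have h1 := (gradient_eq_zero_of_notMem_tsupport hx).self_of_nhds
      have h2 : F =ᶠ[𝓝 x] fun _ => (0 : ℝ) := by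
        filter_upwards [gradient_eq_zero_of_notMem_tsupport hx] with z hz
        simp [hF, hz.1]
      rw [h1.1, h1.2, gradient, h2.fderiv_eq]
      simp
  have hcont1 : Continuous fun x => φ x • gradient u x := continuous_iff_continuousAt.2 fun x => by
    by_cases hx : x ∈ tsupport φ
    · exact hφ1.continuous.continuousAt.smul
        ((contDiffAt_gradient (m := 0) (by simpa using hu x (hsub hx))).continuousAt)
    · refine (continuousAt_const (y := (0 : E n))).congr ?_
      filter_upwards [gradient_eq_zero_of_notMem_tsupport hx] with z hz
      simp [hz.1]
  have hcont2 : Continuous fun x => u x • gradient φ x := continuous_iff_continuousAt.2 fun x => by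
    by_cases hx : x ∈ tsupport φ
    · exact (hu x (hsub hx)).continuousAt.smul (continuous_gradient hφ1).continuousAt
    · refine (continuousAt_const (y := (0 : E n))).congr ?_
      filter_upwards [gradient_eq_zero_of_notMem_tsupport hx] with z hz
      simp [hz.2]
  have hi1 : Integrable fun x => φ x • gradient u x :=
    hcont1.integrable_of_hasCompactSupport hc.smul_right
  have hi2 : Integrable fun x => u x • gradient φ x :=
    hcont2.integrable_of_hasCompactSupport (hc.mono' fun x hx => by
      by_contra h
      exact hx (by simp [(gradient_eq_zero_of_notMem_tsupport h).self_of_nhds.2]))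
  have hi : Integrable (gradient F) := by
    have := hi1.add hi2
    exact this.congr (Eventually.of_forall fun x => (hgradF x).symm)
  have hzero : ∫ x, gradient F x = 0 := by
    refine ext_inner_left ℝ fun v => ?_
    rw [← integral_inner hi, inner_zero_right]
    have h1 : ∀ x, inner ℝ v (gradient F x) = fderiv ℝ F x v := fun x => by
      rw [real_inner_comm, IsLocalDefiningFunction.inner_gradient]
    simp only [h1]
    have hi' : Integrable fun x => fderiv ℝ F x v := by
      have := hi.const_inner (𝕜 := ℝ) v
      exact this.congr (Eventually.of_forall h1)
    have hIF : Integrable F := hFd.continuous.integrable_of_hasCompactSupport hFc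
    have := integral_mul_fderiv_eq_neg_fderiv_mul_of_integrable (𝕜 := ℝ) (f := fun _ : E n => (1 : ℝ))
      (g := F) (v := v) (μ := volume) (by simp) (by simpa using hi') (by simpa using hIF)
      (by simp) (fun x _ => hFd.differentiable one_ne_zero x)
    simpa using this
  have hoff : ∀ x ∉ Ω, φ x • gradient u x = 0 ∧ u x • gradient φ x = 0 := fun x hx => by
    have := (gradient_eq_zero_of_notMem_tsupport fun h => hx (hsub h)).self_of_nhds
    simp [this.1, this.2]
  rw [setIntegral_eq_integral_of_forall_compl_eq_zero fun x hx => (hoff x hx).2,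
    setIntegral_eq_integral_of_forall_compl_eq_zero fun x hx => (hoff x hx).1,
    eq_neg_iff_add_eq_zero, add_comm, ← integral_add hi1 hi2, ← hzero]
  exact integral_congr_ae (Eventually.of_forall fun x => (hgradF x).symm)

/-- Weak gradients pass to limits in `L¹`. -/
theorem IsWeakGradient.of_tendsto {u : ℕ → E n → ℝ} {G : ℕ → E n → E n} {v : E n → ℝ}
    {F : E n → E n} (h : ∀ k, IsWeakGradient Ω (u k) (G k))
    (hui : ∀ k, IntegrableOn (u k) Ω) (hGi : ∀ k, IntegrableOn (G k) Ω)
    (hv : IntegrableOn v Ω) (hF : IntegrableOn F Ω)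
    (hu : Tendsto (fun k => ∫⁻ x in Ω, ‖u k x - v x‖ₑ) atTop (𝓝 0))
    (hG : Tendsto (fun k => ∫⁻ x in Ω, ‖G k x - F x‖ₑ) atTop (𝓝 0)) :
    IsWeakGradient Ω v F := by
  intro φ hφ hc hsub
  have hφ1 : ContDiff ℝ 1 φ := hφ.of_le (by exact_mod_cast le_top)
  obtain ⟨K, hK0, hK⟩ := exists_norm_le_of_hasCompactSupport hφ1 hc
  have hmul : ∀ {f : ℕ → ℝ≥0∞}, Tendsto f atTop (𝓝 0) →
      Tendsto (fun k => ENNReal.ofReal K * f k) atTop (𝓝 0) := fun hf => by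
    simpa using ENNReal.Tendsto.const_mul hf (Or.inr ENNReal.ofReal_ne_top)
  have hi1 : ∀ {w : E n → ℝ}, IntegrableOn w Ω → Integrable (fun x => w x • gradient φ x)
      (volume.restrict Ω) := fun hw =>
    Integrable.smul_bdd hw K (continuous_gradient hφ1).aestronglyMeasurable
      (Eventually.of_forall fun x => (hK x).2)
  have hi2 : ∀ {w : E n → E n}, IntegrableOn w Ω → Integrable (fun x => φ x • w x)
      (volume.restrict Ω) := fun hw =>
    Integrable.bdd_smul hw K hφ1.continuous.aestronglyMeasurable
      (Eventually.of_forall fun x => (hK x).1)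
  have h1 : Tendsto (fun k => ∫ x in Ω, u k x • gradient φ x) atTop
      (𝓝 (∫ x in Ω, v x • gradient φ x)) := by
    refine tendsto_integral_of_L1 _ (hi1 hv).aestronglyMeasurable (Eventually.of_forall fun k => hi1 (hui k)) ?_
    refine tendsto_of_tendsto_of_tendsto_of_le_of_le tendsto_const_nhds (hmul hu)
      (fun _ => zero_le) fun k => ?_
    rw [← lintegral_const_mul' _ _ ENNReal.ofReal_ne_top]
    refine lintegral_mono fun x => ?_
    rw [← sub_smul, enorm_smul, mul_comm]
    gcongr
    rw [← ofReal_norm]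
    exact ENNReal.ofReal_le_ofReal (hK x).2
  have h2 : Tendsto (fun k => ∫ x in Ω, φ x • G k x) atTop (𝓝 (∫ x in Ω, φ x • F x)) := by
    refine tendsto_integral_of_L1 _ (hi2 hF).aestronglyMeasurable (Eventually.of_forall fun k => hi2 (hGi k)) ?_
    refine tendsto_of_tendsto_of_tendsto_of_le_of_le tendsto_const_nhds (hmul hG)
      (fun _ => zero_le) fun k => ?_
    rw [← lintegral_const_mul' _ _ ENNReal.ofReal_ne_top]
    refine lintegral_mono fun x => ?_
    rw [← smul_sub, enorm_smul]
    gcongr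
    rw [← ofReal_norm]
    exact ENNReal.ofReal_le_ofReal (hK x).1
  refine tendsto_nhds_unique h1 ?_
  simp_rw [fun k => h k φ hφ hc hsub]
  exact h2.neg

/-- Weak gradients pass to dominated limits. -/
theorem IsWeakGradient.of_dominated {u : ℕ → E n → ℝ} {G : ℕ → E n → E n} {v : E n → ℝ}
    {F : E n → E n} {g : E n → ℝ} (h : ∀ k, IsWeakGradient Ω (u k) (G k))
    (hum : ∀ k, AEStronglyMeasurable (u k) (volume.restrict Ω))
    (hGm : ∀ k, AEStronglyMeasurable (G k) (volume.restrict Ω)) (hg : IntegrableOn g Ω)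
    (hub : ∀ k, ∀ᵐ x ∂volume.restrict Ω, ‖u k x‖ ≤ g x)
    (hGb : ∀ k, ∀ᵐ x ∂volume.restrict Ω, ‖G k x‖ ≤ g x)
    (hu : ∀ᵐ x ∂volume.restrict Ω, Tendsto (fun k => u k x) atTop (𝓝 (v x)))
    (hG : ∀ᵐ x ∂volume.restrict Ω, Tendsto (fun k => G k x) atTop (𝓝 (F x))) :
    IsWeakGradient Ω v F := by
  have hvm := aestronglyMeasurable_of_tendsto_ae atTop hum hu
  have hFm := aestronglyMeasurable_of_tendsto_ae atTop hGm hG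
  have hvb : ∀ᵐ x ∂volume.restrict Ω, ‖v x‖ ≤ g x := by
    filter_upwards [hu, ae_all_iff.2 hub] with x h1 h2 using le_of_tendsto' h1.norm h2
  have hFb : ∀ᵐ x ∂volume.restrict Ω, ‖F x‖ ≤ g x := by
    filter_upwards [hG, ae_all_iff.2 hGb] with x h1 h2 using le_of_tendsto' h1.norm h2
  refine IsWeakGradient.of_tendsto h (fun k => hg.mono' (hum k) (hub k))
    (fun k => hg.mono' (hGm k) (hGb k)) (hg.mono' hvm hvb) (hg.mono' hFm hFb) ?_ ?_
  · have := tendsto_lintegral_norm_of_dominated_convergence hum hg.2 hub hu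
    simpa only [ofReal_norm] using this
  · have := tendsto_lintegral_norm_of_dominated_convergence hGm hg.2 hGb hG
    simpa only [ofReal_norm] using this

theorem IsWeakGradient.ae_eq (hΩ : IsOpen Ω) {u : E n → ℝ} {F G : E n → E n}
    (hF : IsWeakGradient Ω u F) (hG : IsWeakGradient Ω u G) (hFi : IntegrableOn F Ω)
    (hGi : IntegrableOn G Ω) : F =ᵐ[volume.restrict Ω] G := by
  have h := hΩ.ae_eq_zero_of_integral_contDiff_smul_eq_zero (μ := volume) (f := fun x => F x - G x)
    ((hFi.sub hGi).locallyIntegrableOn) fun φ hφ hc hsub => by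
      have hφ1 : ContDiff ℝ 1 φ := hφ.of_le (by exact_mod_cast le_top)
      obtain ⟨K, hK0, hK⟩ := exists_norm_le_of_hasCompactSupport hφ1 hc
      have hi : ∀ {w : E n → E n}, IntegrableOn w Ω → Integrable (fun x => φ x • w x)
          (volume.restrict Ω) := fun hw =>
        Integrable.bdd_smul hw K hφ1.continuous.aestronglyMeasurable
          (Eventually.of_forall fun x => (hK x).1)
      rw [← setIntegral_eq_integral_of_forall_compl_eq_zero (s := Ω) fun x hx => by
        rw [image_eq_zero_of_notMem_tsupport fun h => hx (hsub h), zero_smul]]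
      simp only [smul_sub]
      rw [integral_sub (hi hFi) (hi hGi), sub_eq_zero, ← neg_inj,
        ← hF φ hφ hc hsub, ← hG φ hφ hc hsub]
  rw [EventuallyEq, ae_restrict_iff' hΩ.measurableSet]
  filter_upwards [h] with x hx hxΩ using sub_eq_zero.1 (hx hxΩ)

/-- `weakGradient` is picked by choice; uniqueness allows the energy to be computed with an explicit
gradient. -/
theorem weakGradient_ae_eq (hΩ : IsC2Domain Ω) {u : E n → ℝ} {G : E n → E n}
    (h : HasWeakGradient Ω u G) : weakGradient Ω u =ᵐ[volume.restrict Ω] G := by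
  have : IsFiniteMeasure (volume.restrict Ω) := ⟨by simpa using hΩ.volume_lt_top⟩
  have hu : MemH1 Ω u := ⟨G, h⟩
  have hs : HasWeakGradient Ω u (weakGradient Ω u) := by
    rw [weakGradient, dif_pos hu]
    exact hu.choose_spec
  exact IsWeakGradient.ae_eq hΩ.isOpen hs.2.2 h.2.2 (hs.2.1.integrable (by norm_num))
    (h.2.1.integrable (by norm_num))

variable {n : ℕ} {Ω : Set (E n)} {δ : ℝ}

theorem IsC2Domain.ae_mem_frontier (Ω : Set (E n)) : ∀ᵐ y ∂surfaceMeasure Ω, y ∈ frontier Ω :=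
  ae_restrict_mem isClosed_frontier.measurableSet

namespace Collar

variable (C : Collar Ω δ)

/-! ### Functions of the normal coordinates -/

/-- A `C¹` profile function of a boundary value and the depth, equal to `b` at depth at least
`δ / 2`. -/
structure IsCutoff (δ b K : ℝ) (H : ℝ × ℝ → ℝ) : Prop where
  contDiff : ContDiff ℝ 1 H
  abs_le : ∀ z, |H z| ≤ K
  norm_fderiv_le : ∀ z, ‖fderiv ℝ H z‖ ≤ K
  eq_right : ∀ q t, δ / 2 ≤ t → H (q, t) = b

open Classical in
/-- The function that is `H(q(y), t)` in normal coordinates `y + t ν(y)`, continued by `b`. -/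
def extend (b : ℝ) (H : ℝ × ℝ → ℝ) (q : E n → ℝ) : E n → ℝ :=
  C.inside.piecewise (fun x => H (q (C.foot x), C.depth x)) fun _ => b

/-- The gradient of `C.extend b H q` for `q` with surface gradient `G`. -/
def extendGrad (H : ℝ × ℝ → ℝ) (q : E n → ℝ) (G : E n → E n) : E n → E n :=
  C.inside.indicator fun x =>
    fderiv ℝ H (q (C.foot x), C.depth x) (1, 0) •
      ContinuousLinearMap.adjoint (fderiv ℝ C.foot x) (G (C.foot x)) +
    fderiv ℝ H (q (C.foot x), C.depth x) (0, 1) • inwardNormal Ω (C.foot x)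

variable {C} {b K : ℝ} {H : ℝ × ℝ → ℝ} {q : E n → ℝ} {G : E n → E n} {x : E n}

open Classical in
theorem extend_of_mem (hx : x ∈ C.inside) :
    C.extend b H q x = H (q (C.foot x), C.depth x) := piecewise_eq_of_mem _ _ _ hx

open Classical in
theorem extend_of_notMem (hx : x ∉ C.inside) : C.extend b H q x = b :=
  piecewise_eq_of_notMem _ _ _ hx

theorem continuousOn_inwardNormal (C : Collar Ω δ) : ContinuousOn (inwardNormal Ω) (frontier Ω) :=
    fun y hy => by
  have := (C.hasFDerivAt_normal (C.frontier_subset hy)).continuousAt.continuousWithinAt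
    (s := frontier Ω)
  exact this.congr (fun z hz => by rw [C.foot_of_mem hz]) (by rw [C.foot_of_mem hy])

/-- The points of depth in `[0, δ/2]` form a compact set, so that a point of `Ω` off the collar has
a neighbourhood avoiding it. The collar points there are deeper than `δ/2`, where `H = b`. The
extension is therefore smooth across the inner edge of the collar. -/
theorem eventually_extend_eq (hΩ : IsC2Domain Ω) (hH : IsCutoff δ b K H) (hx : x ∈ Ω)
    (hx' : x ∉ C.inside) (q : E n → ℝ) : C.extend b H q =ᶠ[𝓝 x] fun _ => b := by
  set Z := (fun p : E n × ℝ => p.1 + p.2 • inwardNormal Ω p.1) '' (frontier Ω ×ˢ Icc 0 (δ / 2))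
    with hZ
  have hZc : IsCompact Z := by
    refine (hΩ.isCompact_frontier.prod isCompact_Icc).image_of_continuousOn ?_
    exact continuousOn_fst.add (continuousOn_snd.smul
      (C.continuousOn_inwardNormal.comp continuousOn_fst fun p hp => hp.1))
  have hxZ : x ∉ Z := by
    rintro ⟨⟨y, t⟩, ⟨hy, ht⟩, rfl⟩
    have htδ : |t| < δ := by
      rw [abs_of_nonneg ht.1]; linarith [ht.2, C.pos]
    have hmem := C.add_mem y hy t htδ
    exact hx' ⟨hmem, ((C.isFootpoint _ hmem).mem_iff).1 hx⟩
  filter_upwards [hZc.isClosed.isOpen_compl.mem_nhds hxZ] with z hz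
  by_cases hzi : z ∈ C.inside
  · rw [extend_of_mem hzi]
    refine hH.eq_right _ _ ?_
    by_contra! hlt
    exact hz ⟨(C.foot z, C.depth z), ⟨(C.isFootpoint z hzi.1).mem, hzi.2.le, hlt.le⟩,
      (C.isFootpoint z hzi.1).add_eq⟩
  · exact extend_of_notMem hzi

theorem extend_eventuallyEq (hΩ : IsC2Domain Ω) (hx : x ∈ C.inside) :
    C.extend b H q =ᶠ[𝓝 x] fun x => H (q (C.foot x), C.depth x) := by
  filter_upwards [(C.isOpen_inside hΩ).mem_nhds hx] with z hz using extend_of_mem hz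

theorem contDiffAt_extend (hΩ : IsC2Domain Ω) (hH : IsCutoff δ b K H) (hq : ContDiff ℝ 1 q)
    (hx : x ∈ Ω) : ContDiffAt ℝ 1 (C.extend b H q) x := by
  by_cases hxi : x ∈ C.inside
  · refine ContDiffAt.congr_of_eventuallyEq ?_ (extend_eventuallyEq hΩ hxi)
    have hf := C.isFootpoint x hxi.1
    exact hH.contDiff.contDiffAt.comp x
      ((hq.contDiffAt.comp x hf.contDiffAt_foot).prodMk hf.contDiffAt_depth)
  · exact contDiffAt_const.congr_of_eventuallyEq (eventually_extend_eq hΩ hH hx hxi q)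

/-- Chain rule. The derivative of the foot has tangential range, so that its adjoint kills the
normal part of `∇q`, and the tangential gradient may stand in for the full one. -/
theorem gradient_extend (hΩ : IsC2Domain Ω) (hH : IsCutoff δ b K H) (hq : ContDiff ℝ 1 q)
    (hx : x ∈ Ω) : gradient (C.extend b H q) x =
      C.extendGrad H q (tangentialGradient Ω q) x := by
  by_cases hxi : x ∈ C.inside
  · have hd := (hH.contDiff.differentiable one_ne_zero (q (C.foot x), C.depth x)).hasFDerivAt.comp x
      (((hq.differentiable one_ne_zero (C.foot x)).hasFDerivAt.comp x
        (C.hasFDerivAt_foot hxi.1)).prodMk (C.hasFDerivAt_depth hxi.1))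
    have hd' := hd.congr_of_eventuallyEq (extend_eventuallyEq (b := b) hΩ hxi)
    refine ext_inner_right ℝ fun v => ?_
    rw [IsLocalDefiningFunction.inner_gradient, hd'.fderiv, extendGrad, indicator_of_mem hxi,
      inner_add_left, real_inner_smul_left, real_inner_smul_left,
      ContinuousLinearMap.adjoint_inner_left, ← fderiv_depth hΩ hxi.1, tangentialGradient,
      inner_sub_left, real_inner_smul_left, (C.isFootpoint x hxi.1).inner_eq_zero,
      IsLocalDefiningFunction.inner_gradient, mul_zero, sub_zero]
    have hsplit : ∀ s t : ℝ, ((s, t) : ℝ × ℝ) = s • (1, 0) + t • (0, 1) := fun s t => by simp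
    simp only [ContinuousLinearMap.comp_apply, ContinuousLinearMap.prod_apply]
    rw [hsplit (fderiv ℝ q (C.foot x) (fderiv ℝ C.foot x v)), map_add, map_smul, map_smul,
      smul_eq_mul, smul_eq_mul, mul_comm, mul_comm (fderiv ℝ C.depth x v)]
  · rw [extendGrad, indicator_of_notMem hxi, gradient,
      (eventually_extend_eq hΩ hH hx hxi q).fderiv_eq]
    simp

theorem abs_fderiv_fst_le (hH : IsCutoff δ b K H) (z : ℝ × ℝ) : |fderiv ℝ H z (1, 0)| ≤ K := by
  have := (fderiv ℝ H z).le_opNorm (1, 0)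
  simp only [Prod.norm_mk, norm_one, norm_zero, Real.norm_eq_abs] at this
  exact this.trans (by simpa using hH.norm_fderiv_le z)

theorem abs_fderiv_snd_le (hH : IsCutoff δ b K H) (z : ℝ × ℝ) : |fderiv ℝ H z (0, 1)| ≤ K := by
  have := (fderiv ℝ H z).le_opNorm (0, 1)
  simp only [Prod.norm_mk, norm_one, norm_zero, Real.norm_eq_abs] at this
  exact this.trans (by simpa using hH.norm_fderiv_le z)

theorem norm_adjoint_fderiv_foot_le (hΩ : IsC2Domain Ω) (hC : C.IsThin) (hx : x ∈ C.carrier)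
    (v : E n) : ‖ContinuousLinearMap.adjoint (fderiv ℝ C.foot x) v‖ ≤ 4 * ‖v‖ := by
  refine (ContinuousLinearMap.le_opNorm _ _).trans ?_
  rw [LinearIsometryEquiv.norm_map]
  exact mul_le_mul_of_nonneg_right (hC.norm_fderiv_foot_le hΩ hx) (norm_nonneg _)

theorem norm_extendGrad_le (hΩ : IsC2Domain Ω) (hC : C.IsThin) (hH : IsCutoff δ b K H) (x : E n) :
    ‖C.extendGrad H q G x‖ ≤ C.inside.indicator (fun x => K * (4 * ‖G (C.foot x)‖ + 1)) x := by
  by_cases hx : x ∈ C.inside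
  · have hK : 0 ≤ K := (abs_nonneg _).trans (hH.abs_le (0, 0))
    rw [extendGrad, indicator_of_mem hx, indicator_of_mem hx, mul_add]
    refine (norm_add_le _ _).trans (add_le_add ?_ ?_)
    · rw [norm_smul]
      exact mul_le_mul (abs_fderiv_fst_le hH _) (norm_adjoint_fderiv_foot_le hΩ hC hx.1 _)
        (norm_nonneg _) hK
    · rw [norm_smul, hΩ.norm_inwardNormal (C.isFootpoint x hx.1).mem]
      exact mul_le_mul_of_nonneg_right (abs_fderiv_snd_le hH _) zero_le_one
  · rw [extendGrad, indicator_of_notMem hx, indicator_of_notMem hx, norm_zero]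

theorem enorm_extendGrad_sub_le (hΩ : IsC2Domain Ω) (hC : C.IsThin) (hH : IsCutoff δ b K H)
    (G' : E n → E n) (hx : x ∈ C.inside) :
    ‖C.extendGrad H q G x - C.extendGrad H q G' x‖ₑ ≤
      ENNReal.ofReal (K * 4) * ‖G (C.foot x) - G' (C.foot x)‖ₑ := by
  have hK : 0 ≤ K := (abs_nonneg _).trans (hH.abs_le (0, 0))
  rw [extendGrad, extendGrad, indicator_of_mem hx, indicator_of_mem hx, add_sub_add_right_eq_sub,
    ← smul_sub, ← map_sub, ← ofReal_norm, ← ofReal_norm, ← ENNReal.ofReal_mul (by positivity),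
    norm_smul, mul_assoc]
  exact ENNReal.ofReal_le_ofReal (mul_le_mul (abs_fderiv_fst_le hH _)
    (norm_adjoint_fderiv_foot_le hΩ hC hx.1 _) (norm_nonneg _) hK)

theorem restrict_restrict_inside (C : Collar Ω δ) :
    (volume.restrict Ω).restrict C.inside = volume.restrict C.inside := by
  rw [Measure.restrict_restrict C.measurableSet_inside, inter_eq_left.2 C.inside_subset]

theorem aestronglyMeasurable_depth (C : Collar Ω δ) (μ : Measure (E n)) :
    AEStronglyMeasurable C.depth μ := C.measurable_depth.aestronglyMeasurable

theorem aestronglyMeasurable_comp_foot (hΩ : IsC2Domain Ω) (hn : 1 ≤ n) (hC : C.IsThin)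
    {F : Type*} [TopologicalSpace F] {f : E n → F}
    (hf : AEStronglyMeasurable f (surfaceMeasure Ω)) :
    AEStronglyMeasurable (fun x => f (C.foot x)) (volume.restrict C.inside) :=
  hf.comp_quasiMeasurePreserving (quasiMeasurePreserving_foot hΩ hn hC)

theorem aestronglyMeasurable_normal (C : Collar Ω δ) :
    AEStronglyMeasurable (fun x => inwardNormal Ω (C.foot x)) (volume.restrict C.inside) :=
  ContinuousOn.aestronglyMeasurable (fun _ hx =>
    (C.hasFDerivAt_normal hx.1).continuousAt.continuousWithinAt) C.measurableSet_inside

theorem aestronglyMeasurable_adjoint (hΩ : IsC2Domain Ω) (hn : 1 ≤ n) (hC : C.IsThin)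
    (hG : AEStronglyMeasurable G (surfaceMeasure Ω)) :
    AEStronglyMeasurable (fun x => ContinuousLinearMap.adjoint (fderiv ℝ C.foot x) (G (C.foot x)))
      (volume.restrict C.inside) := by
  have h1 : AEStronglyMeasurable (fun x => ContinuousLinearMap.adjoint (fderiv ℝ C.foot x))
      (volume.restrict C.inside) :=
    (ContinuousLinearMap.adjoint (𝕜 := ℝ) (E := E n) (F := E n)).continuous.comp_aestronglyMeasurable
      (measurable_fderiv ℝ C.foot).aestronglyMeasurable
  have h2 := aestronglyMeasurable_comp_foot hΩ hn hC hG
  exact isBoundedBilinearMap_apply.continuous.comp_aestronglyMeasurable (h1.prodMk h2)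

theorem aestronglyMeasurable_extend (hΩ : IsC2Domain Ω) (hn : 1 ≤ n) (hC : C.IsThin)
    (hH : Continuous H) (hq : AEStronglyMeasurable q (surfaceMeasure Ω)) :
    AEStronglyMeasurable (C.extend b H q) (volume.restrict Ω) := by
  classical
  refine AEStronglyMeasurable.piecewise C.measurableSet_inside ?_ aestronglyMeasurable_const
  rw [C.restrict_restrict_inside]
  exact hH.comp_aestronglyMeasurable
    ((aestronglyMeasurable_comp_foot hΩ hn hC hq).prodMk (C.aestronglyMeasurable_depth _))

theorem aestronglyMeasurable_extendGrad (hΩ : IsC2Domain Ω) (hn : 1 ≤ n) (hC : C.IsThin)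
    (hH : ContDiff ℝ 1 H) (hq : AEStronglyMeasurable q (surfaceMeasure Ω))
    (hG : AEStronglyMeasurable G (surfaceMeasure Ω)) :
    AEStronglyMeasurable (C.extendGrad H q G) (volume.restrict Ω) := by
  rw [extendGrad, aestronglyMeasurable_indicator_iff C.measurableSet_inside,
    C.restrict_restrict_inside]
  have h1 := (aestronglyMeasurable_comp_foot hΩ hn hC hq).prodMk (C.aestronglyMeasurable_depth _)
  have h2 : ∀ v : ℝ × ℝ, Continuous fun z => fderiv ℝ H z v := fun v =>
    (hH.continuous_fderiv one_ne_zero).clm_apply continuous_const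
  exact (((h2 (1, 0)).comp_aestronglyMeasurable h1).smul
    (aestronglyMeasurable_adjoint hΩ hn hC hG)).add
    (((h2 (0, 1)).comp_aestronglyMeasurable h1).smul (C.aestronglyMeasurable_normal))

theorem memLp_comp_foot (hΩ : IsC2Domain Ω) (hn : 1 ≤ n) (hC : C.IsThin)
    (hG : MemLp G 2 (surfaceMeasure Ω)) :
    MemLp (fun x => G (C.foot x)) 2 (volume.restrict C.inside) := by
  refine ⟨aestronglyMeasurable_comp_foot hΩ hn hC hG.1, ?_⟩
  have h1 := lintegral_rpow_enorm_lt_top_of_eLpNorm_lt_top (by norm_num) (by norm_num) hG.2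
  rw [eLpNorm_lt_top_iff_lintegral_rpow_enorm_lt_top (by norm_num) (by norm_num)]
  have h2 := lintegral_inside_le hΩ hn hC (h := fun y => ‖G y‖ₑ ^ (2 : ℝ≥0∞).toReal)
    (hG.1.enorm.pow_const _) MeasurableSet.univ
  rw [preimage_univ, inter_univ, univ_inter, Real.volume_Ioo] at h2
  exact h2.trans_lt (ENNReal.mul_lt_top (ENNReal.mul_lt_top (by norm_num) ENNReal.ofReal_lt_top) h1)

theorem memLp_bound (hΩ : IsC2Domain Ω) (hn : 1 ≤ n) (hC : C.IsThin)
    (hG : MemLp G 2 (surfaceMeasure Ω)) (K : ℝ) :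
    MemLp (C.inside.indicator (fun x => K * (4 * ‖G (C.foot x)‖ + 1))) 2 (volume.restrict Ω) := by
  have : IsFiniteMeasure (volume.restrict C.inside) :=
    ⟨by simpa using (measure_mono C.inside_subset).trans_lt hΩ.volume_lt_top⟩
  rw [memLp_indicator_iff_restrict C.measurableSet_inside, C.restrict_restrict_inside]
  exact (((memLp_comp_foot hΩ hn hC hG).norm.const_mul 4).add (memLp_const 1)).const_mul K

theorem memLp_extendGrad (hΩ : IsC2Domain Ω) (hn : 1 ≤ n) (hC : C.IsThin) (hH : IsCutoff δ b K H)
    (hq : AEStronglyMeasurable q (surfaceMeasure Ω)) (hG : MemLp G 2 (surfaceMeasure Ω)) :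
    MemLp (C.extendGrad H q G) 2 (volume.restrict Ω) :=
  (memLp_bound hΩ hn hC hG K).mono' (aestronglyMeasurable_extendGrad hΩ hn hC hH.contDiff hq hG.1)
    (Eventually.of_forall (norm_extendGrad_le hΩ hC hH))

theorem norm_extend_le (hH : IsCutoff δ b K H) (x : E n) : ‖C.extend b H q x‖ ≤ K := by
  by_cases hx : x ∈ C.inside
  · rw [extend_of_mem hx]; exact hH.abs_le _
  · rw [extend_of_notMem hx, ← hH.eq_right 0 (δ / 2) le_rfl]; exact hH.abs_le _

theorem memLp_extend (hΩ : IsC2Domain Ω) (hn : 1 ≤ n) (hC : C.IsThin) (hH : IsCutoff δ b K H)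
    (hq : AEStronglyMeasurable q (surfaceMeasure Ω)) :
    MemLp (C.extend b H q) 2 (volume.restrict Ω) := by
  have : IsFiniteMeasure (volume.restrict Ω) := ⟨by simpa using hΩ.volume_lt_top⟩
  exact MemLp.of_bound (aestronglyMeasurable_extend hΩ hn hC hH.contDiff.continuous hq) K
    (Eventually.of_forall (norm_extend_le hH))

end Collar

variable {n : ℕ} {Ω : Set (E n)} {δ : ℝ}

/-! ### Weak gradients of extensions of Sobolev boundary data -/

namespace Collar

variable {C : Collar Ω δ} {b K : ℝ} {H : ℝ × ℝ → ℝ} {q : E n → ℝ} {G : E n → E n}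

theorem ae_comp_foot (hΩ : IsC2Domain Ω) (hn : 1 ≤ n) (hC : C.IsThin) {p : E n → Prop}
    (h : ∀ᵐ y ∂surfaceMeasure Ω, p y) :
    ∀ᵐ x ∂volume.restrict Ω, x ∈ C.inside → p (C.foot x) := by
  refine ae_restrict_of_ae ?_
  exact (ae_restrict_iff' C.measurableSet_inside).1 ((quasiMeasurePreserving_foot hΩ hn hC).ae h)

theorem memLp_tangentialGradient (hΩ : IsC2Domain Ω) (hn : 1 ≤ n) (hC : C.IsThin) {φ : E n → ℝ}
    (hφ : ContDiff ℝ 1 φ) : MemLp (tangentialGradient Ω φ) 2 (surfaceMeasure Ω) := by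
  have := hC.isFiniteMeasure hΩ hn
  have hν := C.continuousOn_inwardNormal
  have hg := (continuous_gradient hφ).continuousOn (s := frontier Ω)
  have hc : ContinuousOn (tangentialGradient Ω φ) (frontier Ω) :=
    hg.sub ((hg.inner (𝕜 := ℝ) hν).smul hν)
  obtain ⟨M, hM⟩ := hΩ.isCompact_frontier.exists_bound_of_continuousOn hc
  refine MemLp.of_bound (hc.aestronglyMeasurable isClosed_frontier.measurableSet) M ?_
  filter_upwards [IsC2Domain.ae_mem_frontier Ω] with y hy using hM y hy

theorem tendsto_lintegral_extend (hΩ : IsC2Domain Ω) (hn : 1 ≤ n) (hC : C.IsThin)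
    (hH : IsCutoff δ b K H) {ψ : ℕ → E n → ℝ}
    (hψ : ∀ k, AEStronglyMeasurable (ψ k) (surfaceMeasure Ω))
    (hq : AEStronglyMeasurable q (surfaceMeasure Ω))
    (h : ∀ᵐ y ∂surfaceMeasure Ω, Tendsto (fun k => ψ k y) atTop (𝓝 (q y))) :
    Tendsto (fun k => ∫⁻ x in Ω, ‖C.extend b H (ψ k) x - C.extend b H q x‖ₑ) atTop (𝓝 0) := by
  have hm : ∀ {q}, AEStronglyMeasurable q (surfaceMeasure Ω) →
      AEStronglyMeasurable (C.extend b H q) (volume.restrict Ω) :=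
    aestronglyMeasurable_extend hΩ hn hC hH.contDiff.continuous
  have key := tendsto_lintegral_of_dominated_convergence' (μ := volume.restrict Ω)
    (F := fun k x => ‖C.extend b H (ψ k) x - C.extend b H q x‖ₑ) (f := fun _ => 0)
    (fun _ => ENNReal.ofReal (K + K)) (fun k => ((hm (hψ k)).sub (hm hq)).enorm)
    (fun k => Eventually.of_forall fun x => ?_) ?_ ?_
  · simpa using key
  · beta_reduce
    rw [← ofReal_norm]
    exact ENNReal.ofReal_le_ofReal ((norm_sub_le _ _).trans
      (add_le_add (norm_extend_le hH x) (norm_extend_le hH x)))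
  · rw [lintegral_const, Measure.restrict_apply_univ]
    exact (ENNReal.mul_lt_top ENNReal.ofReal_lt_top hΩ.volume_lt_top).ne
  · filter_upwards [ae_comp_foot hΩ hn hC h] with x hx
    rw [← enorm_zero (E := ℝ), ← sub_self (C.extend b H q x)]
    refine (Tendsto.sub_const ?_ _).enorm
    by_cases hxi : x ∈ C.inside
    · simp only [extend_of_mem hxi]
      exact (hH.contDiff.continuous.tendsto _).comp ((hx hxi).prodMk_nhds tendsto_const_nhds)
    · simp only [extend_of_notMem hxi]
      exact tendsto_const_nhds

theorem tendsto_lintegral_extendGrad (hΩ : IsC2Domain Ω) (hn : 1 ≤ n) (hC : C.IsThin)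
    (hH : IsCutoff δ b K H) {ψ : ℕ → E n → ℝ}
    (hψ : ∀ k, AEStronglyMeasurable (ψ k) (surfaceMeasure Ω))
    (hq : AEStronglyMeasurable q (surfaceMeasure Ω)) (hG : MemLp G 2 (surfaceMeasure Ω))
    (h : ∀ᵐ y ∂surfaceMeasure Ω, Tendsto (fun k => ψ k y) atTop (𝓝 (q y))) :
    Tendsto (fun k => ∫⁻ x in Ω, ‖C.extendGrad H (ψ k) G x - C.extendGrad H q G x‖ₑ)
      atTop (𝓝 0) := by
  have : IsFiniteMeasure (volume.restrict Ω) := ⟨by simpa using hΩ.volume_lt_top⟩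
  have hm : ∀ {q}, AEStronglyMeasurable q (surfaceMeasure Ω) →
      AEStronglyMeasurable (C.extendGrad H q G) (volume.restrict Ω) := fun hq =>
    aestronglyMeasurable_extendGrad hΩ hn hC hH.contDiff hq hG.1
  set B := C.inside.indicator (fun x => K * (4 * ‖G (C.foot x)‖ + 1)) with hB
  have key := tendsto_lintegral_of_dominated_convergence' (μ := volume.restrict Ω)
    (F := fun k x => ‖C.extendGrad H (ψ k) G x - C.extendGrad H q G x‖ₑ) (f := fun _ => 0)
    (fun x => ENNReal.ofReal (B x + B x)) (fun k => ((hm (hψ k)).sub (hm hq)).enorm)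
    (fun k => Eventually.of_forall fun x => ?_) ?_ ?_
  · simpa using key
  · beta_reduce
    rw [← ofReal_norm]
    exact ENNReal.ofReal_le_ofReal ((norm_sub_le _ _).trans
      (add_le_add (norm_extendGrad_le hΩ hC hH x) (norm_extendGrad_le hΩ hC hH x)))
  · have hBi := (memLp_bound hΩ hn hC hG K).integrable (by norm_num)
    exact (hBi.add hBi).lintegral_lt_top.ne
  · filter_upwards [ae_comp_foot hΩ hn hC h] with x hx
    rw [← enorm_zero (E := E n), ← sub_self (C.extendGrad H q G x)]
    refine (Tendsto.sub_const ?_ _).enorm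
    by_cases hxi : x ∈ C.inside
    · simp only [extendGrad, indicator_of_mem hxi]
      have hc : ∀ v : ℝ × ℝ, Tendsto
          (fun k => fderiv ℝ H (ψ k (C.foot x), C.depth x) v) atTop
          (𝓝 (fderiv ℝ H (q (C.foot x), C.depth x) v)) := fun v =>
        (((hH.contDiff.continuous_fderiv one_ne_zero).clm_apply continuous_const).tendsto _).comp
          ((hx hxi).prodMk_nhds tendsto_const_nhds)
      exact ((hc _).smul_const _).add ((hc _).smul_const _)
    · simp only [extendGrad, indicator_of_notMem hxi]
      exact tendsto_const_nhds

theorem isWeakGradient_extend_of_contDiff (hΩ : IsC2Domain Ω) (hH : IsCutoff δ b K H)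
    (hq : ContDiff ℝ 1 q) :
    IsWeakGradient Ω (C.extend b H q) (C.extendGrad H q (tangentialGradient Ω q)) := by
  intro φ hφ hc hsub
  rw [isWeakGradient_gradient (fun x hx => contDiffAt_extend hΩ hH hq hx) φ hφ hc hsub]
  congr 1
  exact setIntegral_congr_fun hΩ.isOpen.measurableSet fun x hx => by
    simp only [gradient_extend hΩ hH hq hx]

/-- The `C¹` approximants of `q` have classical extensions. The error in their gradients has two
parts: a change of surface gradient, which enters linearly and is small in `L¹`, and a change of `q`
with `G` fixed, which is handled by dominated convergence. -/
theorem isWeakGradient_extend (hΩ : IsC2Domain Ω) (hn : 1 ≤ n) (hC : C.IsThin)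
    (hH : IsCutoff δ b K H) (hq : HasSurfaceGradient Ω q G) :
    IsWeakGradient Ω (C.extend b H q) (C.extendGrad H q G) := by
  have := hC.isFiniteMeasure hΩ hn
  have : IsFiniteMeasure (volume.restrict Ω) := ⟨by simpa using hΩ.volume_lt_top⟩
  obtain ⟨hq2, hG2, φ, hφ, h1, h2⟩ := hq
  have hφm : ∀ k, AEStronglyMeasurable (φ k) (surfaceMeasure Ω) := fun k =>
    (hφ k).continuous.aestronglyMeasurable
  -- The derivative of `H` is merely continuous, so that almost everywhere convergence is needed,
  -- along a subsequence.
  obtain ⟨ns, hns, hae⟩ := (tendstoInMeasure_of_tendsto_eLpNorm (by norm_num) hφm hq2.1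
    h1).exists_seq_tendsto_ae
  have h2' := h2.comp hns.tendsto_atTop
  have hT : ∀ k, MemLp (tangentialGradient Ω (φ (ns k))) 2 (surfaceMeasure Ω) := fun k =>
    memLp_tangentialGradient hΩ hn hC (hφ _)
  refine IsWeakGradient.of_tendsto
    (fun k => isWeakGradient_extend_of_contDiff hΩ hH (hφ (ns k)))
    (fun k => (memLp_extend hΩ hn hC hH (hφm _)).integrable (by norm_num))
    (fun k => (memLp_extendGrad hΩ hn hC hH (hφm _) (hT k)).integrable (by norm_num))
    ((memLp_extend hΩ hn hC hH hq2.1).integrable (by norm_num))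
    ((memLp_extendGrad hΩ hn hC hH hq2.1 hG2).integrable (by norm_num))
    (tendsto_lintegral_extend hΩ hn hC hH (fun k => hφm _) hq2.1 hae) ?_
  set D : ℕ → E n → E n := fun k => tangentialGradient Ω (φ (ns k)) - G with hD
  -- The factor `4K` bounds the dependence on `G`, `2δ` comes from normal coordinates, and the root
  -- of the area from Hölder's inequality.
  set A := ENNReal.ofReal (K * 4) * (2 * volume (Ioo 0 δ) * surfaceMeasure Ω univ ^ (1 / 2 : ℝ))
    with hA
  have hAt : A ≠ ⊤ := by
    refine ENNReal.mul_ne_top ENNReal.ofReal_ne_top (ENNReal.mul_ne_top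
      (ENNReal.mul_ne_top (by norm_num) (by simp)) ?_)
    exact ENNReal.rpow_ne_top_of_nonneg (by norm_num) (measure_ne_top _ _)
  have hfirst : ∀ k, ∫⁻ x in Ω, ‖C.extendGrad H (φ (ns k)) (tangentialGradient Ω (φ (ns k))) x -
      C.extendGrad H (φ (ns k)) G x‖ₑ ≤ A * eLpNorm (D k) 2 (surfaceMeasure Ω) := fun k => by
    have hDm : AEStronglyMeasurable (D k) (surfaceMeasure Ω) := (hT k).1.sub hG2.1
    calc _ ≤ ∫⁻ x in Ω, C.inside.indicator
          (fun x => ENNReal.ofReal (K * 4) * ‖D k (C.foot x)‖ₑ) x := by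
          refine lintegral_mono fun x => ?_
          by_cases hx : x ∈ C.inside
          · rw [indicator_of_mem hx]
            exact enorm_extendGrad_sub_le hΩ hC hH _ hx
          · simp [extendGrad, indicator_of_notMem hx]
      _ = ENNReal.ofReal (K * 4) * ∫⁻ x in C.inside, ‖D k (C.foot x)‖ₑ := by
          rw [lintegral_indicator C.measurableSet_inside, C.restrict_restrict_inside,
            lintegral_const_mul' _ _ ENNReal.ofReal_ne_top]
      _ ≤ ENNReal.ofReal (K * 4) * (2 * volume (Ioo 0 δ) * ∫⁻ y, ‖D k y‖ₑ ∂surfaceMeasure Ω) := by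
          gcongr
          simpa using lintegral_inside_le hΩ hn hC (h := fun y => ‖D k y‖ₑ) hDm.enorm
            MeasurableSet.univ
      _ ≤ ENNReal.ofReal (K * 4) * (2 * volume (Ioo 0 δ) *
            (eLpNorm (D k) 2 (surfaceMeasure Ω) * surfaceMeasure Ω univ ^ (1 / 2 : ℝ))) := by
          gcongr
          rw [← eLpNorm_one_eq_lintegral_enorm]
          refine (eLpNorm_le_eLpNorm_mul_rpow_measure_univ (p := 1) (q := 2) (by norm_num)
            hDm).trans_eq ?_
          norm_num
      _ = A * eLpNorm (D k) 2 (surfaceMeasure Ω) := by rw [hA]; ring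
  have hlim1 : Tendsto (fun k => A * eLpNorm (D k) 2 (surfaceMeasure Ω)) atTop (𝓝 0) := by
    simpa using ENNReal.Tendsto.const_mul h2' (Or.inr hAt)
  have hlim2 := tendsto_lintegral_extendGrad hΩ hn hC hH (fun k => hφm (ns k)) hq2.1 hG2 hae
  refine tendsto_of_tendsto_of_tendsto_of_le_of_le tendsto_const_nhds
    (by simpa using hlim1.add hlim2) (fun _ => zero_le) fun k => ?_
  refine le_trans ?_ (add_le_add_left (hfirst k) _)
  have hm1 := (memLp_extendGrad hΩ hn hC hH (hφm (ns k)) (hT k)).1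
  have hm2 := (memLp_extendGrad hΩ hn hC hH (hφm (ns k)) hG2).1
  have hm12 : AEMeasurable (fun x => ‖C.extendGrad H (φ (ns k)) (tangentialGradient Ω (φ (ns k))) x -
      C.extendGrad H (φ (ns k)) G x‖ₑ) (volume.restrict Ω) := (hm1.sub hm2).enorm
  rw [← lintegral_add_left' hm12]
  refine lintegral_mono fun x => ?_
  refine le_trans (le_of_eq ?_) (enorm_add_le _ _)
  rw [sub_add_sub_cancel]

end Collar

/-! ### A regularization of the travel time -/

/-- A bounded continuous approximation of `1 / √W` on `[a, b]`, vanishing at the wells. -/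
def regularSlowness (W : ℝ → ℝ) (a b : ℝ) (k : ℕ) (s : ℝ) : ℝ :=
  √(W (max a (min b s))) / (W (max a (min b s)) + 1 / ((k : ℝ) + 1))

/-- A `C¹` approximation of the travel time from `a`. -/
def regularTravelTime (W : ℝ → ℝ) (a b : ℝ) (k : ℕ) (x : ℝ) : ℝ :=
  ∫ s in a..x, regularSlowness W a b k s

namespace IsSubquadraticDoubleWell

variable {W : ℝ → ℝ} {a b : ℝ}

theorem clamp_mem_Icc (hW : IsSubquadraticDoubleWell W a b) (s : ℝ) :
    max a (min b s) ∈ Icc a b :=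
  ⟨le_max_left _ _, max_le hW.lt.le (min_le_left _ _)⟩

theorem continuous_regularSlowness (hW : IsSubquadraticDoubleWell W a b) (k : ℕ) :
    Continuous (regularSlowness W a b k) := by
  have hc : Continuous fun s => W (max a (min b s)) :=
    hW.continuous.comp (continuous_const.max (continuous_const.min continuous_id))
  refine hc.sqrt.div (hc.add continuous_const) fun s => ?_
  have := hW.nonneg (max a (min b s))
  positivity

theorem regularSlowness_nonneg (hW : IsSubquadraticDoubleWell W a b) (k : ℕ) (s : ℝ) :
    0 ≤ regularSlowness W a b k s := by
  have := hW.nonneg (max a (min b s))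
  rw [regularSlowness]
  positivity

theorem regularSlowness_le_bound (hW : IsSubquadraticDoubleWell W a b) {M : ℝ}
    (hM : ∀ s ∈ Icc a b, √(W s) ≤ M) (k : ℕ) (s : ℝ) :
    regularSlowness W a b k s ≤ M * (k + 1) := by
  have h0 := hW.nonneg (max a (min b s))
  have hk : (0 : ℝ) < 1 / ((k : ℝ) + 1) := by positivity
  have h1 := hM _ (hW.clamp_mem_Icc s)
  rw [regularSlowness, div_le_iff₀ (by positivity)]
  have hM0 : 0 ≤ M := (Real.sqrt_nonneg _).trans h1
  have h2 : M * (k + 1) * (1 / ((k : ℝ) + 1)) = M := by field_simp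
  nlinarith [mul_nonneg (mul_nonneg hM0 (by positivity : (0 : ℝ) ≤ k + 1)) h0]

/-- Since `√W/(W + τ) ≤ 1/√W`, the integrable true slowness dominates for all `k`. At the wells both
sides are `0`, with `1 / √0` read as `0`. -/
theorem regularSlowness_le (hW : IsSubquadraticDoubleWell W a b) (k : ℕ) {s : ℝ}
    (hs : s ∈ Icc a b) : regularSlowness W a b k s ≤ 1 / √(W s) := by
  rw [regularSlowness, min_eq_right hs.2, max_eq_right hs.1]
  rcases (hW.nonneg s).eq_or_lt with h | h
  · simp [← h]
  · rw [div_le_div_iff₀ (by positivity) (Real.sqrt_pos.2 h), Real.mul_self_sqrt h.le, one_mul]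
    have : (0 : ℝ) < 1 / ((k : ℝ) + 1) := by positivity
    linarith

theorem tendsto_regularSlowness (hW : IsSubquadraticDoubleWell W a b) {s : ℝ}
    (hs : s ∈ Icc a b) :
    Tendsto (fun k => regularSlowness W a b k s) atTop (𝓝 (1 / √(W s))) := by
  simp only [regularSlowness, min_eq_right hs.2, max_eq_right hs.1]
  rcases (hW.nonneg s).eq_or_lt with h | h
  · simp [← h]
  · have hlim : Tendsto (fun k : ℕ => W s + 1 / ((k : ℝ) + 1)) atTop (𝓝 (W s + 0)) :=
      tendsto_const_nhds.add tendsto_one_div_add_atTop_nhds_zero_nat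
    have := (tendsto_const_nhds (x := √(W s))).div hlim (by rw [add_zero]; exact h.ne')
    rwa [add_zero, Real.sqrt_div_self'] at this

theorem hasDerivAt_regularTravelTime (hW : IsSubquadraticDoubleWell W a b) (k : ℕ) (x : ℝ) :
    HasDerivAt (regularTravelTime W a b k) (regularSlowness W a b k x) x :=
  ((hW.continuous_regularSlowness k).integral_hasStrictDerivAt a x).hasDerivAt

theorem contDiff_regularTravelTime (hW : IsSubquadraticDoubleWell W a b) (k : ℕ) :
    ContDiff ℝ 1 (regularTravelTime W a b k) := by
  rw [contDiff_one_iff_deriv]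
  refine ⟨fun x => (hW.hasDerivAt_regularTravelTime k x).differentiableAt, ?_⟩
  rw [funext fun x => (hW.hasDerivAt_regularTravelTime k x).deriv]
  exact hW.continuous_regularSlowness k

/-- Left of `a` the clamped integrand vanishes. The sign is needed for every real `x`, because `C¹`
approximants of the data may leave `[a, b]` and their layers must still reach `b` by depth `εT`. -/
theorem regularTravelTime_nonneg (hW : IsSubquadraticDoubleWell W a b) (k : ℕ) (x : ℝ) :
    0 ≤ regularTravelTime W a b k x := by
  rcases le_total a x with h | h
  · exact intervalIntegral.integral_nonneg h fun s _ => hW.regularSlowness_nonneg k s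
  · refine ge_of_eq ((intervalIntegral.integral_congr (g := fun _ => 0) fun s hs => ?_).trans
      (by simp))
    rw [uIcc_of_ge h] at hs
    simp [regularSlowness, max_eq_left ((min_le_right b s).trans hs.2), hW.apply_left]

theorem tendsto_regularTravelTime (hW : IsSubquadraticDoubleWell W a b) {x : ℝ}
    (hx : x ∈ Icc a b) :
    Tendsto (fun k => regularTravelTime W a b k x) atTop (𝓝 (travelTime W a x)) := by
  have ha : a ∈ Icc a b := ⟨le_rfl, hW.lt.le⟩
  have hsub : uIoc a x ⊆ Icc a b := by
    rw [uIoc_of_le hx.1]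
    exact Ioc_subset_Icc_self.trans (Icc_subset_Icc_right hx.2)
  refine intervalIntegral.tendsto_integral_filter_of_dominated_convergence (fun s => 1 / √(W s))
    (Eventually.of_forall fun k => (hW.continuous_regularSlowness k).aestronglyMeasurable)
    (Eventually.of_forall fun k => Eventually.of_forall fun s hs => ?_)
    (hW.intervalIntegrable_of_mem ha hx)
    (Eventually.of_forall fun s hs => hW.tendsto_regularSlowness (hsub hs))
  rw [Real.norm_of_nonneg (hW.regularSlowness_nonneg k s)]
  exact hW.regularSlowness_le k (hsub hs)

end IsSubquadraticDoubleWell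

/-! ### The boundary layer -/

/-- The optimal profile started at `z.1`, at the scaled depth `z.2 / ε`. -/
def layer (W : ℝ → ℝ) (a b ε : ℝ) (z : ℝ × ℝ) : ℝ :=
  heteroclinic W a b (travelTime W a z.1 + z.2 / ε)

/-- A `C¹` approximation of the layer function. -/
def regularLayer (W : ℝ → ℝ) (a b ε : ℝ) (k : ℕ) (z : ℝ × ℝ) : ℝ :=
  heteroclinic W a b (regularTravelTime W a b k z.1 + z.2 / ε)

namespace IsSubquadraticDoubleWell

variable {W : ℝ → ℝ} {a b ε δ : ℝ}

theorem abs_le_of_mem_Icc {s : ℝ} (hs : s ∈ Icc a b) : |s| ≤ max |a| |b| :=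
  abs_le_max_abs_abs hs.1 hs.2

theorem hasFDerivAt_regularLayer (hW : IsSubquadraticDoubleWell W a b) (ε : ℝ) (k : ℕ)
    (z : ℝ × ℝ) : HasFDerivAt (regularLayer W a b ε k)
      (√(W (regularLayer W a b ε k z)) • (regularSlowness W a b k z.1 •
        ContinuousLinearMap.fst ℝ ℝ ℝ + ε⁻¹ • ContinuousLinearMap.snd ℝ ℝ ℝ)) z := by
  have h1 : HasFDerivAt (fun z : ℝ × ℝ => regularTravelTime W a b k z.1)
      (regularSlowness W a b k z.1 • ContinuousLinearMap.fst ℝ ℝ ℝ) z :=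
    (hW.hasDerivAt_regularTravelTime k z.1).comp_hasFDerivAt z hasFDerivAt_fst
  have h2 : HasFDerivAt (fun z : ℝ × ℝ => z.2 / ε) (ε⁻¹ • ContinuousLinearMap.snd ℝ ℝ ℝ) z := by
    simp only [div_eq_inv_mul]
    exact hasFDerivAt_snd.const_mul ε⁻¹
  exact (hW.hasDerivAt_heteroclinic _).comp_hasFDerivAt z (h1.add h2)

/-- The bound may blow up with `k`. This is harmless: `k` is fixed while the data pass from `C¹` to
`H¹`. -/
theorem exists_isCutoff_regularLayer (hW : IsSubquadraticDoubleWell W a b) (hε : 0 < ε)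
    (hεT : ε * travelTime W a b ≤ δ / 2) (k : ℕ) :
    ∃ K, Collar.IsCutoff δ b K (regularLayer W a b ε k) := by
  obtain ⟨M, hM0, hM⟩ := hW.exists_sqrt_le
  refine ⟨max |a| |b| + M * (M * (k + 1) + ε⁻¹), ?_, fun z => ?_, fun z => ?_, fun q t ht => ?_⟩
  · exact hW.contDiff_heteroclinic.comp
      (((hW.contDiff_regularTravelTime k).comp contDiff_fst).add (contDiff_snd.div_const ε))
  · refine (abs_le_of_mem_Icc (hW.heteroclinic_mem_Icc _)).trans (le_add_of_nonneg_right ?_)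
    positivity
  · rw [(hW.hasFDerivAt_regularLayer ε k z).fderiv, norm_smul,
      Real.norm_of_nonneg (Real.sqrt_nonneg _)]
    refine le_trans ?_ (le_add_of_nonneg_left (le_max_of_le_left (abs_nonneg a)))
    refine mul_le_mul (hM _ (hW.heteroclinic_mem_Icc _)) ?_ (norm_nonneg _) hM0.le
    refine (norm_add_le _ _).trans (add_le_add ?_ ?_)
    · rw [norm_smul, Real.norm_of_nonneg (hW.regularSlowness_nonneg _ _)]
      exact (mul_le_of_le_one_right (hW.regularSlowness_nonneg _ _)
        (ContinuousLinearMap.norm_fst_le _ _ _)).trans (hW.regularSlowness_le_bound hM k _)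
    · rw [norm_smul, Real.norm_of_nonneg (by positivity)]
      exact mul_le_of_le_one_right (by positivity) (ContinuousLinearMap.norm_snd_le _ _ _)
  · refine hW.heteroclinic_of_ge ?_
    have h1 : travelTime W a b ≤ t / ε := by rw [le_div_iff₀ hε, mul_comm]; linarith
    exact h1.trans (le_add_of_nonneg_left (hW.regularTravelTime_nonneg k q))

theorem tendsto_regularLayer (hW : IsSubquadraticDoubleWell W a b) (ε : ℝ) {z : ℝ × ℝ}
    (hz : z.1 ∈ Icc a b) :
    Tendsto (fun k => regularLayer W a b ε k z) atTop (𝓝 (layer W a b ε z)) :=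
  (hW.continuous_heteroclinic.tendsto _).comp ((hW.tendsto_regularTravelTime hz).add_const _)

end IsSubquadraticDoubleWell

namespace Collar

variable {n : ℕ} {Ω : Set (E n)} {δ : ℝ} {W : ℝ → ℝ} {a b ε : ℝ} {q : E n → ℝ} {G : E n → E n}

/-- The gradient of the boundary layer `C.extend b (layer W a b ε) q`. -/
def layerGrad (C : Collar Ω δ) (W : ℝ → ℝ) (a b ε : ℝ) (q : E n → ℝ) (G : E n → E n) :
    E n → E n :=
  C.inside.indicator fun x => √(W (layer W a b ε (q (C.foot x), C.depth x))) •
    (ContinuousLinearMap.adjoint (fderiv ℝ C.foot x)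
      ((1 / √(W (q (C.foot x)))) • G (C.foot x)) + ε⁻¹ • inwardNormal Ω (C.foot x))

variable {C : Collar Ω δ}

theorem extendGrad_regularLayer_of_mem (hW : IsSubquadraticDoubleWell W a b) (k : ℕ) {x : E n}
    (hx : x ∈ C.inside) : C.extendGrad (regularLayer W a b ε k) q G x =
      √(W (regularLayer W a b ε k (q (C.foot x), C.depth x))) •
        (ContinuousLinearMap.adjoint (fderiv ℝ C.foot x)
          (regularSlowness W a b k (q (C.foot x)) • G (C.foot x)) +
            ε⁻¹ • inwardNormal Ω (C.foot x)) := by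
  rw [extendGrad, indicator_of_mem hx, (hW.hasFDerivAt_regularLayer ε k _).fderiv, map_smul,
    smul_add, smul_smul, smul_smul]
  simp [smul_smul]

/-- Here the regularization is removed. The factor `√W(u)` and the normal term are bounded, and the
regularized slowness is below `1/√W(q)`, so that the gradients are dominated through `G/√W(q)`, in
`L²` by hypothesis. -/
theorem hasWeakGradient_layer (hΩ : IsC2Domain Ω) (hn : 1 ≤ n) (hC : C.IsThin)
    (hW : IsSubquadraticDoubleWell W a b) (hε : 0 < ε) (hεT : ε * travelTime W a b ≤ δ / 2)
    (hq : HasSurfaceGradient Ω q G) (hqI : ∀ᵐ y ∂surfaceMeasure Ω, q y ∈ Icc a b)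
    (hG : MemLp (fun y => (1 / √(W (q y))) • G y) 2 (surfaceMeasure Ω)) :
    HasWeakGradient Ω (C.extend b (layer W a b ε) q) (C.layerGrad W a b ε q G) := by
  have : IsFiniteMeasure (volume.restrict Ω) := ⟨by simpa using hΩ.volume_lt_top⟩
  obtain ⟨M, hM0, hM⟩ := hW.exists_sqrt_le
  choose K hK using hW.exists_isCutoff_regularLayer hε hεT
  set u : ℕ → E n → ℝ := fun k => C.extend b (regularLayer W a b ε k) q with hu
  set F : ℕ → E n → E n := fun k => C.extendGrad (regularLayer W a b ε k) q G with hF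
  set G' : E n → E n := fun y => (1 / √(W (q y))) • G y with hG'
  set B := C.inside.indicator fun x => M * (1 + ε⁻¹) * (4 * ‖G' (C.foot x)‖ + 1) with hB
  have hB2 : MemLp B 2 (volume.restrict Ω) := memLp_bound hΩ hn hC hG _
  have hB0 : ∀ x, 0 ≤ B x := fun x => indicator_nonneg (fun x _ => by positivity) x
  have hum : ∀ k, AEStronglyMeasurable (u k) (volume.restrict Ω) := fun k =>
    aestronglyMeasurable_extend hΩ hn hC (hK k).contDiff.continuous hq.1.1
  have hFm : ∀ k, AEStronglyMeasurable (F k) (volume.restrict Ω) := fun k =>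
    aestronglyMeasurable_extendGrad hΩ hn hC (hK k).contDiff hq.1.1 hq.2.1.1
  have hfoot := ae_comp_foot hΩ hn hC hqI
  have hub : ∀ k x, ‖u k x‖ ≤ max |a| |b| := fun k x => by
    by_cases hx : x ∈ C.inside
    · simp only [hu, extend_of_mem hx]
      exact IsSubquadraticDoubleWell.abs_le_of_mem_Icc (hW.heteroclinic_mem_Icc _)
    · simp only [hu, extend_of_notMem hx]
      exact le_max_right _ _
  have hFb : ∀ k, ∀ᵐ x ∂volume.restrict Ω, ‖F k x‖ ≤ B x := fun k => by
    filter_upwards [hfoot] with x hx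
    by_cases hxi : x ∈ C.inside
    · have hqx := hx hxi
      simp only [hF, hB, extendGrad_regularLayer_of_mem hW k hxi, indicator_of_mem hxi]
      rw [norm_smul, Real.norm_of_nonneg (Real.sqrt_nonneg _), mul_assoc]
      refine mul_le_mul (hM _ (hW.heteroclinic_mem_Icc _)) ?_ (norm_nonneg _) hM0.le
      have h1 : ‖ContinuousLinearMap.adjoint (fderiv ℝ C.foot x)
          (regularSlowness W a b k (q (C.foot x)) • G (C.foot x))‖ ≤ 4 * ‖G' (C.foot x)‖ := by
        refine (norm_adjoint_fderiv_foot_le hΩ hC hxi.1 _).trans ?_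
        simp only [hG']
        rw [norm_smul, norm_smul, Real.norm_of_nonneg (hW.regularSlowness_nonneg _ _),
          Real.norm_of_nonneg (by positivity)]
        gcongr
        exact hW.regularSlowness_le k hqx
      have h2 : ‖ε⁻¹ • inwardNormal Ω (C.foot x)‖ = ε⁻¹ := by
        rw [norm_smul, hΩ.norm_inwardNormal (C.isFootpoint x hxi.1).mem, mul_one,
          Real.norm_of_nonneg (by positivity)]
      refine (norm_add_le _ _).trans ?_
      rw [h2]
      have hε' : 0 < ε⁻¹ := inv_pos.2 hε
      nlinarith [norm_nonneg (G' (C.foot x)), mul_nonneg hε'.le (norm_nonneg (G' (C.foot x)))]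
    · simp only [hF, hB, extendGrad, indicator_of_notMem hxi, norm_zero, le_refl]
  have hut : ∀ᵐ x ∂volume.restrict Ω,
      Tendsto (fun k => u k x) atTop (𝓝 (C.extend b (layer W a b ε) q x)) := by
    filter_upwards [hfoot] with x hx
    by_cases hxi : x ∈ C.inside
    · simp only [hu, extend_of_mem hxi]
      exact hW.tendsto_regularLayer ε (hx hxi)
    · simp only [hu, extend_of_notMem hxi]
      exact tendsto_const_nhds
  have hFt : ∀ᵐ x ∂volume.restrict Ω,
      Tendsto (fun k => F k x) atTop (𝓝 (C.layerGrad W a b ε q G x)) := by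
    filter_upwards [hfoot] with x hx
    by_cases hxi : x ∈ C.inside
    · simp only [hF, extendGrad_regularLayer_of_mem hW _ hxi, layerGrad, indicator_of_mem hxi]
      have hw : Continuous fun s => √(W s) := hW.continuous.sqrt
      refine ((hw.tendsto _).comp (hW.tendsto_regularLayer ε (hx hxi))).smul (Tendsto.add_const _ ?_)
      exact ((ContinuousLinearMap.adjoint (fderiv ℝ C.foot x)).continuous.tendsto _).comp
        ((hW.tendsto_regularSlowness (hx hxi)).smul_const _)
    · simp only [hF, extendGrad, layerGrad, indicator_of_notMem hxi]
      exact tendsto_const_nhds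
  refine ⟨?_, ?_, ?_⟩
  · refine MemLp.of_bound (aestronglyMeasurable_of_tendsto_ae atTop hum hut) (max |a| |b|) ?_
    filter_upwards [hut] with x hx using le_of_tendsto' hx.norm fun k => hub k x
  · refine hB2.mono' (aestronglyMeasurable_of_tendsto_ae atTop hFm hFt) ?_
    filter_upwards [hFt, ae_all_iff.2 hFb] with x hx hb using le_of_tendsto' hx.norm hb
  · refine IsWeakGradient.of_dominated (g := fun x => max |a| |b| + B x)
      (fun k => isWeakGradient_extend hΩ hn hC (hK k) hq) hum hFm
      ((integrable_const _).add (hB2.integrable (by norm_num)))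
      (fun k => Eventually.of_forall fun x => (hub k x).trans (le_add_of_nonneg_right (hB0 x)))
      (fun k => ?_) hut hFt
    filter_upwards [hFb k] with x hx using
      hx.trans (le_add_of_nonneg_left (le_max_of_le_left (abs_nonneg a)))

end Collar

variable {n : ℕ} {Ω : Set (E n)} {δ : ℝ}

namespace Collar

variable {C : Collar Ω δ} {b K L : ℝ} {H : ℝ × ℝ → ℝ} {q u : E n → ℝ} {y : E n}

/-! ### Cutoff extensions of arbitrary boundary data -/

/-- Take `H(q, t) = b + η(t)χ(q)(q - b)` with bumps `η` and `χ`: `η` ends the layer at depth `δ/2`,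
and `χ` truncates large values to give global bounds. It serves the `ε` that are not small. -/
theorem exists_isCutoff (C : Collar Ω δ) (b R : ℝ) (hR : 0 < R) :
    ∃ K H, IsCutoff δ b K H ∧ ∀ q, |q| ≤ R → H (q, 0) = q := by
  have hδ := C.pos
  let η : ContDiffBump (0 : ℝ) := ⟨δ / 4, δ / 2, by linarith, by linarith⟩
  let χ : ContDiffBump (0 : ℝ) := ⟨R, R + 1, hR, by linarith⟩
  set F : ℝ × ℝ → ℝ := fun z => η z.2 * χ z.1 * (z.1 - b) with hF
  have hF1 : ContDiff ℝ 1 F :=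
    ((η.contDiff.comp contDiff_snd).mul (χ.contDiff.comp contDiff_fst)).mul
      (contDiff_fst.sub contDiff_const)
  have hη : ∀ t, δ / 2 ≤ |t| → η t = 0 := fun t ht =>
    η.zero_of_le_dist (by rw [Real.dist_eq, sub_zero]; exact ht)
  have hχ : ∀ t, R + 1 ≤ |t| → χ t = 0 := fun t ht =>
    χ.zero_of_le_dist (by rw [Real.dist_eq, sub_zero]; exact ht)
  have hFc : HasCompactSupport F := by
    refine HasCompactSupport.intro ((isCompact_Icc (a := -(R + 1)) (b := R + 1)).prod
      (isCompact_Icc (a := -(δ / 2)) (b := δ / 2))) fun z hz => ?_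
    simp only [mem_prod, mem_Icc, ← abs_le, not_and_or, not_le] at hz
    rcases hz with h | h
    · simp [hF, hχ _ h.le]
    · simp [hF, hη _ h.le]
  obtain ⟨K₁, h1⟩ := hF1.continuous.bounded_above_of_compact_support hFc
  obtain ⟨K₂, h2⟩ := (hF1.continuous_fderiv one_ne_zero).bounded_above_of_compact_support
    (hFc.fderiv (𝕜 := ℝ))
  have hK₁ : 0 ≤ K₁ := (norm_nonneg _).trans (h1 0)
  have hK₂ : 0 ≤ K₂ := (norm_nonneg _).trans (h2 0)
  refine ⟨|b| + K₁ + K₂, fun z => b + F z, ⟨contDiff_const.add hF1, fun z => ?_, fun z => ?_,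
    fun q t ht => ?_⟩, fun q hq => ?_⟩
  · have := abs_add_le b (F z)
    have := h1 z
    rw [Real.norm_eq_abs] at this
    linarith
  · rw [fderiv_const_add]
    have := h2 z
    have := abs_nonneg b
    linarith
  · simp [hF, hη t (ht.trans (le_abs_self t))]
  · have e1 : η 0 = 1 := η.one_of_mem_closedBall (by simp [η.rIn_pos.le])
    have e2 : χ q = 1 := χ.one_of_mem_closedBall (by simpa using hq)
    simp [hF, e1, e2]

theorem IsCutoff.abs_sub_le (hH : IsCutoff δ b K H) (q t : ℝ) :
    |H (q, t) - H (q, 0)| ≤ K * |t| := by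
  have h := Convex.norm_image_sub_le_of_norm_fderiv_le (𝕜 := ℝ) (f := H) (s := univ)
    (x := (q, 0)) (y := (q, t)) (fun x _ => hH.contDiff.differentiable one_ne_zero x)
    (fun x _ => hH.norm_fderiv_le x) convex_univ (mem_univ _) (mem_univ _)
  simpa [Prod.norm_def] using h

/-! ### Traces -/

theorem mul_surfaceMeasure_le (hΩ : IsC2Domain Ω) (hn : 1 ≤ n) (hC : C.IsThin) {A : Set (E n)}
    (hA : MeasurableSet A) {ρ : ℝ} (hρδ : ρ ≤ δ) :
    ENNReal.ofReal (1 / 2) * ENNReal.ofReal ρ * surfaceMeasure Ω A ≤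
      volume (C.inside ∩ (C.foot ⁻¹' A ∩ C.depth ⁻¹' Iio ρ)) := by
  set S : Set (E n × ℝ) := A ×ˢ Iio ρ with hS
  have hSm : MeasurableSet S := hA.prod measurableSet_Iio
  have hpre : MeasurableSet (C.foot ⁻¹' A ∩ C.depth ⁻¹' Iio ρ) :=
    (C.measurable_foot hA).inter (C.measurable_depth measurableSet_Iio)
  have h1 : volume (C.inside ∩ (C.foot ⁻¹' A ∩ C.depth ⁻¹' Iio ρ)) =
      ∫⁻ x in C.inside, S.indicator 1 (C.foot x, C.depth x) := by
    rw [inter_comm, ← Measure.restrict_apply hpre, ← lintegral_indicator_one hpre]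
    rfl
  rw [h1, lintegral_inside hΩ hn hC (h := S.indicator 1)
    (measurable_one.indicator hSm).aemeasurable, ← lintegral_indicator_const hA]
  refine lintegral_mono_ae ?_
  filter_upwards [IsC2Domain.ae_mem_frontier Ω] with y hy
  by_cases hyA : y ∈ A
  · rw [indicator_of_mem hyA]
    calc ENNReal.ofReal (1 / 2) * ENNReal.ofReal ρ
        = ∫⁻ t in Ioo 0 ρ, ENNReal.ofReal (1 / 2) := by
          rw [setLIntegral_const, Real.volume_Ioo, sub_zero]
      _ ≤ ∫⁻ t in Ioo 0 ρ, S.indicator 1 (y, t) * ENNReal.ofReal (C.jacobian (y, t)) := by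
          refine setLIntegral_mono' measurableSet_Ioo fun t ht => ?_
          rw [indicator_of_mem (show (y, t) ∈ S from ⟨hyA, ht.2⟩), Pi.one_apply, one_mul]
          exact ENNReal.ofReal_le_ofReal
            (hC.jacobian_mem hy (by rw [abs_of_pos ht.1]; exact ht.2.trans_le hρδ)).1
      _ ≤ _ := lintegral_mono_set (Ioo_subset_Ioo_right hρδ)
  · rw [indicator_of_notMem hyA]
    exact zero_le

/-- Points with foot within `ρ` of `y` and depth below `ρ` lie within `2ρ` of `y`; their volume
bounds the area from above. -/
theorem mul_surfaceMeasure_closedBall_le (hΩ : IsC2Domain Ω) (hn : 1 ≤ n) (hC : C.IsThin)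
    (y : E n) {ρ : ℝ} (hρ : 0 < ρ) (hρδ : ρ ≤ δ) :
    ENNReal.ofReal ρ * surfaceMeasure Ω (Metric.closedBall y ρ) ≤
      2 * volume (Metric.ball y (3 * ρ)) := by
  have h1 := mul_surfaceMeasure_le hΩ hn hC
    (Metric.isClosed_closedBall (x := y) (ε := ρ)).measurableSet hρδ
  have h2 : C.inside ∩ (C.foot ⁻¹' Metric.closedBall y ρ ∩ C.depth ⁻¹' Iio ρ) ⊆
      Metric.ball y (3 * ρ) := by
    rintro x ⟨hx, hx1, hx2⟩
    rw [mem_preimage, mem_closedBall_iff_norm] at hx1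
    rw [mem_preimage, mem_Iio] at hx2
    have hf := C.isFootpoint x hx.1
    have e : x - y = (C.foot x - y) + C.depth x • inwardNormal Ω (C.foot x) := by
      conv_lhs => rw [← hf.add_eq]
      abel
    rw [mem_ball_iff_norm, e]
    refine (norm_add_le _ _).trans_lt ?_
    rw [norm_smul, hΩ.norm_inwardNormal hf.mem, Real.norm_of_nonneg hx.2.le, mul_one]
    linarith
  have h2' : (2 : ℝ≥0∞) * ENNReal.ofReal (1 / 2) = 1 := by
    rw [← ENNReal.ofReal_ofNat 2, ← ENNReal.ofReal_mul (by norm_num)]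
    norm_num
  calc ENNReal.ofReal ρ * surfaceMeasure Ω (Metric.closedBall y ρ)
      = 2 * (ENNReal.ofReal (1 / 2) * ENNReal.ofReal ρ *
          surfaceMeasure Ω (Metric.closedBall y ρ)) := by
        rw [← mul_assoc, ← mul_assoc, h2', one_mul]
    _ ≤ _ := mul_le_mul_right (h1.trans (measure_mono h2)) 2

theorem exists_foot_depth_le (C : Collar Ω δ) (hy : y ∈ frontier Ω) :
    ∃ A : ℝ, 1 ≤ A ∧ ∀ᶠ x in 𝓝 y,
      x ∈ C.carrier ∧ ‖C.foot x - y‖ ≤ A * ‖x - y‖ ∧ |C.depth x| ≤ A * ‖x - y‖ := by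
  have hyC := C.frontier_subset hy
  obtain ⟨A₁, h1⟩ := (C.hasFDerivAt_foot hyC).isBigO_sub.bound
  obtain ⟨A₂, h2⟩ := (C.hasFDerivAt_depth hyC).isBigO_sub.bound
  refine ⟨max 1 (max A₁ A₂), le_max_left _ _, ?_⟩
  filter_upwards [h1, h2, C.isOpen.mem_nhds hyC] with x hx1 hx2 hx
  rw [C.foot_of_mem hy] at hx1
  rw [C.depth_of_mem hy, sub_zero, Real.norm_eq_abs] at hx2
  refine ⟨hx, hx1.trans ?_, hx2.trans ?_⟩
  · gcongr; exact (le_max_left _ _).trans (le_max_right _ _)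
  · gcongr; exact (le_max_right _ _).trans (le_max_right _ _)

/-- An interior ball bounds the volume of `Ω ∩ B_r(y)` below by a fixed part of `B_r(y)`. On it `⟨ν,
x - y⟩ ≥ r/4`, and the error of the linearized depth is at most `3r/16`. -/
theorem eventually_ball_subset (C : Collar Ω δ) (hΩ : IsC2Domain Ω) (hy : y ∈ frontier Ω) :
    ∀ᶠ r in 𝓝[>] (0 : ℝ), Metric.ball (y + (r / 2) • inwardNormal Ω y) (r / 4) ⊆
      Ω ∩ Metric.ball y r := by
  have hyC := C.frontier_subset hy
  have h1 := (C.hasFDerivAt_depth hyC).isLittleO.def (c := 1 / 4) (by norm_num)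
  obtain ⟨ρ, hρ, h⟩ := Metric.eventually_nhds_iff.1 (h1.and (C.isOpen.mem_nhds hyC))
  filter_upwards [Ioo_mem_nhdsGT hρ] with r hr x hx
  rw [mem_ball_iff_norm] at hx
  have hν := hΩ.norm_inwardNormal hy
  have hxy : ‖x - y‖ ≤ 3 * r / 4 := by
    have e : x - y = (x - (y + (r / 2) • inwardNormal Ω y)) + (r / 2) • inwardNormal Ω y := by abel
    rw [e]
    refine (norm_add_le _ _).trans ?_
    rw [norm_smul, hν, Real.norm_of_nonneg (by linarith [hr.1])]
    linarith
  have hr0 := hr.1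
  obtain ⟨hd, hxC⟩ := h (y := x) (by rw [dist_eq_norm]; linarith [hr.2])
  refine ⟨((C.isFootpoint x hxC).mem_iff).2 ?_, by rw [mem_ball_iff_norm]; linarith⟩
  rw [C.depth_of_mem hy, sub_zero, C.fderiv_depth hΩ hyC, C.foot_of_mem hy, Real.norm_eq_abs] at hd
  have hin : r / 4 ≤ inner ℝ (inwardNormal Ω y) (x - y) := by
    have e : x - y = (x - (y + (r / 2) • inwardNormal Ω y)) + (r / 2) • inwardNormal Ω y := by abel
    rw [e, inner_add_right, inner_smul_right, real_inner_self_eq_norm_sq, hν]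
    have := abs_le.1 (abs_real_inner_le_norm (inwardNormal Ω y)
      (x - (y + (r / 2) • inwardNormal Ω y)))
    rw [hν, one_mul] at this
    linarith [this.1]
  linarith [(abs_le.1 hd).1]

/-- Compare `u` with `q ∘ foot`, then `q ∘ foot` with `q(y)`. The first difference is `O(r)`. In
normal coordinates the second becomes `ρ` times an integral over a boundary ball, and `ρ` times the
area of that ball is comparable to the volume of `Ω ∩ B_r(y)`; thus the mean oscillation of `q` at
`y` controls it. -/
theorem hasTraceAt_of_le (hΩ : IsC2Domain Ω) (hn : 1 ≤ n) (hC : C.IsThin) (hL : 0 ≤ L)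
    (hqm : AEStronglyMeasurable q (surfaceMeasure Ω))
    (hu : ∀ᵐ x ∂volume.restrict Ω, x ∈ C.inside → ‖u x - q (C.foot x)‖ ≤ L * C.depth x)
    (hy : y ∈ frontier Ω)
    (hq : Tendsto (fun r : ℝ => (∫⁻ z in Metric.closedBall y r, ‖q z - q y‖ₑ ∂surfaceMeasure Ω) /
      surfaceMeasure Ω (Metric.closedBall y r)) (𝓝[>] 0) (𝓝 0)) :
    HasTraceAt Ω u y (q y) := by
  have hσ := hC.isFiniteMeasure hΩ hn
  obtain ⟨A, hA1, hA⟩ := C.exists_foot_depth_le hy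
  have hA0 : 0 < A := one_pos.trans_le hA1
  obtain ⟨r₀, hr₀, hA⟩ := Metric.eventually_nhds_iff.1 hA
  set Q : ℝ → ℝ≥0∞ := fun r => (∫⁻ z in Metric.closedBall y r, ‖q z - q y‖ₑ ∂surfaceMeasure Ω) /
      surfaceMeasure Ω (Metric.closedBall y r) with hQ
  set d := Module.finrank ℝ (E n)
  -- The `4` collects the Jacobian bounds, `(3A)^d` the passage from radius `3Ar` to `r`, and `4^d`
  -- that from the interior ball to `B_r(y)`.
  set c : ℝ≥0∞ := 4 * ENNReal.ofReal ((3 * A) ^ d) * ENNReal.ofReal (4 ^ d) with hc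
  have hct : c ≠ ⊤ := by
    rw [hc]
    exact ENNReal.mul_ne_top (ENNReal.mul_ne_top (by norm_num) ENNReal.ofReal_ne_top)
      ENNReal.ofReal_ne_top
  have hscale : Tendsto (fun r : ℝ => A * r) (𝓝[>] 0) (𝓝[>] 0) := by
    refine tendsto_nhdsWithin_iff.2 ⟨?_, ?_⟩
    · have : Tendsto (fun r : ℝ => A * r) (𝓝 0) (𝓝 (A * 0)) := tendsto_id.const_mul A
      rw [mul_zero] at this
      exact this.mono_left nhdsWithin_le_nhds
    · filter_upwards [self_mem_nhdsWithin] with r hr using mul_pos hA0 hr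
  have hlim : Tendsto (fun r => ENNReal.ofReal (L * (A * r)) + c * Q (A * r)) (𝓝[>] 0) (𝓝 0) := by
    have h1 : Tendsto (fun r => ENNReal.ofReal (L * (A * r))) (𝓝[>] 0) (𝓝 0) := by
      have := ENNReal.tendsto_ofReal ((hscale.mono_right nhdsWithin_le_nhds).const_mul L)
      simpa using this
    have h2 := ENNReal.Tendsto.const_mul (hq.comp hscale) (Or.inr hct)
    simpa using h1.add h2
  refine tendsto_of_tendsto_of_tendsto_of_le_of_le' tendsto_const_nhds hlim
    (Eventually.of_forall fun _ => zero_le) ?_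
  filter_upwards [C.eventually_ball_subset hΩ hy, Ioo_mem_nhdsGT hr₀,
    hscale (Ioo_mem_nhdsGT C.pos)] with r hball hr hρ
  have hr0 : 0 < r := hr.1
  set ρ := A * r with hρdef
  set D := Ω ∩ Metric.ball y r with hD
  set cB := Metric.closedBall y ρ with hcB
  have hcBm : MeasurableSet cB := Metric.isClosed_closedBall.measurableSet
  have hDm : MeasurableSet D := hΩ.isOpen.measurableSet.inter Metric.isOpen_ball.measurableSet
  have hV : volume (Metric.ball y r) ≤ ENNReal.ofReal (4 ^ d) * volume D := by
    have e := Measure.addHaar_ball_mul_of_pos (volume : Measure (E n)) y (r := 4) (by norm_num)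
      (r / 4)
    rw [show 4 * (r / 4) = r by ring] at e
    rw [e, ← Measure.addHaar_ball_center volume (y + (r / 2) • inwardNormal Ω y)]
    gcongr
  have hsub : D ⊆ C.inside ∩ (C.foot ⁻¹' cB ∩ C.depth ⁻¹' Iio ρ) := fun x hx => by
    have hxr : ‖x - y‖ < r := mem_ball_iff_norm.1 hx.2
    obtain ⟨hxC, h1, h2⟩ := hA (y := x) (by rw [dist_eq_norm]; exact hxr.trans hr.2)
    have h3 : A * ‖x - y‖ < ρ := mul_lt_mul_of_pos_left hxr hA0
    refine ⟨⟨hxC, ((C.isFootpoint x hxC).mem_iff).1 hx.1⟩, ?_, ?_⟩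
    · rw [mem_preimage, hcB, mem_closedBall_iff_norm]
      exact h1.trans h3.le
    · exact (le_abs_self _).trans_lt (h2.trans_lt h3)
  have hσle : ENNReal.ofReal ρ * surfaceMeasure Ω cB ≤
      2 * (ENNReal.ofReal ((3 * A) ^ d) * volume (Metric.ball y r)) := by
    have e := Measure.addHaar_ball_mul_of_pos (volume : Measure (E n)) y (r := 3 * A)
      (by positivity) r
    rw [← Measure.addHaar_ball_center volume y, mul_assoc] at e
    rw [← e]
    exact mul_surfaceMeasure_closedBall_le hΩ hn hC y hρ.1 hρ.2.le
  have hQmul : ∫⁻ z in cB, ‖q z - q y‖ₑ ∂surfaceMeasure Ω ≤ Q ρ * surfaceMeasure Ω cB := by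
    by_cases h0 : surfaceMeasure Ω cB = 0
    · rw [Measure.restrict_eq_zero.2 h0]
      simp
    · rw [hQ, ENNReal.div_mul_cancel h0 (measure_ne_top _ _)]
  have hmain : ∫⁻ x in D, ‖u x - q y‖ₑ ≤
      (ENNReal.ofReal (L * ρ) + c * Q ρ) * volume D := by
    have hsplit : ∫⁻ x in D, ‖u x - q y‖ₑ ≤
        ∫⁻ x in D, (ENNReal.ofReal (L * ρ) + ‖q (C.foot x) - q y‖ₑ) := by
      refine lintegral_mono_ae ?_
      have hu' := ae_restrict_of_ae_restrict_of_subset (inter_subset_left : D ⊆ Ω) hu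
      filter_upwards [hu', ae_restrict_mem hDm] with x hx hxD
      have hxi := hsub hxD
      have e : u x - q y = (u x - q (C.foot x)) + (q (C.foot x) - q y) := by ring
      rw [e]
      refine (enorm_add_le _ _).trans (add_le_add ?_ le_rfl)
      rw [← ofReal_norm]
      refine ENNReal.ofReal_le_ofReal ((hx hxi.1).trans ?_)
      have : C.depth x < ρ := hxi.2.2
      gcongr
    have hdist : ∫⁻ x in D, ‖q (C.foot x) - q y‖ₑ ≤
        2 * ENNReal.ofReal ρ * ∫⁻ z in cB, ‖q z - q y‖ₑ ∂surfaceMeasure Ω := by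
      have hm : AEMeasurable (cB.indicator fun z => ‖q z - q y‖ₑ) (surfaceMeasure Ω) :=
        (hqm.sub aestronglyMeasurable_const).enorm.indicator hcBm
      calc ∫⁻ x in D, ‖q (C.foot x) - q y‖ₑ
          = ∫⁻ x in D, cB.indicator (fun z => ‖q z - q y‖ₑ) (C.foot x) := by
            refine setLIntegral_congr_fun hDm fun x hx => ?_
            rw [indicator_of_mem (show C.foot x ∈ cB from (hsub hx).2.1)]
        _ ≤ ∫⁻ x in C.inside ∩ C.depth ⁻¹' Iio ρ,
              cB.indicator (fun z => ‖q z - q y‖ₑ) (C.foot x) :=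
            lintegral_mono_set fun x hx => ⟨(hsub hx).1, (hsub hx).2.2⟩
        _ ≤ 2 * volume (Iio ρ ∩ Ioo 0 δ) *
              ∫⁻ z, cB.indicator (fun z => ‖q z - q y‖ₑ) z ∂surfaceMeasure Ω :=
            lintegral_inside_le hΩ hn hC hm measurableSet_Iio
        _ ≤ _ := by
            rw [lintegral_indicator hcBm]
            gcongr
            refine (measure_mono (t := Ioo 0 ρ) fun t ht => ⟨ht.2.1, ht.1⟩).trans_eq ?_
            rw [Real.volume_Ioo, sub_zero]
    refine hsplit.trans ?_
    rw [lintegral_add_left measurable_const, setLIntegral_const, add_mul]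
    gcongr
    calc ∫⁻ x in D, ‖q (C.foot x) - q y‖ₑ
        ≤ 2 * ENNReal.ofReal ρ * (Q ρ * surfaceMeasure Ω cB) := hdist.trans (by gcongr)
      _ = 2 * Q ρ * (ENNReal.ofReal ρ * surfaceMeasure Ω cB) := by ring
      _ ≤ 2 * Q ρ * (2 * (ENNReal.ofReal ((3 * A) ^ d) *
            (ENNReal.ofReal (4 ^ d) * volume D))) := by
          exact mul_le_mul' le_rfl (hσle.trans (mul_le_mul' le_rfl (mul_le_mul' le_rfl hV)))
      _ = c * Q ρ * volume D := by rw [hc]; ring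
  rw [laverage_eq, Measure.restrict_apply_univ]
  exact ENNReal.div_le_of_le_mul hmain

theorem hasTrace_of_le (hΩ : IsC2Domain Ω) (hn : 1 ≤ n) (hC : C.IsThin) (hL : 0 ≤ L)
    (hq : MemLp q 2 (surfaceMeasure Ω))
    (hu : ∀ᵐ x ∂volume.restrict Ω, x ∈ C.inside → ‖u x - q (C.foot x)‖ ≤ L * C.depth x) :
    HasTrace Ω u q := by
  have hσ := hC.isFiniteMeasure hΩ hn
  filter_upwards [IsC2Domain.ae_mem_frontier Ω,
    -- Besicovitch's differentiation theorem needs no doubling property of the surface measure.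
    (Besicovitch.vitaliFamily (surfaceMeasure Ω)).ae_tendsto_lintegral_enorm_sub_div_of_integrable
      (hq.integrable (by norm_num))] with y hy h
  exact hasTraceAt_of_le hΩ hn hC hL hq.1 hu hy (h.comp (Besicovitch.tendsto_filterAt _ y))

end Collar

/-! ### The energy of the layer -/

namespace IsSubquadraticDoubleWell

variable {W : ℝ → ℝ} {a b : ℝ} {X : Type*} [MeasurableSpace X] {μ : Measure X} {q : X → ℝ}

/-- The data lie in `[a, b]` only almost everywhere, and the travel time and the moment are known to
be continuous only there; clamping supplies a globally continuous substitute. -/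
theorem continuous_comp_clamp (hW : IsSubquadraticDoubleWell W a b) {f : ℝ → ℝ}
    (hf : ContinuousOn f (Icc a b)) : Continuous fun s => f (max a (min b s)) :=
  hf.comp_continuous (continuous_const.max (continuous_const.min continuous_id)) hW.clamp_mem_Icc

theorem clamp_eq {s : ℝ} (hs : s ∈ Icc a b) : max a (min b s) = s := by
  rw [min_eq_right hs.2, max_eq_right hs.1]

theorem aestronglyMeasurable_comp (hW : IsSubquadraticDoubleWell W a b) {f : ℝ → ℝ}
    (hf : ContinuousOn f (Icc a b)) (hq : AEStronglyMeasurable q μ)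
    (hqI : ∀ᵐ y ∂μ, q y ∈ Icc a b) : AEStronglyMeasurable (fun y => f (q y)) μ := by
  refine ((hW.continuous_comp_clamp hf).comp_aestronglyMeasurable hq).congr ?_
  filter_upwards [hqI] with y hy
  rw [clamp_eq hy]

/-- The energy of the layer over a normal segment, with a first-order Jacobian. -/
theorem integral_layer (hW : IsSubquadraticDoubleWell W a b) {ε : ℝ} (hε : 0 < ε) {α : ℝ}
    (hα : α ∈ Icc a b) (c : ℝ) :
    ∫ t in (0 : ℝ)..ε * travelTime W a b, 2 * W (layer W a b ε (α, t)) / ε ^ 2 * (1 + c * t) =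
      1 / ε * geodesicDist W α b + c * profileMoment W b α := by
  set r := travelTime W a α with hr
  have hr0 : 0 ≤ r := (hW.travelTime_mem_Icc hα).1
  set T := travelTime W a b
  have hc : Continuous fun s => 2 * W (heteroclinic W a b (r + s)) :=
    (hW.continuous.comp (hW.continuous_heteroclinic.comp (continuous_const_add r))).const_mul 2
  -- The substitution `s = t/ε` gives the zeroth moment the weight `1/ε` and the first moment the
  -- weight `c`.
  have e : ∀ t, 2 * W (layer W a b ε (α, t)) / ε ^ 2 * (1 + c * t) =
      (fun s => 1 / ε ^ 2 * (2 * W (heteroclinic W a b (r + s))) +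
        c / ε * (2 * W (heteroclinic W a b (r + s)) * s)) (t / ε) := fun t => by
    simp only [layer, ← hr]
    field_simp
  have hc2 : Continuous fun s => 2 * W (heteroclinic W a b (r + s)) * s := hc.mul continuous_id
  simp_rw [e]
  rw [intervalIntegral.integral_comp_div (f := fun s =>
      1 / ε ^ 2 * (2 * W (heteroclinic W a b (r + s))) +
        c / ε * (2 * W (heteroclinic W a b (r + s)) * s)) hε.ne', zero_div,
    mul_div_cancel_left₀ _ hε.ne',
    intervalIntegral.integral_add ((hc.const_mul _).intervalIntegrable _ _)
      ((hc2.const_mul _).intervalIntegrable _ _),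
    intervalIntegral.integral_const_mul (1 / ε ^ 2), intervalIntegral.integral_const_mul (c / ε),
    hW.integral_two_mul_heteroclinic (by linarith),
    hW.integral_two_mul_heteroclinic_mul (by linarith), hW.heteroclinic_travelTime hα,
    hW.profileMoment_eq hα le_rfl, smul_eq_mul]
  field_simp
  rfl

end IsSubquadraticDoubleWell

namespace Collar

variable {n : ℕ} {Ω : Set (E n)} {δ : ℝ} {C : Collar Ω δ} {W : ℝ → ℝ} {a b ε : ℝ} {q : E n → ℝ}
  {G : E n → E n} {x : E n}

theorem continuousOn_meanCurvature (C : Collar Ω δ) (hΩ : IsC2Domain Ω) :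
    ContinuousOn (meanCurvature Ω) (frontier Ω) := by
  have h : ContinuousOn (fun y => -∑ i, C.normalDeriv y (EuclideanSpace.single i 1) i)
      (frontier Ω) := by
    refine (continuousOn_finsetSum _ fun i _ => ?_).neg
    have h1 : ContinuousOn C.normalDeriv (frontier Ω) := fun y hy =>
      (C.continuousAt_normalDeriv (C.frontier_subset hy)).continuousWithinAt
    exact (EuclideanSpace.proj (𝕜 := ℝ) i).continuous.comp_continuousOn
      (h1.clm_apply continuousOn_const)
  refine h.congr fun y hy => ?_
  beta_reduce
  rw [sum_normalDeriv hΩ hy, neg_neg]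

/-- The image `v` of the normal satisfies `v = -t Dν v`, and `‖t Dν‖ ≤ 1/2` in a thin collar, whence
`v = 0`. This is the source of the orthogonal splitting of the layer gradient. -/
theorem fderiv_foot_normal (hΩ : IsC2Domain Ω) (hC : C.IsThin) (hx : x ∈ C.carrier) :
    fderiv ℝ C.foot x (inwardNormal Ω (C.foot x)) = 0 := by
  have hmem := (C.isFootpoint x hx).mem
  set v := fderiv ℝ C.foot x (inwardNormal Ω (C.foot x)) with hv
  have h1 : v + C.depth x • C.normalDeriv (C.foot x) v = 0 := by
    rw [hv, fderiv_foot_add hΩ hx, real_inner_self_eq_norm_sq, hΩ.norm_inwardNormal hmem]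
    simp
  have h2 : ‖v‖ ≤ 1 / 2 * ‖v‖ := by
    conv_lhs => rw [eq_neg_of_add_eq_zero_left h1, norm_neg, norm_smul, Real.norm_eq_abs]
    calc _ ≤ δ * (‖C.normalDeriv (C.foot x)‖ * ‖v‖) :=
          mul_le_mul (C.abs_depth_lt x hx).le (ContinuousLinearMap.le_opNorm _ _)
            (norm_nonneg _) C.pos.le
      _ = δ * ‖C.normalDeriv (C.foot x)‖ * ‖v‖ := by ring
      _ ≤ _ := mul_le_mul_of_nonneg_right (hC.mul_norm_le _ hmem) (norm_nonneg _)
  exact norm_le_zero_iff.1 (by linarith)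

theorem layer_eq_of_le (hW : IsSubquadraticDoubleWell W a b) (hε : 0 < ε) {α t : ℝ}
    (hα : α ∈ Icc a b) (ht : ε * travelTime W a b ≤ t) : layer W a b ε (α, t) = b := by
  refine hW.heteroclinic_of_ge ?_
  have h1 : travelTime W a b ≤ t / ε := by rw [le_div_iff₀ hε, mul_comm]; exact ht
  exact h1.trans (le_add_of_nonneg_left (hW.travelTime_mem_Icc hα).1)

/-- Pythagoras: the normal part of the gradient contributes `W(u)/ε²`, the same as the potential.
The tangential part has `4²` from the adjoint of the foot derivative and `M²` from `W(u)`, and it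
vanishes at depth `εT` and beyond, where `u = b`. -/
theorem norm_layerGrad_sq_le (hΩ : IsC2Domain Ω) (hC : C.IsThin)
    (hW : IsSubquadraticDoubleWell W a b) (hε : 0 < ε) {M : ℝ}
    (hM : ∀ s ∈ Icc a b, √(W s) ≤ M) (hx : x ∈ C.inside) (hqx : q (C.foot x) ∈ Icc a b) :
    W (C.extend b (layer W a b ε) q x) / ε ^ 2 + ‖C.layerGrad W a b ε q G x‖ ^ 2 ≤
      2 * W (layer W a b ε (q (C.foot x), C.depth x)) / ε ^ 2 +
        (Iio (ε * travelTime W a b)).indicator (fun _ =>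
          16 * M ^ 2 * (‖G (C.foot x)‖ ^ 2 / W (q (C.foot x)))) (C.depth x) := by
  rw [extend_of_mem hx, layerGrad, indicator_of_mem hx, norm_smul, mul_pow,
    Real.norm_of_nonneg (Real.sqrt_nonneg _), Real.sq_sqrt (hW.nonneg _)]
  set w := layer W a b ε (q (C.foot x), C.depth x) with hw
  set v := ContinuousLinearMap.adjoint (fderiv ℝ C.foot x)
    ((1 / √(W (q (C.foot x)))) • G (C.foot x)) with hv
  have horth : inner ℝ v (ε⁻¹ • inwardNormal Ω (C.foot x)) = 0 := by
    rw [hv, inner_smul_right, ContinuousLinearMap.adjoint_inner_left,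
      fderiv_foot_normal hΩ hC hx.1, inner_zero_right, mul_zero]
  have hsq : ‖v + ε⁻¹ • inwardNormal Ω (C.foot x)‖ ^ 2 = ‖v‖ ^ 2 + 1 / ε ^ 2 := by
    rw [norm_add_sq_real, horth, norm_smul,
      hΩ.norm_inwardNormal (C.isFootpoint x hx.1).mem, Real.norm_of_nonneg (by positivity)]
    ring
  have hv2 : ‖v‖ ^ 2 ≤ 16 * (‖G (C.foot x)‖ ^ 2 / W (q (C.foot x))) := by
    have h1 : ‖v‖ ≤ 4 * (1 / √(W (q (C.foot x))) * ‖G (C.foot x)‖) := by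
      refine (norm_adjoint_fderiv_foot_le hΩ hC hx.1 _).trans ?_
      rw [norm_smul, Real.norm_of_nonneg (by positivity)]
    refine (pow_le_pow_left₀ (norm_nonneg _) h1 2).trans (le_of_eq ?_)
    rw [mul_pow, mul_pow, div_pow, Real.sq_sqrt (hW.nonneg _)]
    ring
  have hG0 : 0 ≤ ‖G (C.foot x)‖ ^ 2 / W (q (C.foot x)) := div_nonneg (sq_nonneg _) (hW.nonneg _)
  have hWM : W w * ‖v‖ ^ 2 ≤ (Iio (ε * travelTime W a b)).indicator (fun _ =>
      16 * M ^ 2 * (‖G (C.foot x)‖ ^ 2 / W (q (C.foot x)))) (C.depth x) := by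
    by_cases hd : C.depth x ∈ Iio (ε * travelTime W a b)
    · rw [indicator_of_mem hd]
      have hWw : W w ≤ M ^ 2 := by
        rw [← Real.sq_sqrt (hW.nonneg w)]
        exact pow_le_pow_left₀ (Real.sqrt_nonneg _) (hM _ (hW.heteroclinic_mem_Icc _)) 2
      refine (mul_le_mul hWw hv2 (sq_nonneg _) (sq_nonneg _)).trans (le_of_eq ?_)
      ring
    · rw [indicator_of_notMem hd, hw, layer_eq_of_le hW hε hqx (not_lt.1 hd), hW.apply_right,
        zero_mul]
  rw [hsq]
  have : W w / ε ^ 2 + W w * (‖v‖ ^ 2 + 1 / ε ^ 2) = 2 * W w / ε ^ 2 + W w * ‖v‖ ^ 2 := by ring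
  rw [this]
  linarith

/-- The energy of the layer over a single normal segment. -/
theorem lintegral_layer_le (hC : C.IsThin) (hW : IsSubquadraticDoubleWell W a b) (hε : 0 < ε)
    (hεδ : ε * travelTime W a b ≤ δ) {y : E n} (hy : y ∈ frontier Ω) {α c : ℝ}
    (hα : α ∈ Icc a b)
    (hJ : ∀ t ∈ Ioo 0 (ε * travelTime W a b), C.jacobian (y, t) ≤ 1 + c * t) :
    0 ≤ 1 / ε * geodesicDist W α b + c * profileMoment W b α ∧
    ∫⁻ t in Ioo 0 δ, ENNReal.ofReal (2 * W (layer W a b ε (α, t)) / ε ^ 2) *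
        ENNReal.ofReal (C.jacobian (y, t)) ≤
      ENNReal.ofReal (1 / ε * geodesicDist W α b + c * profileMoment W b α) := by
  set S := ε * travelTime W a b with hS
  have hS0 : 0 < S := mul_pos hε hW.travelTime_pos
  set f : ℝ → ℝ := fun t => 2 * W (layer W a b ε (α, t)) / ε ^ 2 * (1 + c * t) with hf
  have hfc : Continuous f := by
    have h1 : Continuous fun t => layer W a b ε (α, t) :=
      hW.continuous_heteroclinic.comp ((continuous_id.div_const ε).const_add (travelTime W a α))
    exact (((hW.continuous.comp h1).const_mul 2).div_const _).mul
      (continuous_const.add (continuous_const.mul continuous_id))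
  have hf0 : ∀ t ∈ Ioo 0 S, 0 ≤ f t := fun t ht => by
    have h1 := (hC.jacobian_mem hy (t := t) (by rw [abs_of_pos ht.1]; exact ht.2.trans_le hεδ)).1
    have h2 := hJ t ht
    have h3 := hW.nonneg (layer W a b ε (α, t))
    have : 0 ≤ 1 + c * t := by linarith
    positivity
  have hfi : ∫ t in Ioo 0 S, f t = 1 / ε * geodesicDist W α b + c * profileMoment W b α := by
    rw [← integral_Ioc_eq_integral_Ioo, ← intervalIntegral.integral_of_le hS0.le]
    exact hW.integral_layer hε hα c
  have hf0' : 0 ≤ᵐ[volume.restrict (Ioo 0 S)] f := by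
    filter_upwards [ae_restrict_mem measurableSet_Ioo] with t ht using hf0 t ht
  refine ⟨hfi ▸ integral_nonneg_of_ae hf0', ?_⟩
  rw [← hfi, ofReal_integral_eq_lintegral_ofReal
    ((hfc.integrableOn_Icc (a := 0) (b := S)).mono_set Ioo_subset_Icc_self) hf0']
  rw [← lintegral_indicator measurableSet_Ioo fun t => ENNReal.ofReal (f t)]
  refine le_trans (setLIntegral_mono' measurableSet_Ioo fun t ht => ?_)
    (setLIntegral_le_lintegral (Ioo 0 δ) _)
  by_cases htS : t < S
  · have h3 := hW.nonneg (layer W a b ε (α, t))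
    rw [indicator_of_mem (show t ∈ Ioo 0 S from ⟨ht.1, htS⟩), ← ENNReal.ofReal_mul (by positivity)]
    exact ENNReal.ofReal_le_ofReal
      (mul_le_mul_of_nonneg_left (hJ t ⟨ht.1, htS⟩) (by positivity))
  · rw [layer_eq_of_le hW hε hα (not_lt.1 htS), hW.apply_right]
    simp

/-- The normal part is integrated exactly along segments. The tangential part costs the Jacobian
bound `2`, the layer width `εT` and the pointwise constant `16M²`, hence `32M²T ε`. -/
theorem lintegral_energy_le (hΩ : IsC2Domain Ω) (hn : 1 ≤ n) (hC : C.IsThin)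
    (hW : IsSubquadraticDoubleWell W a b) (hε : 0 < ε) (hεδ : ε * travelTime W a b ≤ δ)
    {M : ℝ} (hM : ∀ s ∈ Icc a b, √(W s) ≤ M)
    (hq : AEStronglyMeasurable q (surfaceMeasure Ω)) (hG : AEStronglyMeasurable G (surfaceMeasure Ω))
    (hqI : ∀ᵐ y ∂surfaceMeasure Ω, q y ∈ Icc a b) {c : E n → ℝ}
    (hJ : ∀ y ∈ frontier Ω, ∀ t ∈ Ioo 0 (ε * travelTime W a b),
      C.jacobian (y, t) ≤ 1 + c y * t) :
    ∫⁻ x in Ω, ENNReal.ofReal (W (C.extend b (layer W a b ε) q x) / ε ^ 2 +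
        ‖C.layerGrad W a b ε q G x‖ ^ 2) ≤
      ∫⁻ y, ENNReal.ofReal (1 / ε * geodesicDist W (q y) b + c y * profileMoment W b (q y))
        ∂surfaceMeasure Ω +
      ENNReal.ofReal (32 * M ^ 2 * travelTime W a b) * (ENNReal.ofReal ε *
        ∫⁻ y, ENNReal.ofReal (‖G y‖ ^ 2 / W (q y)) ∂surfaceMeasure Ω) := by
  have hσ := hC.isFiniteMeasure hΩ hn
  set S := ε * travelTime W a b with hS
  have hS0 : 0 < S := mul_pos hε hW.travelTime_pos
  set h1 : E n × ℝ → ℝ≥0∞ := fun p => ENNReal.ofReal (2 * W (layer W a b ε (q p.1, p.2)) / ε ^ 2)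
    with hh1
  set h2 : E n → ℝ≥0∞ := fun y => ENNReal.ofReal (16 * M ^ 2 * (‖G y‖ ^ 2 / W (q y))) with hh2
  have hΨ : AEStronglyMeasurable (fun y => travelTime W a (q y)) (surfaceMeasure Ω) :=
    hW.aestronglyMeasurable_comp hW.continuousOn_travelTime hq hqI
  have hm1 : AEMeasurable h1 ((surfaceMeasure Ω).prod (volume.restrict (Ioo 0 δ))) := by
    have e1 : AEMeasurable (fun p : E n × ℝ => travelTime W a (q p.1))
        ((surfaceMeasure Ω).prod (volume.restrict (Ioo 0 δ))) :=
      hΨ.aemeasurable.comp_quasiMeasurePreserving Measure.quasiMeasurePreserving_fst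
    have e2 : AEMeasurable (fun p : E n × ℝ => travelTime W a (q p.1) + p.2 / ε)
        ((surfaceMeasure Ω).prod (volume.restrict (Ioo 0 δ))) :=
      e1.add (measurable_snd.div_const ε).aemeasurable
    have e3 : Measurable fun r => ENNReal.ofReal (2 * W (heteroclinic W a b r) / ε ^ 2) :=
      ((((hW.continuous.comp hW.continuous_heteroclinic).const_mul 2).div_const
        _).measurable).ennreal_ofReal
    exact e3.comp_aemeasurable e2
  have hm2 : AEMeasurable h2 (surfaceMeasure Ω) := by
    have e1 : AEMeasurable (fun y => W (q y)) (surfaceMeasure Ω) :=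
      hW.continuous.measurable.comp_aemeasurable hq.aemeasurable
    exact (((hG.norm.aemeasurable.pow_const 2).div e1).const_mul _).ennreal_ofReal
  have hle : ∀ᵐ x ∂volume.restrict Ω, ENNReal.ofReal (W (C.extend b (layer W a b ε) q x) / ε ^ 2 +
        ‖C.layerGrad W a b ε q G x‖ ^ 2) ≤
      C.inside.indicator (fun x => h1 (C.foot x, C.depth x)) x +
        (C.inside ∩ C.depth ⁻¹' Iio S).indicator (fun x => h2 (C.foot x)) x := by
    filter_upwards [ae_comp_foot hΩ hn hC hqI] with x hx
    by_cases hxi : x ∈ C.inside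
    · refine (ENNReal.ofReal_le_ofReal
        (norm_layerGrad_sq_le hΩ hC hW hε hM hxi (hx hxi))).trans ?_
      rw [indicator_of_mem hxi]
      refine ENNReal.ofReal_add_le.trans (add_le_add le_rfl ?_)
      by_cases hd : C.depth x ∈ Iio S
      · rw [indicator_of_mem hd, indicator_of_mem (show x ∈ C.inside ∩ C.depth ⁻¹' Iio S from
          ⟨hxi, hd⟩)]
      · rw [indicator_of_notMem hd, ENNReal.ofReal_zero]
        exact zero_le
    · rw [extend_of_notMem hxi, layerGrad, indicator_of_notMem hxi, hW.apply_right]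
      simp
  have hmS : MeasurableSet (C.inside ∩ C.depth ⁻¹' Iio S) :=
    C.measurableSet_inside.inter (C.measurable_depth measurableSet_Iio)
  have hm1' : AEMeasurable (C.inside.indicator (fun x => h1 (C.foot x, C.depth x)))
      (volume.restrict Ω) := by
    rw [aemeasurable_indicator_iff C.measurableSet_inside, C.restrict_restrict_inside]
    exact hm1.comp_quasiMeasurePreserving (quasiMeasurePreserving hΩ hn hC)
  refine (lintegral_mono_ae hle).trans ?_
  rw [lintegral_add_left' hm1', lintegral_indicator C.measurableSet_inside,
    C.restrict_restrict_inside, lintegral_indicator hmS, Measure.restrict_restrict hmS,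
    inter_eq_left.2 (inter_subset_left.trans C.inside_subset), lintegral_inside hΩ hn hC hm1]
  refine add_le_add (lintegral_mono_ae ?_) ?_
  · filter_upwards [IsC2Domain.ae_mem_frontier Ω, hqI] with y hy hqy
    exact (lintegral_layer_le hC hW hε hεδ hy hqy (hJ y hy)).2
  · refine (lintegral_inside_le hΩ hn hC hm2 measurableSet_Iio).trans ?_
    have hvol : volume (Iio S ∩ Ioo 0 δ) ≤ ENNReal.ofReal S := by
      refine (measure_mono (t := Ioo 0 S) fun t ht => ⟨ht.2.1, ht.1⟩).trans_eq ?_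
      rw [Real.volume_Ioo, sub_zero]
    have hM0 : (0 : ℝ) ≤ 16 * M ^ 2 := by positivity
    have hT0 := hW.travelTime_pos.le
    have e : ∫⁻ y, h2 y ∂surfaceMeasure Ω = ENNReal.ofReal (16 * M ^ 2) *
        ∫⁻ y, ENNReal.ofReal (‖G y‖ ^ 2 / W (q y)) ∂surfaceMeasure Ω := by
      rw [← lintegral_const_mul' _ _ ENNReal.ofReal_ne_top]
      simp only [hh2, ENNReal.ofReal_mul hM0]
    have e2 : ENNReal.ofReal (32 * M ^ 2 * travelTime W a b) =
        2 * ENNReal.ofReal (16 * M ^ 2) * ENNReal.ofReal (travelTime W a b) := by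
      have : (2 : ℝ≥0∞) = ENNReal.ofReal 2 := by simp
      rw [this, ← ENNReal.ofReal_mul (by norm_num), ← ENNReal.ofReal_mul (by positivity)]
      ring_nf
    calc _ ≤ 2 * ENNReal.ofReal S * ∫⁻ y, h2 y ∂surfaceMeasure Ω := by gcongr
      _ = _ := by rw [e, e2, hS, ENNReal.ofReal_mul hε.le]; ring

end Collar

/-! ### Traces, convergence and energy of layers with given boundary data -/

variable {n : ℕ} {Ω : Set (E n)} {δ : ℝ} {C : Collar Ω δ} {W : ℝ → ℝ} {a b ε : ℝ} {q g : E n → ℝ}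
  {G : E n → E n}

theorem hasSurfaceGradient_surfaceGradient (hq : MemH1Boundary Ω q) :
    HasSurfaceGradient Ω q (surfaceGradient Ω q) := by
  rw [surfaceGradient, dif_pos hq]
  exact hq.choose_spec

theorem IsC2OnBoundary.aestronglyMeasurable (hg : IsC2OnBoundary Ω g) :
    AEStronglyMeasurable g (surfaceMeasure Ω) := by
  obtain ⟨F, hF, hFg⟩ := hg
  refine hF.continuous.aestronglyMeasurable.congr ?_
  filter_upwards [IsC2Domain.ae_mem_frontier Ω] with y hy using hFg hy

theorem geodesicDist_nonneg (W : ℝ → ℝ) (r s : ℝ) : 0 ≤ geodesicDist W r s := abs_nonneg _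

namespace IsSubquadraticDoubleWell

variable {X : Type*} [MeasurableSpace X] {μ : Measure X} {r : X → ℝ}

theorem integrable_comp (hW : IsSubquadraticDoubleWell W a b) [IsFiniteMeasure μ] {f : ℝ → ℝ}
    (hf : ContinuousOn f (Icc a b)) (hr : AEStronglyMeasurable r μ)
    (hrI : ∀ᵐ y ∂μ, r y ∈ Icc a b) : Integrable (fun y => f (r y)) μ := by
  obtain ⟨K, hK⟩ := isCompact_Icc.exists_bound_of_continuousOn hf
  refine Integrable.of_bound (hW.aestronglyMeasurable_comp hf hr hrI) K ?_
  filter_upwards [hrI] with y hy using hK _ hy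

theorem continuousOn_geodesicDist_right (hW : IsSubquadraticDoubleWell W a b) :
    ContinuousOn (fun s => geodesicDist W s b) (Icc a b) :=
  (hW.continuous_geodesicDist.comp (continuous_id.prodMk continuous_const)).continuousOn

theorem abs_layer_sub_le (hW : IsSubquadraticDoubleWell W a b) {M : ℝ} (hM0 : 0 < M)
    (hM : ∀ s ∈ Icc a b, √(W s) ≤ M) (hε : 0 < ε) {α t : ℝ} (hα : α ∈ Icc a b) (ht : 0 ≤ t) :
    |layer W a b ε (α, t) - α| ≤ M / ε * t := by
  have h := hW.lipschitz_heteroclinic hM0 hM (travelTime W a α + t / ε) (travelTime W a α)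
  rw [hW.heteroclinic_travelTime hα, add_sub_cancel_left, abs_of_nonneg (div_nonneg ht hε.le)] at h
  exact h.trans_eq (by ring)

theorem aestronglyMeasurable_geodesicDist_div (hW : IsSubquadraticDoubleWell W a b) {s : X → ℝ}
    (hr : AEStronglyMeasurable r μ) (hs : AEStronglyMeasurable s μ) (ε : ℝ) :
    AEStronglyMeasurable (fun y => geodesicDist W (r y) (s y) / ε) μ := by
  have hc : Continuous fun p : ℝ × ℝ => geodesicDist W p.1 p.2 / ε :=
    hW.continuous_geodesicDist.div_const ε
  have h := hc.comp_aestronglyMeasurable (hr.prodMk hs)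
  exact h

/-- The squared norm is the integrand of the tangential energy, wells included, since both are `0`
where `W(q) = 0`. -/
theorem memLp_div_sqrt (hW : IsSubquadraticDoubleWell W a b)
    (hq : AEStronglyMeasurable q (surfaceMeasure Ω))
    (hG : AEStronglyMeasurable G (surfaceMeasure Ω))
    (h : ∫⁻ y, ENNReal.ofReal (‖G y‖ ^ 2 / W (q y)) ∂surfaceMeasure Ω < ⊤) :
    MemLp (fun y => (1 / √(W (q y))) • G y) 2 (surfaceMeasure Ω) := by
  have hm : AEStronglyMeasurable (fun y => 1 / √(W (q y))) (surfaceMeasure Ω) :=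
    ((hW.continuous.measurable.sqrt.const_div 1).comp_aemeasurable
      hq.aemeasurable).aestronglyMeasurable
  refine ⟨hm.smul hG, ?_⟩
  rw [eLpNorm_lt_top_iff_lintegral_rpow_enorm_lt_top (by norm_num) (by norm_num)]
  refine lt_of_eq_of_lt (lintegral_congr fun y => ?_) h
  rw [← ofReal_norm, ENNReal.toReal_ofNat, ENNReal.ofReal_rpow_of_nonneg (norm_nonneg _)
    (by norm_num), Real.rpow_ofNat, norm_smul, mul_pow, Real.norm_of_nonneg (by positivity),
    div_pow, Real.sq_sqrt (hW.nonneg _)]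
  congr 1
  ring

end IsSubquadraticDoubleWell

namespace Collar

theorem exists_abs_meanCurvature_le (C : Collar Ω δ) (hΩ : IsC2Domain Ω) :
    ∃ K, ∀ y ∈ frontier Ω, |meanCurvature Ω y| ≤ K :=
  hΩ.isCompact_frontier.exists_bound_of_continuousOn (C.continuousOn_meanCurvature hΩ)

theorem aestronglyMeasurable_meanCurvature (C : Collar Ω δ) (hΩ : IsC2Domain Ω) :
    AEStronglyMeasurable (meanCurvature Ω) (surfaceMeasure Ω) :=
  (C.continuousOn_meanCurvature hΩ).aestronglyMeasurable isClosed_frontier.measurableSet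

theorem hasTrace_layer (hΩ : IsC2Domain Ω) (hn : 1 ≤ n) (hC : C.IsThin)
    (hW : IsSubquadraticDoubleWell W a b) (hε : 0 < ε) (hq : MemLp q 2 (surfaceMeasure Ω))
    (hqI : ∀ᵐ y ∂surfaceMeasure Ω, q y ∈ Icc a b) :
    HasTrace Ω (C.extend b (layer W a b ε) q) q := by
  obtain ⟨M, hM0, hM⟩ := hW.exists_sqrt_le
  refine hasTrace_of_le hΩ hn hC (L := M / ε) (by positivity) hq ?_
  filter_upwards [ae_comp_foot hΩ hn hC hqI] with x hx hxi
  rw [extend_of_mem hxi]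
  exact hW.abs_layer_sub_le hM0 hM hε (hx hxi) hxi.2.le

theorem IsCutoff.hasTrace_extend (hΩ : IsC2Domain Ω) (hn : 1 ≤ n) (hC : C.IsThin) {K : ℝ}
    {H : ℝ × ℝ → ℝ} (hH : IsCutoff δ b K H) (hq : MemLp q 2 (surfaceMeasure Ω))
    (hqH : ∀ᵐ y ∂surfaceMeasure Ω, H (q y, 0) = q y) : HasTrace Ω (C.extend b H q) q := by
  refine hasTrace_of_le hΩ hn hC (L := K) ((abs_nonneg _).trans (hH.abs_le 0)) hq ?_
  filter_upwards [ae_comp_foot hΩ hn hC hqH] with x hx hxi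
  rw [extend_of_mem hxi]
  have := hH.abs_sub_le (q (C.foot x)) (C.depth x)
  rwa [hx hxi, abs_of_nonneg hxi.2.le] at this

theorem extend_layer_add (hW : IsSubquadraticDoubleWell W a b) (hε : 0 < ε) {y : E n}
    (hy : y ∈ frontier Ω) (hqy : q y ∈ Icc a b) {t : ℝ} (ht : t ∈ Ioo 0 δ) :
    C.extend b (layer W a b ε) q (y + t • inwardNormal Ω y) = profile W b (q y) (t / ε) := by
  have htδ : |t| < δ := by rw [abs_of_pos ht.1]; exact ht.2
  have hd := C.depth_add y hy t htδ
  have hx : y + t • inwardNormal Ω y ∈ C.inside := ⟨C.add_mem y hy t htδ, by rw [hd]; exact ht.1⟩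
  rw [extend_of_mem hx, hd, C.foot_add y hy t htδ, hW.profile_eq hqy (div_pos ht.1 hε).le, layer]

theorem extend_of_le_infDist (hΩ : IsC2Domain Ω) {H : ℝ × ℝ → ℝ} {x : E n}
    (hx : δ ≤ Metric.infDist x (frontier Ω)) : C.extend b H q x = b := by
  refine extend_of_notMem fun hxi => ?_
  have hf := C.isFootpoint x hxi.1
  have h1 := Metric.infDist_le_dist_of_mem hf.mem (x := x)
  have h2 : dist x (C.foot x) = |C.depth x| := by
    rw [dist_eq_norm, sub_eq_iff_eq_add'.2 hf.add_eq.symm, norm_smul,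
      hΩ.norm_inwardNormal hf.mem, mul_one, Real.norm_eq_abs]
  linarith [C.abs_depth_lt x hxi.1]

theorem eLpNorm_extend_layer_sub_le (hΩ : IsC2Domain Ω) (hn : 1 ≤ n) (hC : C.IsThin)
    (hW : IsSubquadraticDoubleWell W a b) (hε : 0 < ε)
    (hqI : ∀ᵐ y ∂surfaceMeasure Ω, q y ∈ Icc a b) :
    eLpNorm (fun x => C.extend b (layer W a b ε) q x - b) 1 (volume.restrict Ω) ≤
      2 * ENNReal.ofReal (ε * travelTime W a b) *
        (ENNReal.ofReal (b - a) * surfaceMeasure Ω univ) := by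
  set S := ε * travelTime W a b
  have hmS : MeasurableSet (C.inside ∩ C.depth ⁻¹' Iio S) :=
    C.measurableSet_inside.inter (C.measurable_depth measurableSet_Iio)
  have h0 : ∀ᵐ x ∂volume.restrict Ω, ‖C.extend b (layer W a b ε) q x - b‖ₑ ≤
      (C.inside ∩ C.depth ⁻¹' Iio S).indicator (fun _ => ENNReal.ofReal (b - a)) x := by
    filter_upwards [ae_comp_foot hΩ hn hC hqI] with x hx
    by_cases hxi : x ∈ C.inside
    · rw [extend_of_mem hxi]
      by_cases hd : C.depth x < S
      · rw [indicator_of_mem (show x ∈ C.inside ∩ C.depth ⁻¹' Iio S from ⟨hxi, hd⟩), ← ofReal_norm]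
        refine ENNReal.ofReal_le_ofReal ?_
        have h := hW.heteroclinic_mem_Icc
          (travelTime W a (q (C.foot x)) + C.depth x / ε)
        rw [Real.norm_eq_abs, layer, abs_sub_comm, abs_of_nonneg (by linarith [h.2])]
        linarith [h.1]
      · rw [layer_eq_of_le hW hε (hx hxi) (not_lt.1 hd), sub_self, enorm_zero]
        exact zero_le
    · rw [extend_of_notMem hxi, sub_self, enorm_zero]
      exact zero_le
  rw [eLpNorm_one_eq_lintegral_enorm]
  refine (lintegral_mono_ae h0).trans ?_
  rw [lintegral_indicator hmS, Measure.restrict_restrict hmS,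
    inter_eq_left.2 (inter_subset_left.trans C.inside_subset)]
  refine (lintegral_inside_le hΩ hn hC (h := fun _ => ENNReal.ofReal (b - a)) aemeasurable_const
    measurableSet_Iio).trans ?_
  rw [lintegral_const]
  gcongr
  refine (measure_mono (t := Ioo 0 S) fun t ht => ⟨ht.2.1, ht.1⟩).trans_eq ?_
  rw [Real.volume_Ioo, sub_zero]

theorem integrable_meanCurvature_mul (C : Collar Ω δ) (hΩ : IsC2Domain Ω)
    [IsFiniteMeasure (surfaceMeasure Ω)] (hW : IsSubquadraticDoubleWell W a b)
    (hq : AEStronglyMeasurable q (surfaceMeasure Ω))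
    (hqI : ∀ᵐ y ∂surfaceMeasure Ω, q y ∈ Icc a b) (η : ℝ) :
    Integrable (fun y => (η - meanCurvature Ω y) * profileMoment W b (q y))
      (surfaceMeasure Ω) := by
  obtain ⟨K, hK⟩ := C.exists_abs_meanCurvature_le hΩ
  refine (hW.integrable_comp hW.continuousOn_profileMoment hq hqI).bdd_mul (c := |η| + K)
    (aestronglyMeasurable_const.sub (C.aestronglyMeasurable_meanCurvature hΩ)) ?_
  filter_upwards [IsC2Domain.ae_mem_frontier Ω] with y hy
  exact (norm_sub_le _ _).trans (add_le_add le_rfl (hK y hy))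

theorem integrable_layerEnergy (C : Collar Ω δ) (hΩ : IsC2Domain Ω)
    [IsFiniteMeasure (surfaceMeasure Ω)] (hW : IsSubquadraticDoubleWell W a b)
    (hq : AEStronglyMeasurable q (surfaceMeasure Ω))
    (hqI : ∀ᵐ y ∂surfaceMeasure Ω, q y ∈ Icc a b) (ε η : ℝ) :
    Integrable (fun y => 1 / ε * geodesicDist W (q y) b +
      (η - meanCurvature Ω y) * profileMoment W b (q y)) (surfaceMeasure Ω) :=
  ((hW.integrable_comp (f := fun s => geodesicDist W s b) hW.continuousOn_geodesicDist_right
    hq hqI).const_mul _).add (C.integrable_meanCurvature_mul hΩ hW hq hqI η)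

/-- Only the term with `1/ε` is sensitive to replacing `q` by `g`; the triangle inequality for `d_W`
does so at the price `d_W(q, g)/ε`. -/
theorem integral_layerEnergy_le (C : Collar Ω δ) (hΩ : IsC2Domain Ω)
    [IsFiniteMeasure (surfaceMeasure Ω)] (hW : IsSubquadraticDoubleWell W a b) (hε : 0 < ε)
    (hq : AEStronglyMeasurable q (surfaceMeasure Ω))
    (hqI : ∀ᵐ y ∂surfaceMeasure Ω, q y ∈ Icc a b)
    (hg : AEStronglyMeasurable g (surfaceMeasure Ω))
    (hgI : ∀ᵐ y ∂surfaceMeasure Ω, g y ∈ Icc a b) (η : ℝ)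
    (hd : ∫⁻ y, ENNReal.ofReal (geodesicDist W (q y) (g y) / ε) ∂surfaceMeasure Ω ≠ ⊤) :
    ∫ y, (1 / ε * geodesicDist W (q y) b +
        (η - meanCurvature Ω y) * profileMoment W b (q y)) ∂surfaceMeasure Ω ≤
      1 / ε * ∫ y, geodesicDist W b (g y) ∂surfaceMeasure Ω +
        (∫⁻ y, ENNReal.ofReal (geodesicDist W (q y) (g y) / ε) ∂surfaceMeasure Ω).toReal +
        ∫ y, (η - meanCurvature Ω y) * profileMoment W b (q y) ∂surfaceMeasure Ω := by
  have hiDg : Integrable (fun y => geodesicDist W b (g y)) (surfaceMeasure Ω) := by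
    simp_rw [IsSubquadraticDoubleWell.geodesicDist_comm W b]
    exact hW.integrable_comp (f := fun s => geodesicDist W s b)
      hW.continuousOn_geodesicDist_right hg hgI
  have hiμ := C.integrable_meanCurvature_mul hΩ hW hq hqI η
  have hdm : AEStronglyMeasurable (fun y => geodesicDist W (q y) (g y) / ε) (surfaceMeasure Ω) :=
    hW.aestronglyMeasurable_geodesicDist_div hq hg ε
  have hd0 : ∀ y, 0 ≤ geodesicDist W (q y) (g y) / ε := fun y =>
    div_nonneg (geodesicDist_nonneg W _ _) hε.le
  have hid : Integrable (fun y => geodesicDist W (q y) (g y) / ε) (surfaceMeasure Ω) :=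
    ⟨hdm, by
      rw [hasFiniteIntegral_iff_ofReal (Eventually.of_forall hd0)]
      exact lt_top_iff_ne_top.2 hd⟩
  have hi1 : Integrable (fun y => 1 / ε * geodesicDist W b (g y)) (surfaceMeasure Ω) :=
    hiDg.const_mul _
  have hi2 : Integrable (fun y => 1 / ε * geodesicDist W b (g y) +
      geodesicDist W (q y) (g y) / ε) (surfaceMeasure Ω) := hi1.add hid
  have hi3 : Integrable (fun y => 1 / ε * geodesicDist W b (g y) +
      geodesicDist W (q y) (g y) / ε + (η - meanCurvature Ω y) * profileMoment W b (q y))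
      (surfaceMeasure Ω) := hi2.add hiμ
  have hle : ∀ y, 1 / ε * geodesicDist W (q y) b ≤
      1 / ε * geodesicDist W b (g y) + geodesicDist W (q y) (g y) / ε := fun y => by
    have htri := hW.geodesicDist_triangle (q y) (g y) b
    rw [IsSubquadraticDoubleWell.geodesicDist_comm W b (g y)]
    calc 1 / ε * geodesicDist W (q y) b
        ≤ 1 / ε * (geodesicDist W (q y) (g y) + geodesicDist W (g y) b) :=
          mul_le_mul_of_nonneg_left htri (by positivity)
      _ = _ := by ring
  have hmono := integral_mono (C.integrable_layerEnergy hΩ hW hq hqI ε η) hi3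
    fun y => add_le_add (hle y) le_rfl
  rwa [integral_add hi2 hiμ, integral_add hi1 hid, integral_const_mul,
    integral_eq_lintegral_of_nonneg_ae (Eventually.of_forall hd0) hdm] at hmono

/-- The energy of the layer, up to the tangential part of the gradient and the distance of the
data `q` to `g`. -/
theorem toReal_lintegral_energy_le (hΩ : IsC2Domain Ω) (hn : 1 ≤ n) (hC : C.IsThin)
    (hW : IsSubquadraticDoubleWell W a b) (hε : 0 < ε) (hεδ : ε * travelTime W a b ≤ δ)
    {M : ℝ} (hM : ∀ s ∈ Icc a b, √(W s) ≤ M)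
    (hq : AEStronglyMeasurable q (surfaceMeasure Ω)) (hG : AEStronglyMeasurable G (surfaceMeasure Ω))
    (hqI : ∀ᵐ y ∂surfaceMeasure Ω, q y ∈ Icc a b)
    (hg : AEStronglyMeasurable g (surfaceMeasure Ω))
    (hgI : ∀ᵐ y ∂surfaceMeasure Ω, g y ∈ Icc a b) {η : ℝ}
    (hJ : ∀ y ∈ frontier Ω, ∀ t ∈ Ioo 0 (ε * travelTime W a b),
      C.jacobian (y, t) ≤ 1 + (η - meanCurvature Ω y) * t)
    (hd : ∫⁻ y, ENNReal.ofReal (geodesicDist W (q y) (g y) / ε) ∂surfaceMeasure Ω ≠ ⊤)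
    (hr : ENNReal.ofReal ε * ∫⁻ y, ENNReal.ofReal (‖G y‖ ^ 2 / W (q y)) ∂surfaceMeasure Ω ≠ ⊤) :
    ∫⁻ x in Ω, ENNReal.ofReal (W (C.extend b (layer W a b ε) q x) / ε ^ 2 +
        ‖C.layerGrad W a b ε q G x‖ ^ 2) ≠ ⊤ ∧
    (∫⁻ x in Ω, ENNReal.ofReal (W (C.extend b (layer W a b ε) q x) / ε ^ 2 +
        ‖C.layerGrad W a b ε q G x‖ ^ 2)).toReal ≤
      1 / ε * ∫ y, geodesicDist W b (g y) ∂surfaceMeasure Ω +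
        (∫⁻ y, ENNReal.ofReal (geodesicDist W (q y) (g y) / ε) ∂surfaceMeasure Ω).toReal +
        ∫ y, (η - meanCurvature Ω y) * profileMoment W b (q y) ∂surfaceMeasure Ω +
        32 * M ^ 2 * travelTime W a b * (ENNReal.ofReal ε *
          ∫⁻ y, ENNReal.ofReal (‖G y‖ ^ 2 / W (q y)) ∂surfaceMeasure Ω).toReal := by
  have hσ := hC.isFiniteMeasure hΩ hn
  have hT := hW.travelTime_pos.le
  have hfi := C.integrable_layerEnergy hΩ hW hq hqI ε η
  have hle := C.integral_layerEnergy_le hΩ hW hε hq hqI hg hgI η hd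
  have hf0 : 0 ≤ᵐ[surfaceMeasure Ω] fun y => 1 / ε * geodesicDist W (q y) b +
      (η - meanCurvature Ω y) * profileMoment W b (q y) := by
    filter_upwards [IsC2Domain.ae_mem_frontier Ω, hqI] with y hy hqy
    exact (lintegral_layer_le hC hW hε hεδ hy hqy (hJ y hy)).1
  have hE := lintegral_energy_le hΩ hn hC hW hε hεδ hM hq hG hqI
    (c := fun y => η - meanCurvature Ω y) hJ
  rw [← ofReal_integral_eq_lintegral_ofReal hfi hf0] at hE
  generalize ENNReal.ofReal ε * ∫⁻ y, ENNReal.ofReal (‖G y‖ ^ 2 / W (q y)) ∂surfaceMeasure Ω = r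
    at hr hE ⊢
  have hK : 0 ≤ 32 * M ^ 2 * travelTime W a b := by positivity
  have hI := integral_nonneg_of_ae hf0
  rw [← ENNReal.ofReal_toReal hr, ← ENNReal.ofReal_mul hK,
    ← ENNReal.ofReal_add hI (mul_nonneg hK ENNReal.toReal_nonneg)] at hE
  refine ⟨(hE.trans_lt ENNReal.ofReal_lt_top).ne, ?_⟩
  refine (ENNReal.toReal_le_of_le_ofReal ?_ hE).trans (add_le_add hle le_rfl)
  exact add_nonneg hI (mul_nonneg hK ENNReal.toReal_nonneg)

end Collar

/-! ### Passage to the limit -/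

variable {n : ℕ} {Ω : Set (E n)} {δ : ℝ} {C : Collar Ω δ} {W : ℝ → ℝ} {a b ε : ℝ} {g : E n → ℝ}
  {gε : ℝ → E n → ℝ}

theorem IsLimitDatum.ae_mem_Icc (hg : IsLimitDatum Ω a b g) :
    ∀ᵐ y ∂surfaceMeasure Ω, g y ∈ Icc a b := by
  filter_upwards [IsC2Domain.ae_mem_frontier Ω] with y hy using hg.mem_Icc y hy

namespace IsApproximatingData

theorem hasSurfaceGradient (h : IsApproximatingData Ω W a b g gε) (hε : 0 < ε) :
    HasSurfaceGradient Ω (gε ε) (surfaceGradient Ω (gε ε)) :=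
  hasSurfaceGradient_surfaceGradient (h.memH1 ε hε)

theorem eventually_lintegral_lt_top (h : IsApproximatingData Ω W a b g gε) :
    ∀ᶠ ε in 𝓝[>] (0 : ℝ), ∫⁻ y, ENNReal.ofReal (‖surfaceGradient Ω (gε ε) y‖ ^ 2 / W (gε ε y))
      ∂surfaceMeasure Ω < ⊤ := by
  filter_upwards [h.tendsto_gradient.eventually (gt_mem_nhds one_pos), self_mem_nhdsWithin]
    with ε h1 hε
  refine lt_top_iff_ne_top.2 fun htop => ?_
  rw [htop, ENNReal.mul_top (ENNReal.ofReal_pos.2 hε).ne'] at h1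
  exact not_top_lt h1

/-- Dominated convergence: the moment is continuous and bounded on `[a, b]`, the curvature is
bounded, and the data converge almost everywhere. -/
theorem tendsto_integral_profileMoment (h : IsApproximatingData Ω W a b g gε)
    (hW : IsSubquadraticDoubleWell W a b) (hg : IsLimitDatum Ω a b g)
    [IsFiniteMeasure (surfaceMeasure Ω)] (C : Collar Ω δ) (hΩ : IsC2Domain Ω) (η : ℝ) :
    Tendsto (fun ε => ∫ y, (η - meanCurvature Ω y) * profileMoment W b (gε ε y)
        ∂surfaceMeasure Ω) (𝓝[>] 0)
      (𝓝 (∫ y, (η - meanCurvature Ω y) * profileMoment W b (g y) ∂surfaceMeasure Ω)) := by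
  obtain ⟨K, hK⟩ := C.exists_abs_meanCurvature_le hΩ
  obtain ⟨B, hB⟩ := isCompact_Icc.exists_bound_of_continuousOn hW.continuousOn_profileMoment
  have hc := hW.continuous_comp_clamp hW.continuousOn_profileMoment
  set P : ℝ → ℝ := fun s => profileMoment W b (max a (min b s)) with hP
  have hPg : ∫ y, (η - meanCurvature Ω y) * profileMoment W b (g y) ∂surfaceMeasure Ω =
      ∫ y, (η - meanCurvature Ω y) * P (g y) ∂surfaceMeasure Ω := by
    refine integral_congr_ae ?_
    filter_upwards [hg.ae_mem_Icc] with y hy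
    simp only [hP, IsSubquadraticDoubleWell.clamp_eq hy]
  have hPε : ∀ᶠ ε in 𝓝[>] (0 : ℝ), ∫ y, (η - meanCurvature Ω y) * P (gε ε y) ∂surfaceMeasure Ω =
      ∫ y, (η - meanCurvature Ω y) * profileMoment W b (gε ε y) ∂surfaceMeasure Ω := by
    filter_upwards [self_mem_nhdsWithin] with ε hε
    refine integral_congr_ae ?_
    filter_upwards [h.mem_Icc ε hε] with y hy
    simp only [hP, IsSubquadraticDoubleWell.clamp_eq hy]
  rw [hPg]
  refine Tendsto.congr' hPε ?_
  refine tendsto_integral_filter_of_dominated_convergence (fun _ => (|η| + K) * B) ?_ ?_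
    (integrable_const _) ?_
  · filter_upwards [self_mem_nhdsWithin] with ε hε
    exact (aestronglyMeasurable_const.sub (C.aestronglyMeasurable_meanCurvature hΩ)).mul
      (hc.comp_aestronglyMeasurable (h.hasSurfaceGradient hε).1.1)
  · refine Eventually.of_forall fun ε => ?_
    filter_upwards [IsC2Domain.ae_mem_frontier Ω] with y hy
    rw [norm_mul]
    have h1 : ‖η - meanCurvature Ω y‖ ≤ |η| + K :=
      (norm_sub_le _ _).trans (add_le_add le_rfl (hK y hy))
    exact mul_le_mul h1 (hB _ (hW.clamp_mem_Icc _)) (norm_nonneg _) ((norm_nonneg _).trans h1)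
  · filter_upwards [h.tendsto_ae] with y hy
    exact ((hc.tendsto _).comp hy).const_mul _

end IsApproximatingData

/-- Every number above the limit energy eventually bounds the energies of the layers. -/
theorem eventually_secondOrderFunctional_le (hn : 1 ≤ n) (hΩ : IsC2Domain Ω) (hC : C.IsThin)
    (hW : IsSubquadraticDoubleWell W a b) (hg : IsLimitDatum Ω a b g)
    (hgε : IsApproximatingData Ω W a b g gε) {c : ℝ} (hc : secondOrderLimit Ω W b g < c) :
    ∀ᶠ ε in 𝓝[>] (0 : ℝ), secondOrderFunctional Ω W b g (gε ε) ε
      (C.extend b (layer W a b ε) (gε ε)) ≤ (c : EReal) := by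
  have hσ := hC.isFiniteMeasure hΩ hn
  have hT := hW.travelTime_pos
  have hgm := hg.isC2.aestronglyMeasurable
  have hgI := hg.ae_mem_Icc
  obtain ⟨M, hM0, hM⟩ := hW.exists_sqrt_le
  set m := ∫ y, profileMoment W b (g y) ∂surfaceMeasure Ω with hm
  have hm0 : 0 ≤ m := integral_nonneg fun y => profileMoment_nonneg W b _
  -- This choice gives `ηm < c - secondOrderLimit`; the `+ 1` covers the case `m = 0`.
  set η := (c - secondOrderLimit Ω W b g) / (m + 1) with hη
  have hη0 : 0 < η := div_pos (sub_pos.2 hc) (by linarith)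
  have hlim : ∫ y, (η - meanCurvature Ω y) * profileMoment W b (g y) ∂surfaceMeasure Ω < c := by
    have hi0 := C.integrable_meanCurvature_mul hΩ hW hgm hgI 0
    have hi1 : Integrable (fun y => profileMoment W b (g y)) (surfaceMeasure Ω) :=
      hW.integrable_comp hW.continuousOn_profileMoment hgm hgI
    have e : ∫ y, (η - meanCurvature Ω y) * profileMoment W b (g y) ∂surfaceMeasure Ω =
        η * m + secondOrderLimit Ω W b g := by
      have e0 : secondOrderLimit Ω W b g =
          ∫ y, (0 - meanCurvature Ω y) * profileMoment W b (g y) ∂surfaceMeasure Ω := by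
        simp only [zero_sub]
        rfl
      rw [e0, hm, ← integral_const_mul, ← integral_add (hi1.const_mul η) hi0]
      exact integral_congr_ae (Eventually.of_forall fun y => by ring)
    have : η * (m + 1) = c - secondOrderLimit Ω W b g := div_mul_cancel₀ _ (by linarith)
    rw [e]
    linarith
  obtain ⟨τ, hτ, hJ⟩ := C.exists_jacobian_sub_le hΩ hη0
  set d : ℝ → ℝ≥0∞ := fun ε =>
    ∫⁻ y, ENNReal.ofReal (geodesicDist W (gε ε y) (g y) / ε) ∂surfaceMeasure Ω with hd
  set r : ℝ → ℝ≥0∞ := fun ε => ENNReal.ofReal ε *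
    ∫⁻ y, ENNReal.ofReal (‖surfaceGradient Ω (gε ε) y‖ ^ 2 / W (gε ε y)) ∂surfaceMeasure Ω with hr
  have hd0 : Tendsto d (𝓝[>] 0) (𝓝 0) := hgε.tendsto_dist
  have hr0 : Tendsto r (𝓝[>] 0) (𝓝 0) := hgε.tendsto_gradient
  have hsum : Tendsto (fun ε => (d ε).toReal +
      ∫ y, (η - meanCurvature Ω y) * profileMoment W b (gε ε y) ∂surfaceMeasure Ω +
      32 * M ^ 2 * travelTime W a b * (r ε).toReal) (𝓝[>] 0)
      (𝓝 (0 + ∫ y, (η - meanCurvature Ω y) * profileMoment W b (g y) ∂surfaceMeasure Ω +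
        32 * M ^ 2 * travelTime W a b * 0)) :=
    (((ENNReal.tendsto_toReal ENNReal.zero_ne_top).comp hd0).add
      (hgε.tendsto_integral_profileMoment hW hg C hΩ η)).add
      (((ENNReal.tendsto_toReal ENNReal.zero_ne_top).comp hr0).const_mul _)
  rw [zero_add, mul_zero, add_zero] at hsum
  -- Below this threshold the layer stays where the Jacobian expansion holds and within half the
  -- collar.
  have hpos : 0 < min τ (δ / 2) / travelTime W a b :=
    div_pos (lt_min hτ (half_pos C.pos)) hT
  filter_upwards [hsum.eventually (gt_mem_nhds hlim), hgε.eventually_lintegral_lt_top,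
    hd0.eventually (gt_mem_nhds one_pos), hr0.eventually (gt_mem_nhds one_pos),
    Ioo_mem_nhdsGT hpos] with ε hεc hfin hd1 hr1 hε
  have hεT : ε * travelTime W a b < min τ (δ / 2) := (lt_div_iff₀ hT).1 hε.2
  have hεδ : ε * travelTime W a b ≤ δ / 2 := hεT.le.trans (min_le_right _ _)
  have hq := hgε.hasSurfaceGradient hε.1
  have hqI := hgε.mem_Icc ε hε.1
  have hgrad := Collar.hasWeakGradient_layer hΩ hn hC hW hε.1 hεδ hq hqI
    (hW.memLp_div_sqrt hq.1.1 hq.2.1.1 hfin)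
  have hJε : ∀ y ∈ frontier Ω, ∀ t ∈ Ioo 0 (ε * travelTime W a b),
      C.jacobian (y, t) ≤ 1 + (η - meanCurvature Ω y) * t := fun y hy t ht => by
    have h1 := hJ y hy t (by
      rw [abs_of_pos ht.1]
      exact (ht.2.trans hεT).trans_le (min_le_left _ _))
    rw [abs_of_pos ht.1] at h1
    have := (abs_le.1 h1).2
    linarith
  obtain ⟨hE1, hE2⟩ := Collar.toReal_lintegral_energy_le hΩ hn hC hW hε.1 (by linarith [C.pos]) hM hq.1.1
    hq.2.1.1 hqI hgm hgI hJε (hd1.trans ENNReal.one_lt_top).ne (hr1.trans ENNReal.one_lt_top).ne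
  rw [secondOrderFunctional, if_pos ⟨⟨_, hgrad⟩, Collar.hasTrace_layer hΩ hn hC hW hε.1 hq.1 hqI⟩]
  set A := 1 / ε * ∫ y, geodesicDist W b (g y) ∂surfaceMeasure Ω with hA
  set u := C.extend b (layer W a b ε) (gε ε) with hu
  have hcongr : ∫⁻ x in Ω, ENNReal.ofReal (W (u x) / ε ^ 2 + ‖weakGradient Ω u x‖ ^ 2) =
      ∫⁻ x in Ω, ENNReal.ofReal (W (u x) / ε ^ 2 +
        ‖C.layerGrad W a b ε (gε ε) (surfaceGradient Ω (gε ε)) x‖ ^ 2) := by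
    refine lintegral_congr_ae ?_
    filter_upwards [weakGradient_ae_eq hΩ hgrad] with x hx
    rw [hx]
  rw [hcongr]
  rw [← EReal.coe_ennreal_toReal hE1, ← EReal.coe_sub, EReal.coe_le_coe_iff]
  linarith

end CahnHilliard

end

/-! ### The recovery family -/

theorem mainTheorem2 (n : ℕ) (hn : 1 ≤ n) (Ω : Set (CahnHilliard.E n))
    (hΩ : CahnHilliard.IsC2Domain Ω)
    (W : ℝ → ℝ) (a b : ℝ) (hW : CahnHilliard.IsSubquadraticDoubleWell W a b)
    (g : CahnHilliard.E n → ℝ) (hg : CahnHilliard.IsLimitDatum Ω a b g)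
    (gε : ℝ → CahnHilliard.E n → ℝ) (hgε : CahnHilliard.IsApproximatingData Ω W a b g gε)
    (hmin : CahnHilliard.IsUniqueMinimizer Ω (CahnHilliard.firstOrderLimit Ω W a b g)
      (fun _ => b)) :
    ∃ u : ℝ → CahnHilliard.E n → ℝ,
      (∀ ε, 0 < ε → MemLp (u ε) 1 (volume.restrict Ω) ∧ CahnHilliard.MemH1 Ω (u ε) ∧
        CahnHilliard.HasTrace Ω (u ε) (gε ε)) ∧
      Tendsto (fun ε => eLpNorm (fun x => u ε x - b) 1 (volume.restrict Ω)) (𝓝[>] 0) (𝓝 0) ∧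
      limsup (fun ε => CahnHilliard.secondOrderFunctional Ω W b g (gε ε) ε (u ε)) (𝓝[>] 0) ≤
        ((CahnHilliard.secondOrderLimit Ω W b g : ℝ) : EReal) ∧
      ∃ δ ε₀ : ℝ, 0 < δ ∧ 0 < ε₀ ∧ ∀ ε, 0 < ε → ε < ε₀ →
        (∀ᵐ y ∂CahnHilliard.surfaceMeasure Ω, ∀ t ∈ Ioo 0 δ,
          u ε (y + t • CahnHilliard.inwardNormal Ω y) =
            CahnHilliard.profile W b (gε ε y) (t / ε)) ∧
        (∀ x ∈ Ω, δ ≤ Metric.infDist x (frontier Ω) → u ε x = b) := by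
  obtain ⟨δ, C, hC⟩ := hΩ.exists_isThin
  have hσ := hC.isFiniteMeasure hΩ hn
  have hΩf : IsFiniteMeasure (volume.restrict Ω) := ⟨by simpa using hΩ.volume_lt_top⟩
  have hT := hW.travelTime_pos
  obtain ⟨K, H, hH, hH0⟩ := C.exists_isCutoff b (max |a| |b| + 1) (by positivity)
  obtain ⟨ε₁, hε₁, hfin⟩ := mem_nhdsGT_iff_exists_Ioo_subset.1 hgε.eventually_lintegral_lt_top
  have hε₁' : 0 < ε₁ := hε₁
  set ε₀ := min ε₁ (δ / 2 / CahnHilliard.travelTime W a b) with hε₀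
  have hε₀pos : 0 < ε₀ := lt_min hε₁' (div_pos (half_pos C.pos) hT)
  -- For `ε ≥ ε₀` the layer may not fit into the collar, or the tangential energy of the data may be
  -- infinite; there only membership in `H¹` and the trace are required, and the cutoff extension
  -- provides them.
  set u : ℝ → CahnHilliard.E n → ℝ := fun ε =>
    if ε < ε₀ then C.extend b (CahnHilliard.layer W a b ε) (gε ε) else C.extend b H (gε ε) with hu
  have hu_lt : ∀ ε, ε < ε₀ → u ε = C.extend b (CahnHilliard.layer W a b ε) (gε ε) :=
    fun ε h => if_pos h
  have hu_ge : ∀ ε, ¬ ε < ε₀ → u ε = C.extend b H (gε ε) := fun ε h => if_neg h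
  have hsmall : ∀ᶠ ε in 𝓝[>] (0 : ℝ), ε ∈ Ioo 0 ε₀ := Ioo_mem_nhdsGT hε₀pos
  refine ⟨u, fun ε hε => ?_, ?_, ?_, δ, ε₀, C.pos, hε₀pos, fun ε hε hεε₀ => ⟨?_, fun x _ hx => ?_⟩⟩
  · have hq := hgε.hasSurfaceGradient hε
    have hqI := hgε.mem_Icc ε hε
    by_cases h : ε < ε₀
    · rw [hu_lt ε h]
      have hεT : ε * CahnHilliard.travelTime W a b ≤ δ / 2 :=
        ((lt_div_iff₀ hT).1 (h.trans_le (min_le_right _ _))).le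
      have hfinε := hfin ⟨hε, h.trans_le (min_le_left _ _)⟩
      have hw := CahnHilliard.Collar.hasWeakGradient_layer hΩ hn hC hW hε hεT hq hqI
        (hW.memLp_div_sqrt hq.1.1 hq.2.1.1 hfinε)
      exact ⟨hw.1.mono_exponent (by norm_num), ⟨_, hw⟩,
        CahnHilliard.Collar.hasTrace_layer hΩ hn hC hW hε hq.1 hqI⟩
    · rw [hu_ge ε h]
      have hw : CahnHilliard.HasWeakGradient Ω (C.extend b H (gε ε)) _ :=
        ⟨CahnHilliard.Collar.memLp_extend hΩ hn hC hH hq.1.1,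
          CahnHilliard.Collar.memLp_extendGrad hΩ hn hC hH hq.1.1 hq.2.1,
          CahnHilliard.Collar.isWeakGradient_extend hΩ hn hC hH hq⟩
      refine ⟨hw.1.mono_exponent (by norm_num), ⟨_, hw⟩, hH.hasTrace_extend hΩ hn hC hq.1 ?_⟩
      filter_upwards [hqI] with y hy
      exact hH0 _ ((abs_le_max_abs_abs hy.1 hy.2).trans (le_add_of_nonneg_right zero_le_one))
  · have hlim : Tendsto (fun ε : ℝ => 2 * ENNReal.ofReal (ε * CahnHilliard.travelTime W a b) *
        (ENNReal.ofReal (b - a) * CahnHilliard.surfaceMeasure Ω univ)) (𝓝[>] 0) (𝓝 0) := by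
      have h1 : Tendsto (fun ε : ℝ => ENNReal.ofReal (ε * CahnHilliard.travelTime W a b)) (𝓝[>] 0)
          (𝓝 (ENNReal.ofReal (0 * CahnHilliard.travelTime W a b))) :=
        (ENNReal.tendsto_ofReal (tendsto_id.mul_const _)).mono_left nhdsWithin_le_nhds
      rw [zero_mul, ENNReal.ofReal_zero] at h1
      have h2 : Tendsto (fun ε : ℝ => 2 * ENNReal.ofReal (ε * CahnHilliard.travelTime W a b))
          (𝓝[>] 0) (𝓝 (2 * 0)) := ENNReal.Tendsto.const_mul h1 (Or.inr (by norm_num))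
      have hfinite : ENNReal.ofReal (b - a) * CahnHilliard.surfaceMeasure Ω univ ≠ ⊤ :=
        ENNReal.mul_ne_top ENNReal.ofReal_ne_top (measure_ne_top _ univ)
      have h3 := ENNReal.Tendsto.mul_const h2 (Or.inr hfinite)
      rwa [mul_zero, zero_mul] at h3
    refine tendsto_of_tendsto_of_tendsto_of_le_of_le' tendsto_const_nhds hlim
      (Eventually.of_forall fun _ => zero_le) ?_
    filter_upwards [hsmall] with ε hε
    rw [hu_lt ε hε.2]
    exact CahnHilliard.Collar.eLpNorm_extend_layer_sub_le hΩ hn hC hW hε.1 (hgε.mem_Icc ε hε.1)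
  -- It suffices that every real `c` above the limit energy eventually bounds the functionals.
  · refine EReal.le_of_forall_lt_iff_le.1 fun c hc => ?_
    refine limsup_le_of_le (by isBoundedDefault) ?_
    filter_upwards [hsmall, CahnHilliard.eventually_secondOrderFunctional_le hn hΩ hC hW hg hgε
      (EReal.coe_lt_coe_iff.1 hc)] with ε hε h
    rwa [hu_lt ε hε.2]
  · filter_upwards [CahnHilliard.IsC2Domain.ae_mem_frontier Ω, hgε.mem_Icc ε hε] with y hy hqy t ht
    rw [hu_lt ε hεε₀]
    exact CahnHilliard.Collar.extend_layer_add hW hε hy hqy ht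
  · rw [hu_lt ε hεε₀]
    exact CahnHilliard.Collar.extend_of_le_infDist hΩ hx
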